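/- Let $\omega=dz^1\wedge dz^3+dz^2\wedge dz^4$ on $\mathbb{C}^4$, let $\mathrm{Sp}(2,\mathbb{C})$ be its symplectic group, with Maurer--Cartan form $\varphi=A^{-1}dA=(\varphi^j_i)$ ($j$ the row, $i$ the column), and let $A_j=A\mathbf e_j$ denote the $j$-th column of $A$. Let $\mathbb{Q}_3$ be the manifold of Lagrangian planes of $\mathbb{C}^4$, with the conformal structure $\mathbf g$ represented by $\varphi^3_1\varphi^4_2-(\varphi^4_1)^2$ with respect to the symplectic frames $A$ with $[A_1\wedge A_2]=P\in\mathbb{Q}_3$. Let $\mathtt S:\mathrm{SL}(2,\mathbb{C})\to\mathrm{Sp}(2,\mathbb{C})$ be the representation on $\mathrm S^3(\mathbb{C}^2)\cong\mathbb{C}^4$, where $\mathbf a_1^3\mapsto\mathbf e_1$, $\mathbf a_1^2\mathbf a_2\mapsto-(2/9)^{1/3}\mathbf e_2$, $\mathbf a_2^3\mapsto\mathbf e_3$, $\mathbf a_1\mathbf a_2^2\mapsto(1/6)^{1/3}\mathbf e_4$; let $\mathrm H=\mathtt S(\mathrm{SL}(2,\mathbb{C}))$ and $\mathrm H_1=\{X\in\mathrm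 H\mid X\mathbf e_1\wedge\mathbf e_1=0\}=\mathtt S(\mathrm{SL}(2,\mathbb{C})_1)$, where $\mathrm{SL}(2,\mathbb{C})_1$ is the group of upper triangular unimodular matrices. Let $S$ be a connected Riemann surface and $f:S\to\mathbb{Q}_3$ an isotropic curve, that is, a nonconstant holomorphic map with $f^*\mathbf g=0$, and suppose that $f(S)$ is not contained in a null ray $\{P\mid \xi\in P\}$, $\xi\ne0$. Let $f^\sharp:S\to\mathbb{CP}^3$ be its Legendre associate: if $f=[\mathbf u_1\wedge\mathbf u_2]$ near $p$ with $\mathbf u_1,\mathbf u_2$ holomorphic, $z$ is a coordinate centred at $p$ and $\omega(\mathbf u_i,\mathbf u_j')=z^{k}n_{ij}$ with $k\ge 0$, $n$ holomorphic and $n_{22}$ nowhere zero, then $f^\sharp=[-n_{22}\mathbf u_1+n_{12}\mathbf u_2]$ near $p$. Let $|\Delta_f|$ and $|\Delta_{f^\sharp}|$ be the sets of critical points of $f$ and $f^\sharp$, let $S_\star=S\setminus(|\Delta_f|\cup|\Delta_{f^\sharp}|)$, and let $\mathcal F_0=\{(p,A)\in S\times\mathrm{Sp}(2,\mathbb{C})\mid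 f(p)=[A_1\wedge A_2]\}$ be the zeroth order frame bundle. Then there is a unique holomorphic reduction $\pi:\mathcal F\to S_\star$ of $\mathcal F_0|_{S_\star}$ to the structure group $\mathrm H_1$ such that $\mathcal F\ni(p,A)\mapsto A$ is an integral manifold of the Pfaffian system $$\varphi^3_1=\varphi^4_1=\varphi^2_1-\varphi^4_2=\varphi^1_1-3\varphi^2_2=4\varphi^1_2-3\varphi^2_4=\varphi^1_4=0,\qquad\varphi^4_2\neq0 .$$ Moreover: 1. There is a meromorphic quartic differential $\delta$ on $S$ such that $\pi^*(\delta)=\varphi^1_3(\varphi^4_2)^3$ on $\mathcal F$. 2. Let $\eta$ be the restriction to $\mathcal F$ of the form $$\begin{pmatrix}\varphi^2_2&-(3/32)^{1/3}\varphi^2_4\\-6^{-1/3}\varphi^4_2&-\varphi^2_2\end{pmatrix}.$$ Then $(\mathcal F,\eta)$ is a meromorphic projective structure on $S$ with singular locus contained in $|\Delta_f|\cup|\Delta_{f^\sharp}|$. That is, the set $|\Delta_f|\cup|\Delta_{f^\sharp}|$ is closed and discrete; $\mathcal F$, with $x\in\mathrm{SL}(2,\mathbb{C})_1$ acting by $(p,A)\mapsto(p,A\,\mathtt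 S(x))$, is a holomorphic principal $\mathrm{SL}(2,\mathbb{C})_1$-bundle over $S_\star$ on which $\eta$ is a holomorphic $\mathfrak{sl}(2,\mathbb{C})$-valued Cartan connection; each $p\in|\Delta_f|\cup|\Delta_{f^\sharp}|$ has an open neighbourhood $U$, containing no other point of this set, and a holomorphic section $\sigma:U\setminus\{p\}\to\mathcal F$ such that $\sigma^*(\eta)$ is meromorphic on $U$; and every point across which $(\mathcal F,\eta)$ does not extend as a projective structure lies in $|\Delta_f|\cup|\Delta_{f^\sharp}|$. -/

import Mathlib

open scoped Manifold Topology

noncomputable section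

namespace IsotropicCurve

/-! ### The symplectic group and the Lagrangian Grassmannian

The indices `1, 2, 3, 4` of the basis of `ℂ⁴` are `0, 1, 2, 3 : Fin 4` here. -/

abbrev C4 : Type := Fin 4 → ℂ

abbrev Mat4 : Type := Matrix (Fin 4) (Fin 4) ℂ

abbrev Mat2 : Type := Matrix (Fin 2) (Fin 2) ℂ

/-- The symplectic form `dz¹ ∧ dz³ + dz² ∧ dz⁴` on `ℂ⁴`. -/
def sympForm (x y : C4) : ℂ := x 0 * y 2 - x 2 * y 0 + (x 1 * y 3 - x 3 * y 1)

/-- `Sp(2, ℂ)`: the matrices that preserve `sympForm`. -/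
def Sp2 : Set Mat4 := {A | ∀ x y : C4, sympForm (A.mulVec x) (A.mulVec y) = sympForm x y}

/-- `ℚ₃`: the Lagrangian planes of `ℂ⁴`. -/
def Q3 : Type :=
  {P : Submodule ℂ C4 // Module.finrank ℂ P = 2 ∧ ∀ x ∈ P, ∀ y ∈ P, sympForm x y = 0}

/-! ### The subgroups `H` and `H₁` -/

/-- `SL(2, ℂ)`. -/
abbrev SL2 : Type := Matrix.SpecialLinearGroup (Fin 2) ℂ

/-- `SL(2, ℂ)₁`: the upper triangular unimodular matrices. -/
def SL2up : Set SL2 := {x | x 1 0 = 0}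

/-- The action of a `2 × 2` matrix `x` on the third symmetric power of `ℂ²`, written in the basis
`a₁a₁a₁, a₁a₁a₂, a₂a₂a₂, a₁a₂a₂`; here `x a₁ = x₁₁ a₁ + x₂₁ a₂` and `x a₂ = x₁₂ a₁ + x₂₂ a₂`. The
`j`-th column contains the coordinates of the image of the `j`-th basis vector. -/
def symCube (x : Mat2) : Mat4 :=
  let a := x 0 0
  let b := x 0 1
  let c := x 1 0
  let d := x 1 1
  !![a ^ 3, a ^ 2 * b, b ^ 3, a * b ^ 2;
     3 * a ^ 2 * c, a ^ 2 * d + 2 * a * b * c, 3 * b ^ 2 * d, 2 * a * b * d + b ^ 2 * c;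
     c ^ 3, c ^ 2 * d, d ^ 3, c * d ^ 2;
     3 * a * c ^ 2, 2 * a * c * d + b * c ^ 2, 3 * b * d ^ 2, a * d ^ 2 + 2 * b * c * d]

/-- The real cube root of a nonnegative real number, as a complex number. -/
def cbrt (r : ℝ) : ℂ := ((r ^ (1 / 3 : ℝ) : ℝ) : ℂ)

/-- The factors of the isomorphism of the third symmetric power of `ℂ²` with `ℂ⁴` given by
`a₁a₁a₁ ↦ e₁`, `a₁a₁a₂ ↦ -(2/9)^(1/3) e₂`, `a₂a₂a₂ ↦ e₃`, `a₁a₂a₂ ↦ (1/6)^(1/3) e₄`. -/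
def fScale : Fin 4 → ℂ := ![1, -cbrt (2 / 9), 1, cbrt (1 / 6)]

/-- The representation of `SL(2, ℂ)` on `ℂ⁴` induced by that on the third symmetric power. -/
def repS (x : SL2) : Mat4 :=
  Matrix.diagonal fScale * symCube x.1 * (Matrix.diagonal fScale)⁻¹

/-- The image `H` of `SL(2, ℂ)` in `Sp(2, ℂ)`. -/
def H : Set Mat4 := Set.range repS

/-- `H₁ = {X ∈ H | X e₁ ∧ e₁ = 0}`. -/
def H1 : Set Mat4 := {X | X ∈ H ∧ ∃ c : ℂ, X.mulVec (Pi.single 0 1) = c • (Pi.single 0 1 : C4)}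

/-! ### Holomorphic maps and forms on a Riemann surface -/

section Surface

variable {S : Type*} [TopologicalSpace S] [ChartedSpace ℂ S]

/-- A vector-valued function is holomorphic on the (open) set `U`. -/
def HolOn (u : S → C4) (U : Set S) : Prop := MDifferentiableOn 𝓘(ℂ, ℂ) 𝓘(ℂ, C4) u U

/-- A matrix-valued function is holomorphic on the (open) set `U`. -/
def MatHolOn {M : Type*} [TopologicalSpace M] [ChartedSpace ℂ M] {m n : Type*}
    (A : M → Matrix m n ℂ) (U : Set M) : Prop :=
  ∀ i j, MDifferentiableOn 𝓘(ℂ, ℂ) 𝓘(ℂ, ℂ) (fun q => A q i j) U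

/-- The differential of a matrix-valued function at `p`, applied to a tangent vector. -/
def matD {M : Type*} [TopologicalSpace M] [ChartedSpace ℂ M] {m n : Type*}
    (A : M → Matrix m n ℂ) (p : M) (v : TangentSpace 𝓘(ℂ, ℂ) p) : Matrix m n ℂ :=
  Matrix.of fun i j => (mfderiv 𝓘(ℂ, ℂ) 𝓘(ℂ, ℂ) (fun q => A q i j) p v : ℂ)

/-- The coordinate vector `∂/∂z` of the preferred chart `z` at `p₀`, at the point with
coordinate `t`. -/
def coordVec (p₀ : S) (t : ℂ) : TangentSpace 𝓘(ℂ, ℂ) ((chartAt ℂ p₀).symm t) :=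
  mfderiv 𝓘(ℂ, ℂ) 𝓘(ℂ, ℂ) (chartAt ℂ p₀).symm t (1 : ℂ)

/-- The derivative of `u` with respect to the preferred chart at `p₀`, at the point `q`. -/
def chartDeriv (p₀ : S) (u : S → C4) (q : S) : C4 :=
  deriv (fun t => u ((chartAt ℂ p₀).symm t)) (chartAt ℂ p₀ q)

/-- `u₁, u₂` are holomorphic on `U` and span the plane `f q` for all `q ∈ U`, i.e.
`f = [u₁ ∧ u₂]` on `U`. -/
structure IsLift (f : S → Q3) (U : Set S) (u : Fin 2 → S → C4) : Prop where
  hol : ∀ i, HolOn (u i) U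
  indep : ∀ q ∈ U, LinearIndependent ℂ (fun i => u i q)
  span : ∀ q ∈ U, (f q).1 = Submodule.span ℂ (Set.range fun i => u i q)

/-- `f : S → ℚ₃` is holomorphic. -/
def IsHolomorphic (f : S → Q3) : Prop :=
  ∀ p : S, ∃ (U : Set S) (u : Fin 2 → S → C4), IsOpen U ∧ p ∈ U ∧ IsLift f U u

/-- The zeroth order frame bundle `{(p, A) | A ∈ Sp(2, ℂ), f(p) = [A₁ ∧ A₂]}` of `f`, where `A_j`
is the `j`-th column of `A`. -/
def frameBundle (f : S → Q3) : Set (S × Mat4) :=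
  {a | a.2 ∈ Sp2 ∧
    (f a.1).1 = Submodule.span ℂ {(fun i => a.2 i 0 : C4), (fun i => a.2 i 1 : C4)}}

/-- The Maurer-Cartan form `A⁻¹ dA` on `S × Sp(2, ℂ)`: its entry in row `j` and column `i` is
`φ^j_i`. -/
def mcForm (a : S × Mat4) : (TangentSpace 𝓘(ℂ, ℂ) a.1 × Mat4) →ₗ[ℂ] Mat4 :=
  (LinearMap.mulLeft ℂ a.2⁻¹).comp (LinearMap.snd ℂ _ _)

/-- `f* g = 0` for the conformal structure `g` of `ℚ₃`, which, in terms of any symplectic frame, is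
represented by `φ³₁ φ⁴₂ - (φ⁴₁)²`. -/
def IsNull (f : S → Q3) : Prop :=
  ∀ (U : Set S) (A : S → Mat4), IsOpen U → MatHolOn A U → (∀ q ∈ U, (q, A q) ∈ frameBundle f) →
    ∀ q ∈ U, ∀ v : TangentSpace 𝓘(ℂ, ℂ) q,
      let φ := mcForm (q, A q) (v, matD A q v)
      φ 2 0 * φ 3 1 - (φ 3 0) ^ 2 = 0

/-- Isotropic curves in `ℚ₃`: nonconstant holomorphic null maps that do not lie in a null ray
`{P | ξ ∈ P}`, `ξ ≠ 0`. -/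
structure IsIsotropicCurve (f : S → Q3) : Prop where
  holomorphic : IsHolomorphic f
  nonconstant : ∃ p q, f p ≠ f q
  null : IsNull f
  not_null_ray : ¬ ∃ ξ : C4, ξ ≠ 0 ∧ ∀ p, ξ ∈ (f p).1

/-- The Legendre associate `f♯` of an isotropic curve, with a point of `ℂℙ³` regarded as a line in
`ℂ⁴`. If `f = [u₁ ∧ u₂]` near `p`, `z` is a coordinate centred at `p`, and
`ω(u_i, u_j') = z ^ k * n_ij` with `n` holomorphic and `n₂₂` nowhere zero, then
`f♯(p) = [-n₂₂ u₁ + n₁₂ u₂]`. (This line does not depend on the choices.) -/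
def legendreAssociate (f : S → Q3) (p : S) : Submodule ℂ C4 :=
  Submodule.span ℂ {v | ∃ (U : Set S) (u : Fin 2 → S → C4) (k : ℕ) (n : S → Mat2),
    IsOpen U ∧ p ∈ U ∧ U ⊆ (chartAt ℂ p).source ∧ IsLift f U u ∧ MatHolOn n U ∧
    (∀ q ∈ U, ∀ i j, sympForm (u i q) (chartDeriv p (u j) q)
      = (chartAt ℂ p q - chartAt ℂ p p) ^ k * n q i j) ∧
    (∀ q ∈ U, n q 1 1 ≠ 0) ∧
    v = -(n p 1 1) • u 0 p + n p 0 1 • u 1 p}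

/-- `p` is a critical point of the map `F` from `S` to a Grassmannian of `ℂ⁴`: the differential
`T_p S → Hom(F p, ℂ⁴ / F p)`, which sends `v` to the map `w(p) ↦ dw(v) mod F p` for local
holomorphic sections `w` of `F`, is zero. -/
def IsCritical (F : S → Submodule ℂ C4) (p : S) : Prop :=
  ∀ (U : Set S) (w : S → C4), IsOpen U → p ∈ U → HolOn w U → (∀ q ∈ U, w q ∈ F q) →
    ∀ v : TangentSpace 𝓘(ℂ, ℂ) p, (mfderiv 𝓘(ℂ, ℂ) 𝓘(ℂ, C4) w p v : C4) ∈ F p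

/-- `|Δ_f| ∪ |Δ_{f♯}|`: the critical points of `f` or of `f♯`. -/
def critSet (f : S → Q3) : Set S :=
  {p | IsCritical (fun q => (f q).1) p ∨ IsCritical (legendreAssociate f) p}

/-! ### Subbundles of `S × Sp(2, ℂ)` -/

/-- `F` is a (holomorphic) reduction to the structure group `G` of the zeroth order frame bundle of
`f`, restricted to `W`. -/
structure IsReduction (f : S → Q3) (W : Set S) (G : Set Mat4) (F : Set (S × Mat4)) : Prop where
  sub : ∀ a ∈ F, a.1 ∈ W ∧ a ∈ frameBundle f
  act : ∀ a ∈ F, ∀ X ∈ G, (a.1, a.2 * X) ∈ F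
  trans : ∀ a ∈ F, ∀ b ∈ F, a.1 = b.1 → ∃ X ∈ G, b.2 = a.2 * X
  section_exists : ∀ p ∈ W, ∃ (U : Set S) (A : S → Mat4), IsOpen U ∧ p ∈ U ∧ MatHolOn A U ∧
    ∀ q ∈ U, (q, A q) ∈ F

/-- The holomorphic tangent space at `a` of a complex submanifold `F` of `S × Mat4`: it consists of
the velocities at `0` of the holomorphic curves in `F` through `a`. -/
def tangent (F : Set (S × Mat4)) (a : S × Mat4) :
    Submodule ℂ (TangentSpace 𝓘(ℂ, ℂ) a.1 × Mat4) :=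
  Submodule.span ℂ {w | ∃ (V : Set ℂ) (γ : ℂ → S) (A : ℂ → Mat4), IsOpen V ∧ (0 : ℂ) ∈ V ∧
    MDifferentiableOn 𝓘(ℂ, ℂ) 𝓘(ℂ, ℂ) γ V ∧ MatHolOn A V ∧ (∀ t ∈ V, (γ t, A t) ∈ F) ∧
    (⟨γ 0, mfderiv 𝓘(ℂ, ℂ) 𝓘(ℂ, ℂ) γ 0 (1 : ℂ)⟩ : TangentBundle 𝓘(ℂ, ℂ) S) = ⟨a.1, w.1⟩ ∧
    A 0 = a.2 ∧ w.2 = matD A (0 : ℂ) (1 : ℂ)}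

/-- `F ∋ (p, A) ↦ A` is an integral manifold of the Pfaffian system
`φ³₁ = φ⁴₁ = φ²₁ - φ⁴₂ = φ¹₁ - 3 φ²₂ = 4 φ¹₂ - 3 φ²₄ = φ¹₄ = 0`, `φ⁴₂ ≠ 0`. -/
def IsIntegralManifold (F : Set (S × Mat4)) : Prop :=
  ∀ a ∈ F,
    (∀ w ∈ tangent F a,
      let φ := mcForm a w
      φ 2 0 = 0 ∧ φ 3 0 = 0 ∧ φ 1 0 - φ 3 1 = 0 ∧ φ 0 0 - 3 * φ 1 1 = 0 ∧
        4 * φ 0 1 - 3 * φ 1 3 = 0 ∧ φ 0 3 = 0) ∧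
    ∃ w ∈ tangent F a, mcForm a w 3 1 ≠ 0

/-! ### Meromorphic differentials -/

/-- `δ` is a meromorphic differential of order `n` on `S`: on each tangent space it is homogeneous
of degree `n` (its values at the poles are irrelevant), and `δ = Z(z) dz ^ n` with `Z` meromorphic
in the coordinates `z`. -/
def IsMeromorphicDifferential (n : ℕ) (δ : ∀ p : S, TangentSpace 𝓘(ℂ, ℂ) p → ℂ) : Prop :=
  (∀ (p : S) (c : ℂ) (v : TangentSpace 𝓘(ℂ, ℂ) p), δ p (c • v) = c ^ n * δ p v) ∧
  ∀ p₀ : S, MeromorphicAt (fun t => δ ((chartAt ℂ p₀).symm t) (coordVec p₀ t)) (chartAt ℂ p₀ p₀)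

/-! ### Projective structures -/

/-- A holomorphic section of `P ⊆ S × Mat4` over `U`. -/
def IsSection (P : Set (S × Mat4)) (U : Set S) (σ : S → Mat4) : Prop :=
  MatHolOn σ U ∧ ∀ q ∈ U, (q, σ q) ∈ P

/-- The coefficient of `dz` in `σ* η`, as a function of the coordinate `z` of the preferred chart at
`p₀`. -/
def pullCoeff (η : ∀ a : S × Mat4, (TangentSpace 𝓘(ℂ, ℂ) a.1 × Mat4) →ₗ[ℂ] Mat2) (σ : S → Mat4)
    (p₀ : S) (t : ℂ) : Mat2 :=
  let q := (chartAt ℂ p₀).symm t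
  η (q, σ q) (coordVec p₀ t, matD σ q (coordVec p₀ t))

/-- `P`, on which `x ∈ SL(2, ℂ)₁` acts by `(p, A) ↦ (p, A * repS x)`, is a holomorphic principal
`SL(2, ℂ)₁`-bundle over the open set `W`, and the restriction of `η` to `P` is a holomorphic Cartan
connection: a projective structure on `W`. -/
structure IsProjectiveStructure (W : Set S) (P : Set (S × Mat4))
    (η : ∀ a : S × Mat4, (TangentSpace 𝓘(ℂ, ℂ) a.1 × Mat4) →ₗ[ℂ] Mat2) : Prop where
  isOpen : IsOpen W
  base : ∀ a ∈ P, a.1 ∈ W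
  act : ∀ a ∈ P, ∀ x ∈ SL2up, (a.1, a.2 * repS x) ∈ P
  simply_trans : ∀ a ∈ P, ∀ b ∈ P, a.1 = b.1 → ∃! x : SL2, x ∈ SL2up ∧ b.2 = a.2 * repS x
  section_exists : ∀ p ∈ W, ∃ (U : Set S) (σ : S → Mat4), IsOpen U ∧ p ∈ U ∧ IsSection P U σ
  /-- `η` is holomorphic. (Together with `vertical` and `equivariant`, this is holomorphy on `P`.) -/
  hol : ∀ (U : Set S) (σ : S → Mat4), IsOpen U → IsSection P U σ → ∀ p ∈ U, ∀ i j,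
    AnalyticAt ℂ (fun t => pullCoeff η σ p t i j) (chartAt ℂ p p)
  /-- `η` is a linear isomorphism of each tangent space of `P` onto `sl(2, ℂ)`. -/
  iso : ∀ a ∈ P, Set.BijOn (η a) (tangent P a) {X : Mat2 | X.trace = 0}
  /-- `η` reproduces the generators of the fundamental vector fields. -/
  vertical : ∀ a ∈ P, ∀ (V : Set ℂ) (x : ℂ → SL2), IsOpen V → (0 : ℂ) ∈ V →
    MatHolOn (fun t => (x t).1) V → (∀ t ∈ V, x t ∈ SL2up) → x 0 = 1 →
    η a (0, matD (fun t => a.2 * repS (x t)) (0 : ℂ) (1 : ℂ))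
      = matD (fun t => (x t).1) (0 : ℂ) (1 : ℂ)
  /-- `R_x* η = Ad(x⁻¹) η`. -/
  equivariant : ∀ a ∈ P, ∀ x ∈ SL2up, ∀ w ∈ tangent P a,
    η (a.1, a.2 * repS x) (w.1, w.2 * repS x) = (x⁻¹).1 * η a w * x.1

/-- `(P, η)` is a projective structure on `S ∖ D`, where `D` is closed and discrete, which is
meromorphic at the points of `D`. -/
structure IsMeromorphicProjectiveStructure (D : Set S) (P : Set (S × Mat4))
    (η : ∀ a : S × Mat4, (TangentSpace 𝓘(ℂ, ℂ) a.1 × Mat4) →ₗ[ℂ] Mat2) : Prop where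
  closed : IsClosed D
  discrete : IsDiscrete D
  projective : IsProjectiveStructure Dᶜ P η
  meromorphic : ∀ p ∈ D, ∃ (U : Set S) (σ : S → Mat4), IsOpen U ∧ U ∩ D = {p} ∧
    IsSection P (U \ {p}) σ ∧
    ∀ i j, MeromorphicAt (fun t => pullCoeff η σ p t i j) (chartAt ℂ p p)

/-- The points across which `(P, η)` cannot be extended as a projective structure. The pair extends
across `p` if and only if there is a section `σ` over a punctured neighbourhood of `p` such that
`σ* η` extends holomorphically to `p`, with nonzero entry in row `2` and column `1` (`σ` then
extends to a section of the extended bundle). -/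
def singularLocus (P : Set (S × Mat4))
    (η : ∀ a : S × Mat4, (TangentSpace 𝓘(ℂ, ℂ) a.1 × Mat4) →ₗ[ℂ] Mat2) : Set S :=
  {p | ¬ ∃ (U : Set S) (σ : S → Mat4) (g : ℂ → Mat2), IsOpen U ∧ p ∈ U ∧
    IsSection P (U \ {p}) σ ∧
    (∀ i j, AnalyticAt ℂ (fun t => g t i j) (chartAt ℂ p p)) ∧
    (∀ᶠ t in 𝓝[≠] (chartAt ℂ p p), pullCoeff η σ p t = g t) ∧
    g (chartAt ℂ p p) 1 0 ≠ 0}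

/-- The form `η = φ²₂ (a₁¹ - a₂²) - 6^(-1/3) φ⁴₂ a₂¹ - (3/32)^(1/3) φ²₄ a₁²`, where `a_i^j` has the
entry `1` in row `i` and column `j`. -/
def etaForm (a : S × Mat4) : (TangentSpace 𝓘(ℂ, ℂ) a.1 × Mat4) →ₗ[ℂ] Mat2 where
  toFun w := !![mcForm a w 1 1, -cbrt (3 / 32) * mcForm a w 1 3;
    -cbrt (1 / 6) * mcForm a w 3 1, -mcForm a w 1 1]
  map_add' v w := by
    ext i j
    fin_cases i <;> fin_cases j <;> simp <;> ring
  map_smul' c w := by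
    ext i j
    fin_cases i <;> fin_cases j <;> simp <;> ring

end Surface

end IsotropicCurve

end

open IsotropicCurve

open scoped Manifold Topology
noncomputable section
namespace IsotropicCurve

/-! Locally an isotropic curve is a constant symplectic matrix `B` applied to the graph of a
symmetric matrix Σ with entries `x, y, z`. For the frame E = `B * graphFrame x y z` the form G =
E⁻¹E' has Σ' as its lower left block, so nullity says det Σ' = 0. Comparing orders of vanishing, and
exchanging the two basis directions if necessary, one gets Σ' = z' · (s², -s; -s, 1) with `s`
holomorphic: the curve is encoded by the two functions `z` and `s` (`exists_isNormalForm`). The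
kernel of Σ' is spanned by (1, s). The corresponding vector ξ of the plane spans the Legendre
associate, and ξ' is s' times another vector of the plane. Hence `f` is critical exactly where z' =
0, and its associate exactly where s' = 0. If z' vanished identically, `f` would be constant; if s'
did, a fixed ξ would lie in all planes and `f` would lie in a null ray. The identity theorem
excludes both, so critical points are isolated.

Where z's' ≠ 0, look for an adapted frame EM. Its Maurer-Cartan form is Φ if and only if M' = MΦ -
GM. With `s` as parameter, this is solved explicitly by `gaugeMat`, whose entries are rational in
derivatives of `z` and `s` (`matDerivAt_gaugeMat`). Conversely, for any adapted frame the Pfaffian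
equations put the first column on the Legendre line and tie its length to the cube of the transverse
component of the second column. The two parameters of `H1` then bring both columns to the form they
have in `gaugeMat`, and the symplectic relations together with repeated differentiation determine
all other entries (`exists_mul_upMat_eq_gaugeMat`, `eq_gaugeMat_of_cols`). So the adapted frames
over a noncritical point form one orbit of `H1`. They make up `adaptedBundle`, and every other
reduction that is an integral manifold coincides with it.

A tangent vector of the bundle is dσ(v) plus σ times an element `pfaffForm α 0 β 0` of the Lie
algebra of `H1` (`mem_tangent_iff`). A general value `pfaffForm p h r c` is the image under the
differential of the representation of the 2 × 2 matrix η, plus c in the entry φ¹₃. By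
`upMat_conj_pfaffForm`, conjugation multiplies h by a² and c by a⁻⁶, while vertical vectors have h =
c = 0. Therefore h³c descends to a quartic differential on the surface. The same formula gives the
equivariance of η, and h ≠ 0 makes η an isomorphism on each tangent space. Since `z` and `s` stay
holomorphic across the critical points, the coefficients of the explicit frame are meromorphic
there, and so are the quartic differential and the projective structure. -/

/-! ### Symplectic matrices -/

/-- The Gram matrix of `sympForm`. -/
def gram : Mat4 := !![0, 0, 1, 0; 0, 0, 0, 1; -1, 0, 0, 0; 0, -1, 0, 0]

lemma gram_mul_gram : gram * gram = -1 := by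
  ext i j; fin_cases i <;> fin_cases j <;> simp [gram, Matrix.mul_apply, Fin.sum_univ_four]

lemma sympForm_eq (x y : C4) : sympForm x y = x ⬝ᵥ gram.mulVec y := by
  simp [sympForm, gram, Matrix.mulVec, dotProduct, Fin.sum_univ_four]; ring

lemma sympForm_add_left (x y w : C4) : sympForm (x + y) w = sympForm x w + sympForm y w := by
  simp [sympForm]; ring

lemma sympForm_add_right (x y w : C4) : sympForm x (y + w) = sympForm x y + sympForm x w := by
  simp [sympForm]; ring

lemma sympForm_smul_left (c : ℂ) (x w : C4) : sympForm (c • x) w = c * sympForm x w := by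
  simp [sympForm]; ring

lemma sympForm_smul_right (c : ℂ) (x w : C4) : sympForm x (c • w) = c * sympForm x w := by
  simp [sympForm]; ring

lemma sympForm_swap (x y : C4) : sympForm y x = -sympForm x y := by
  simp [sympForm]; ring

lemma sympForm_self (x : C4) : sympForm x x = 0 := by
  simp [sympForm]; ring

lemma transpose_mul_gram_mul_apply (A : Mat4) (j k : Fin 4) :
    (A.transpose * gram * A) j k = sympForm (fun i => A i j) (fun i => A i k) := by
  simp [sympForm, gram, Matrix.mul_apply, Fin.sum_univ_four]; ring

lemma mem_Sp2_iff {A : Mat4} : A ∈ Sp2 ↔ A.transpose * gram * A = gram := by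
  have key : ∀ x y : C4, sympForm (A.mulVec x) (A.mulVec y) =
      x ⬝ᵥ (A.transpose * gram * A).mulVec y := by
    intro x y
    rw [sympForm_eq, ← Matrix.mulVec_mulVec, ← Matrix.mulVec_mulVec, Matrix.dotProduct_mulVec x,
      Matrix.vecMul_transpose]
  constructor
  · intro h
    ext j k
    have := h (Pi.single j 1) (Pi.single k 1)
    rw [key, sympForm_eq] at this
    simpa using this
  · intro h x y
    rw [key, h, sympForm_eq]

lemma mem_Sp2_iff_col {A : Mat4} :
    A ∈ Sp2 ↔ ∀ j k, sympForm (fun i => A i j) (fun i => A i k) = gram j k := by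
  rw [mem_Sp2_iff, ← Matrix.ext_iff]
  simp only [transpose_mul_gram_mul_apply]

/-- J² = -1 turns AᵀJA = J into a left inverse that is polynomial in the entries of A. This is what
makes inverses of holomorphic symplectic frames holomorphic without dividing by a determinant. -/
lemma Sp2_inv_mul {A : Mat4} (hA : A ∈ Sp2) : -(gram * A.transpose * gram) * A = 1 := by
  rw [mem_Sp2_iff] at hA
  rw [neg_mul, Matrix.mul_assoc gram, Matrix.mul_assoc gram, hA, gram_mul_gram, neg_neg]

lemma Sp2_inv {A : Mat4} (hA : A ∈ Sp2) : A⁻¹ = -(gram * A.transpose * gram) :=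
  Matrix.inv_eq_left_inv (Sp2_inv_mul hA)

lemma Sp2_isUnit {A : Mat4} (hA : A ∈ Sp2) : IsUnit A.det :=
  Matrix.isUnit_det_of_left_inverse (Sp2_inv_mul hA)

lemma Sp2_nonsing_inv_mul {A : Mat4} (hA : A ∈ Sp2) : A⁻¹ * A = 1 :=
  Matrix.nonsing_inv_mul _ (Sp2_isUnit hA)

lemma Sp2_mul_nonsing_inv {A : Mat4} (hA : A ∈ Sp2) : A * A⁻¹ = 1 :=
  Matrix.mul_nonsing_inv _ (Sp2_isUnit hA)

lemma Sp2_inv_mul_cancel {A : Mat4} (hA : A ∈ Sp2) {n : Type*} (M : Matrix (Fin 4) n ℂ) :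
    A⁻¹ * (A * M) = M := by
  rw [← Matrix.mul_assoc, Sp2_nonsing_inv_mul hA, Matrix.one_mul]

lemma Sp2_mul_inv_cancel {A : Mat4} (hA : A ∈ Sp2) {n : Type*} (M : Matrix (Fin 4) n ℂ) :
    A * (A⁻¹ * M) = M := by
  rw [← Matrix.mul_assoc, Sp2_mul_nonsing_inv hA, Matrix.one_mul]

lemma Sp2_mul {A B : Mat4} (hA : A ∈ Sp2) (hB : B ∈ Sp2) : A * B ∈ Sp2 := by
  intro x y
  rw [← Matrix.mulVec_mulVec, ← Matrix.mulVec_mulVec, hA, hB]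

lemma Sp2_inv_mem {A : Mat4} (hA : A ∈ Sp2) : A⁻¹ ∈ Sp2 := by
  intro x y
  rw [← hA, Matrix.mulVec_mulVec, Matrix.mulVec_mulVec, Sp2_mul_nonsing_inv hA, Matrix.one_mulVec,
    Matrix.one_mulVec]

lemma Sp2_mulVec_inv {A : Mat4} (hA : A ∈ Sp2) (x : C4) : A.mulVec (A⁻¹.mulVec x) = x := by
  rw [Matrix.mulVec_mulVec, Sp2_mul_nonsing_inv hA, Matrix.one_mulVec]

lemma Sp2_inv_mulVec {A : Mat4} (hA : A ∈ Sp2) (x : C4) : A⁻¹.mulVec (A.mulVec x) = x := by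
  rw [Matrix.mulVec_mulVec, Sp2_nonsing_inv_mul hA, Matrix.one_mulVec]

/-! ### Symplectic frames of Lagrangian planes -/

lemma exists_sympForm_eq {u v : C4} (h : LinearIndependent ℂ ![u, v]) :
    ∃ y, sympForm u y = 1 ∧ sympForm v y = 0 := by
  let L : C4 → (C4 →ₗ[ℂ] ℂ) := fun u =>
    { toFun := sympForm u
      map_add' := sympForm_add_right u
      map_smul' := fun c y => by simp [sympForm_smul_right] }
  -- If no such y exists, the kernel of ω(v, ·) lies in that of ω(u, ·), so ω(u, ·) is a multiple of
  -- ω(v, ·). Evaluating on the basis vectors makes u a multiple of v.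
  by_contra hcon
  have hker : ⨅ _ : Unit, (L v).ker ≤ (L u).ker := by
    intro y hy
    simp only [ciInf_const, LinearMap.mem_ker] at hy ⊢
    by_contra hne
    refine hcon ⟨(sympForm u y)⁻¹ • y, ?_, ?_⟩
    · rw [sympForm_smul_right]; exact inv_mul_cancel₀ hne
    · rw [sympForm_smul_right]; exact mul_eq_zero_of_right _ hy
  have hmem := FiniteDimensional.mem_span_of_iInf_ker_le_ker hker
  rw [Set.range_const, Submodule.mem_span_singleton] at hmem
  obtain ⟨c, hc⟩ := hmem
  have hc' : ∀ y, c * sympForm v y = sympForm u y := fun y => by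
    simpa [L] using LinearMap.congr_fun hc y
  have huv : (1 : ℂ) • u + (-c) • v = 0 := by
    ext i
    have h0 := hc' (Pi.single 2 1)
    have h1 := hc' (Pi.single 3 1)
    have h2 := hc' (Pi.single 0 1)
    have h3 := hc' (Pi.single 1 1)
    simp [sympForm] at h0 h1 h2 h3
    fin_cases i <;> simp
    · rw [h0]; ring
    · rw [h1]; ring
    · rw [h2]; ring
    · rw [h3]; ring
  exact one_ne_zero (LinearIndependent.pair_iff.1 h _ _ huv).1

/-- The matrix with columns `u₀, u₁, u₂, u₃`. -/
def ofCols (u : Fin 4 → C4) : Mat4 := Matrix.of fun i j => u j i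

lemma exists_symplectic_frame (P : Q3) : ∃ B ∈ Sp2,
    P.1 = Submodule.span ℂ {(fun i => B i 0 : C4), (fun i => B i 1 : C4)} := by
  obtain ⟨P, hdim, hlag⟩ := P
  have : Module.Finite ℂ P := inferInstance
  let b := Module.finBasisOfFinrankEq ℂ P hdim
  have hr : Set.range (fun i => (b i : C4)) = {(b 0 : C4), (b 1 : C4)} := by
    ext y
    simp [Fin.exists_fin_two, eq_comm]
  have hspan : Submodule.span ℂ {(b 0 : C4), (b 1 : C4)} = P := by
    have h1 := congrArg (Submodule.map P.subtype) b.span_eq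
    rw [Submodule.map_span, Submodule.map_top, Submodule.range_subtype, ← Set.range_comp] at h1
    rw [← hr]
    exact h1
  have hind : LinearIndependent ℂ ![(b 0 : C4), (b 1 : C4)] := by
    have h1 := b.linearIndependent.map' P.subtype (Submodule.ker_subtype P)
    have e : ![(b 0 : C4), (b 1 : C4)] = P.subtype ∘ b := by
      ext i; fin_cases i <;> rfl
    rw [e]; exact h1
  have hind' : LinearIndependent ℂ ![(b 1 : C4), (b 0 : C4)] := by
    rw [LinearIndependent.pair_iff] at hind ⊢
    intro s t h
    rw [add_comm] at h
    exact (hind t s h).symm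
  obtain ⟨y, hy0, hy1⟩ := exists_sympForm_eq hind
  obtain ⟨w, hw1, hw0⟩ := exists_sympForm_eq hind'
  have hlag' := hlag _ (b 0).2 _ (b 1).2
  -- The multiple of `b 0` added to `w` makes the fourth column orthogonal to `y`. It does not
  -- change the pairings with `b 0` and `b 1`, because the plane is Lagrangian.
  refine ⟨ofCols ![b 0, b 1, y, w + sympForm y w • (b 0 : C4)], ?_, ?_⟩
  · rw [mem_Sp2_iff_col]
    intro j k
    have e : ∀ j, (fun i => ofCols ![b 0, b 1, y, w + sympForm y w • (b 0 : C4)] i j) =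
      (![b 0, b 1, y, w + sympForm y w • (b 0 : C4)] : Fin 4 → C4) j := fun j => rfl
    rw [e, e]
    have s1 := sympForm_swap (b 0 : C4) (b 1)
    have s2 := sympForm_swap (b 0 : C4) y
    have s3 := sympForm_swap (b 0 : C4) w
    have s4 := sympForm_swap (b 1 : C4) y
    have s5 := sympForm_swap (b 1 : C4) w
    have s6 := sympForm_swap y w
    fin_cases j <;> fin_cases k <;>
      simp [gram, sympForm_add_left, sympForm_add_right, sympForm_smul_left, sympForm_smul_right,
        sympForm_self, hlag', hy0, hy1, hw0, hw1, s1, s2, s3, s4, s5, s6]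
  · exact hspan.symm

lemma mem_span_cols_iff {B : Mat4} {x : C4} (hB : B ∈ Sp2) :
    x ∈ Submodule.span ℂ {(fun i => B i 0 : C4), (fun i => B i 1 : C4)} ↔
      (B⁻¹.mulVec x) 2 = 0 ∧ (B⁻¹.mulVec x) 3 = 0 := by
  rw [Submodule.mem_span_pair]
  constructor
  · rintro ⟨a, b, rfl⟩
    have : a • (fun i => B i 0 : C4) + b • (fun i => B i 1 : C4) = B.mulVec ![a, b, 0, 0] := by
      ext i; simp [Matrix.mulVec, dotProduct, Fin.sum_univ_four]; ring
    rw [this, Sp2_inv_mulVec hB]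
    simp
  · rintro ⟨h2, h3⟩
    refine ⟨(B⁻¹.mulVec x) 0, (B⁻¹.mulVec x) 1, ?_⟩
    conv_rhs => rw [← Sp2_mulVec_inv hB x]
    ext i
    simp [Matrix.mulVec, dotProduct, Fin.sum_univ_four] at h2 h3 ⊢
    rw [h2, h3]; ring

/-! ### The Lie algebra of the Pfaffian system -/

/-- The Pfaffian system. -/
def IsPfaffian (φ : Mat4) : Prop :=
  φ 2 0 = 0 ∧ φ 3 0 = 0 ∧ φ 1 0 - φ 3 1 = 0 ∧ φ 0 0 - 3 * φ 1 1 = 0 ∧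
    4 * φ 0 1 - 3 * φ 1 3 = 0 ∧ φ 0 3 = 0

/-- The general element of `sp(2, ℂ)` that satisfies the Pfaffian system. -/
def pfaffForm (p h r s : ℂ) : Mat4 :=
  !![3 * p, 3 / 4 * r, s, 0; h, p, 0, r; 0, 0, -(3 * p), -h; 0, h, -(3 / 4 * r), -p]

lemma isPfaffian_pfaffForm (p h r s : ℂ) : IsPfaffian (pfaffForm p h r s) := by
  simp [IsPfaffian, pfaffForm]; ring

lemma pfaffForm_add (p h r s p' h' r' s' : ℂ) : pfaffForm p h r s + pfaffForm p' h' r' s' =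
    pfaffForm (p + p') (h + h') (r + r') (s + s') := by
  ext i j; fin_cases i <;> fin_cases j <;> simp [pfaffForm] <;> ring

lemma smul_pfaffForm (c p h r s : ℂ) : c • pfaffForm p h r s =
    pfaffForm (c * p) (c * h) (c * r) (c * s) := by
  ext i j; fin_cases i <;> fin_cases j <;> simp [pfaffForm] <;> ring

/-- The six equations cut the ten-dimensional algebra sp(2, ℂ) down to four dimensions, with the
four displayed entries as coordinates. -/
lemma eq_pfaffForm {φ : Mat4} (hs : φ.transpose * gram + gram * φ = 0) (hp : IsPfaffian φ) :
    φ = pfaffForm (φ 1 1) (φ 3 1) (φ 1 3) (φ 0 2) := by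
  obtain ⟨h1, h2, h3, h4, h5, h6⟩ := hp
  have e := fun i j => congrFun (congrFun hs i) j
  have e02 := e 0 2
  have e03 := e 0 3
  have e12 := e 1 2
  have e13 := e 1 3
  have e01 := e 0 1
  have e23 := e 2 3
  simp [gram, Matrix.mul_apply, Fin.sum_univ_four, Matrix.vecMul, dotProduct] at e02 e03 e12 e13 e01 e23
  ext i j; fin_cases i <;> fin_cases j <;> simp [pfaffForm] <;> grind

/-! ### The group `H₁` -/

/-- The matrix in `H₁` with parameters `a`, `b`. -/
def upMat (a b : ℂ) : Mat4 :=
  !![a ^ 3, a ^ 2 * b, -(2 / 9) * b ^ 3, 2 / 3 * a * b ^ 2;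
     0, a, -(2 / 3) * b ^ 2 * a⁻¹, 4 / 3 * b;
     0, 0, a⁻¹ ^ 3, 0;
     0, 0, -(b * a⁻¹ ^ 2), a⁻¹]

lemma upMat_one_zero : upMat 1 0 = 1 := by
  ext i j; fin_cases i <;> fin_cases j <;> simp [upMat]

/-- This is the group law of the matrices (a, b; 0, a⁻¹). -/
lemma upMat_mul {a a' : ℂ} (ha : a ≠ 0) (ha' : a' ≠ 0) (b b' : ℂ) :
    upMat a b * upMat a' b' = upMat (a * a') (a * b' + b * a'⁻¹) := by
  ext i j; fin_cases i <;> fin_cases j <;>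
    simp [upMat, Matrix.mul_apply, Fin.sum_univ_four] <;> field_simp <;> ring

lemma upMat_mem_Sp2 {a : ℂ} (ha : a ≠ 0) (b : ℂ) : upMat a b ∈ Sp2 := by
  rw [mem_Sp2_iff_col]
  intro i j; fin_cases i <;> fin_cases j <;>
    simp [upMat, sympForm, gram] <;> field_simp <;> ring

lemma upMat_inv {a : ℂ} (ha : a ≠ 0) (b : ℂ) : (upMat a b)⁻¹ = upMat a⁻¹ (-b) := by
  apply Matrix.inv_eq_left_inv
  rw [upMat_mul (inv_ne_zero ha) ha, inv_mul_cancel₀ ha, ← upMat_one_zero]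
  congr 1; ring

lemma upMat_inj {a b a' b' : ℂ} (h : upMat a b = upMat a' b') : a = a' ∧ b = b' := by
  have h1 := congrFun (congrFun h 1) 1
  have h2 := congrFun (congrFun h 1) 3
  simp [upMat] at h1 h2
  exact ⟨h1, h2⟩

/-- The adjoint action of `H1` preserves the Pfaffian system. The weights 2 of h and -6 of s make
h³s invariant, which produces the quartic differential; the transformation of p, h, r does not
involve s, which lets η be equivariant on its own. -/
lemma upMat_conj_pfaffForm {a : ℂ} (ha : a ≠ 0) (b p h r s : ℂ) :
    (upMat a b)⁻¹ * (pfaffForm p h r s * upMat a b) =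
      pfaffForm (p - h * b * a / 3) (h * a ^ 2)
        (8 / 3 * b * p * a⁻¹ + r * a⁻¹ ^ 2 - 4 / 9 * h * b ^ 2) (s * a⁻¹ ^ 6) := by
  rw [upMat_inv ha]
  ext i j; fin_cases i <;> fin_cases j <;>
    simp [upMat, pfaffForm, Matrix.mul_apply, Fin.sum_univ_four] <;> field_simp <;> ring

/-- The derivative of a curve in `H₁`. -/
def upMatDeriv (a b a' b' : ℂ) : Mat4 :=
  upMat a b * pfaffForm (a⁻¹ * a') 0 (4 / 3 * (a⁻¹ ^ 2 * (a * b' + b * a'))) 0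

/-! ### Cube-root constants and the identification of `H1` with the matrices `upMat` -/

lemma cbrt_cube {r : ℝ} (hr : 0 ≤ r) : cbrt r ^ 3 = (r : ℂ) := by
  unfold cbrt
  rw [← Complex.ofReal_pow, ← Real.rpow_natCast, ← Real.rpow_mul hr]
  norm_num

lemma cbrt_mul {r s : ℝ} (hr : 0 ≤ r) (hs : 0 ≤ s) : cbrt r * cbrt s = cbrt (r * s) := by
  unfold cbrt
  rw [← Complex.ofReal_mul, ← Real.mul_rpow hr hs]

lemma cbrt_of_cube {r : ℝ} (hr : 0 ≤ r) : cbrt (r ^ 3) = (r : ℂ) := by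
  unfold cbrt
  rw [← Real.rpow_natCast, ← Real.rpow_mul hr]
  norm_num

lemma cbrt_ne_zero {r : ℝ} (hr : 0 < r) : cbrt r ≠ 0 := by
  unfold cbrt
  rw [Complex.ofReal_ne_zero]
  exact (Real.rpow_pos_of_pos hr _).ne'

/-- Because 2/9 · 1/6 = (1/3)³ and 3/32 = (3/4)³ · 2/9, all cube roots of the statement can be
expressed through `cbrt (2 / 9)` alone. -/
lemma cbrt_one_sixth_mul : cbrt (2 / 9) * cbrt (1 / 6) = 1 / 3 := by
  rw [cbrt_mul (by norm_num) (by norm_num), show (2 / 9 * (1 / 6) : ℝ) = (1 / 3) ^ 3 by norm_num,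
    cbrt_of_cube (by norm_num)]
  norm_num

lemma cbrt_three_div : cbrt (3 / 32) = 3 / 4 * cbrt (2 / 9) := by
  rw [show (3 / 32 : ℝ) = (3 / 4) ^ 3 * (2 / 9) by norm_num,
    ← cbrt_mul (by norm_num) (by norm_num), cbrt_of_cube (by norm_num)]
  norm_num

lemma cbrt_two_ninths_cube : cbrt (2 / 9) ^ 3 = 2 / 9 := by
  rw [cbrt_cube (by norm_num)]; norm_num

lemma cbrt_one_sixth : cbrt (1 / 6) = (3 * cbrt (2 / 9))⁻¹ := by
  have h := cbrt_one_sixth_mul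
  have := cbrt_ne_zero (show (0 : ℝ) < 2 / 9 by norm_num)
  field_simp
  linear_combination 3 * h

lemma SL2up_apply_one_one {x : SL2} (hx : x ∈ SL2up) : x.1 1 1 = (x.1 0 0)⁻¹ ∧ x.1 0 0 ≠ 0 := by
  have hd := x.2
  rw [Matrix.det_fin_two, show x.1 1 0 = 0 from hx] at hd
  have h0 : x.1 0 0 ≠ 0 := by rintro h; simp [h] at hd
  refine ⟨?_, h0⟩
  field_simp
  linear_combination hd

lemma fScale_eq : fScale = ![1, -cbrt (2 / 9), 1, (3 * cbrt (2 / 9))⁻¹] := by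
  rw [fScale, cbrt_one_sixth]

lemma diagonal_fScale_inv :
    (Matrix.diagonal fScale)⁻¹ = Matrix.diagonal (fun i => (fScale i)⁻¹) := by
  have hk := cbrt_ne_zero (show (0 : ℝ) < 2 / 9 by norm_num)
  apply Matrix.inv_eq_left_inv
  rw [Matrix.diagonal_mul_diagonal, ← Matrix.diagonal_one, fScale_eq]
  congr 1
  ext i; fin_cases i <;> simp <;> field_simp

/-- Rescaling the off-diagonal parameter by `-cbrt (2 / 9)` removes the irrational constant: after
it, only the cube 2/9 occurs. All further computations in `H1` are therefore rational. -/
lemma repS_of_mem_SL2up {x : SL2} (hx : x ∈ SL2up) :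
    repS x = upMat (x.1 0 0) (-(x.1 0 1 / cbrt (2 / 9))) := by
  obtain ⟨h11, h0⟩ := SL2up_apply_one_one hx
  have h10 : x.1 1 0 = 0 := hx
  have hk := cbrt_ne_zero (show (0 : ℝ) < 2 / 9 by norm_num)
  have hk3 := cbrt_two_ninths_cube
  unfold repS
  rw [diagonal_fScale_inv, fScale_eq]
  generalize hkk : cbrt (2 / 9) = k at *
  ext i j
  rw [Matrix.mul_diagonal, Matrix.diagonal_mul]
  fin_cases i <;> fin_cases j <;>
    simp [symCube, upMat, h10, h11] <;> field_simp <;> rw [hk3] <;> ring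

/-- The upper triangular unimodular matrix that represents `upMat a b`. -/
def upSL (a b : ℂ) (ha : a ≠ 0) : SL2 :=
  ⟨!![a, -(cbrt (2 / 9) * b); 0, a⁻¹], by rw [Matrix.det_fin_two]; simp [ha]⟩

lemma upSL_mem {a b : ℂ} (ha : a ≠ 0) : upSL a b ha ∈ SL2up := by
  change (upSL a b ha).1 1 0 = 0
  simp [upSL]

lemma repS_upSL {a b : ℂ} (ha : a ≠ 0) : repS (upSL a b ha) = upMat a b := by
  rw [repS_of_mem_SL2up (upSL_mem ha)]
  have hk := cbrt_ne_zero (show (0 : ℝ) < 2 / 9 by norm_num)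
  congr 1
  simp [upSL]
  field_simp

lemma repS_injOn {x y : SL2} (hx : x ∈ SL2up) (hy : y ∈ SL2up) (h : repS x = repS y) : x = y := by
  rw [repS_of_mem_SL2up hx, repS_of_mem_SL2up hy] at h
  obtain ⟨h1, h2⟩ := upMat_inj h
  have hk := cbrt_ne_zero (show (0 : ℝ) < 2 / 9 by norm_num)
  have h3 : x.1 0 1 = y.1 0 1 := by field_simp at h2; exact neg_injective h2
  apply Subtype.ext
  ext i j
  fin_cases i <;> fin_cases j
  · exact h1
  · exact h3
  · exact (show x.1 1 0 = 0 from hx).trans (show y.1 1 0 = 0 from hy).symm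
  · exact (SL2up_apply_one_one hx).1.trans (h1 ▸ (SL2up_apply_one_one hy).1.symm)

lemma mem_H1_iff {X : Mat4} : X ∈ H1 ↔ ∃ a b : ℂ, a ≠ 0 ∧ X = upMat a b := by
  constructor
  · rintro ⟨⟨x, rfl⟩, c, hc⟩
    have hk := cbrt_ne_zero (show (0 : ℝ) < 2 / 9 by norm_num)
    -- The third coordinate of the first column of `repS x` is the cube of the lower left entry of
    -- x, and it must vanish.
    have hx : x ∈ SL2up := by
      change x.1 1 0 = 0
      have h2 := congrFun hc 2
      rw [Matrix.mulVec_single_one] at h2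
      simp only [repS, diagonal_fScale_inv, Matrix.col_apply, Matrix.mul_diagonal, Matrix.diagonal_mul] at h2
      simpa [fScale, symCube] using h2
    exact ⟨_, _, (SL2up_apply_one_one hx).2, repS_of_mem_SL2up hx⟩
  · rintro ⟨a, b, ha, rfl⟩
    refine ⟨⟨_, repS_upSL ha⟩, a ^ 3, ?_⟩
    ext i; fin_cases i <;> simp [upMat]

/-! ### Derivatives of matrix-valued functions of one variable -/

section MatDeriv

variable {l m n : Type*}

/-- `A'` is the entrywise derivative of `A` at `t`. -/
def MatDerivAt (A : ℂ → Matrix m n ℂ) (A' : Matrix m n ℂ) (t : ℂ) : Prop :=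
  ∀ i j, HasDerivAt (fun τ => A τ i j) (A' i j) t

/-- The entries of `A` are analytic at `t`. -/
def MatAnalyticAt (A : ℂ → Matrix m n ℂ) (t : ℂ) : Prop :=
  ∀ i j, AnalyticAt ℂ (fun τ => A τ i j) t

/-- The entrywise derivative. -/
def matDeriv (A : ℂ → Matrix m n ℂ) (t : ℂ) : Matrix m n ℂ :=
  Matrix.of fun i j => deriv (fun τ => A τ i j) t

lemma MatAnalyticAt.matDerivAt {A : ℂ → Matrix m n ℂ} {t : ℂ} (h : MatAnalyticAt A t) :
    MatDerivAt A (matDeriv A t) t := fun i j => (h i j).differentiableAt.hasDerivAt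

lemma MatAnalyticAt.matDeriv {A : ℂ → Matrix m n ℂ} {t : ℂ} (h : MatAnalyticAt A t) :
    MatAnalyticAt (matDeriv A) t := fun i j => (h i j).deriv

lemma MatDerivAt.matDeriv_eq {A : ℂ → Matrix m n ℂ} {A' : Matrix m n ℂ} {t : ℂ}
    (h : MatDerivAt A A' t) : matDeriv A t = A' := by
  ext i j; exact (h i j).deriv

lemma MatDerivAt.unique {A : ℂ → Matrix m n ℂ} {A' A'' : Matrix m n ℂ} {t : ℂ}
    (h : MatDerivAt A A' t) (h' : MatDerivAt A A'' t) : A' = A'' :=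
  h.matDeriv_eq.symm.trans h'.matDeriv_eq

lemma matDerivAt_const (A : Matrix m n ℂ) (t : ℂ) : MatDerivAt (fun _ => A) 0 t :=
  fun i j => hasDerivAt_const t (A i j)

lemma matAnalyticAt_const (A : Matrix m n ℂ) (t : ℂ) : MatAnalyticAt (fun _ => A) t :=
  fun _ _ => analyticAt_const

lemma MatDerivAt.congr {A B : ℂ → Matrix m n ℂ} {A' : Matrix m n ℂ} {t : ℂ}
    (h : MatDerivAt A A' t) (hAB : ∀ᶠ τ in 𝓝 t, B τ = A τ) : MatDerivAt B A' t :=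
  fun i j => (h i j).congr_of_eventuallyEq (hAB.mono fun τ hτ => by simp [hτ])

lemma MatAnalyticAt.congr {A B : ℂ → Matrix m n ℂ} {t : ℂ}
    (h : MatAnalyticAt A t) (hAB : ∀ᶠ τ in 𝓝 t, B τ = A τ) : MatAnalyticAt B t :=
  fun i j => (h i j).congr (hAB.mono fun τ hτ => by simp [hτ])

lemma MatDerivAt.mul [Fintype m] {A : ℂ → Matrix l m ℂ} {A' : Matrix l m ℂ}
    {B : ℂ → Matrix m n ℂ} {B' : Matrix m n ℂ} {t : ℂ}
    (hA : MatDerivAt A A' t) (hB : MatDerivAt B B' t) :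
    MatDerivAt (fun τ => A τ * B τ) (A' * B t + A t * B') t := by
  intro i j
  simp only [Matrix.mul_apply, Matrix.add_apply, ← Finset.sum_add_distrib]
  exact HasDerivAt.fun_sum fun k _ => (hA i k).mul (hB k j)

lemma MatAnalyticAt.mul [Fintype m] {A : ℂ → Matrix l m ℂ} {B : ℂ → Matrix m n ℂ} {t : ℂ}
    (hA : MatAnalyticAt A t) (hB : MatAnalyticAt B t) :
    MatAnalyticAt (fun τ => A τ * B τ) t := by
  intro i j
  simp only [Matrix.mul_apply]
  exact Finset.analyticAt_fun_sum _ fun k _ => (hA i k).mul (hB k j)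

lemma MatDerivAt.transpose {A : ℂ → Matrix m n ℂ} {A' : Matrix m n ℂ} {t : ℂ}
    (hA : MatDerivAt A A' t) : MatDerivAt (fun τ => (A τ).transpose) A'.transpose t :=
  fun i j => hA j i

lemma MatAnalyticAt.transpose {A : ℂ → Matrix m n ℂ} {t : ℂ}
    (hA : MatAnalyticAt A t) : MatAnalyticAt (fun τ => (A τ).transpose) t :=
  fun i j => hA j i

lemma MatAnalyticAt.neg {A : ℂ → Matrix m n ℂ} {t : ℂ}
    (hA : MatAnalyticAt A t) : MatAnalyticAt (fun τ => -A τ) t :=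
  fun i j => (hA i j).neg

lemma MatAnalyticAt.inv_of_Sp2 {A : ℂ → Mat4} {t : ℂ} (hA : MatAnalyticAt A t)
    (h : ∀ᶠ τ in 𝓝 t, A τ ∈ Sp2) : MatAnalyticAt (fun τ => (A τ)⁻¹) t := by
  have := (((matAnalyticAt_const gram t).mul hA.transpose).mul (matAnalyticAt_const gram t)).neg
  exact this.congr (h.mono fun τ hτ => Sp2_inv hτ)

end MatDeriv

/-- The Maurer-Cartan form of a curve in `Sp(2, ℂ)` takes values in `sp(2, ℂ)`. -/
lemma maurerCartan_mem_sp {A : ℂ → Mat4} {A' : Mat4} {t : ℂ} (hA : MatDerivAt A A' t)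
    (h : ∀ᶠ τ in 𝓝 t, A τ ∈ Sp2) :
    ((A t)⁻¹ * A').transpose * gram + gram * ((A t)⁻¹ * A') = 0 := by
  -- Differentiate the constant AᵀJA = J; the substitution A' = Aφ then turns the result into the
  -- defining equation of the Lie algebra.
  have h1 := (hA.transpose.mul (matDerivAt_const gram t)).mul hA
  have h2 : MatDerivAt (fun τ => (A τ).transpose * gram * A τ) 0 t :=
    (matDerivAt_const gram t).congr (h.mono fun τ hτ => mem_Sp2_iff.1 hτ)
  have h3 := h1.unique h2
  have hAt := h.self_of_nhds
  have hJ := mem_Sp2_iff.1 hAt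
  have hA' : A' = A t * ((A t)⁻¹ * A') := (Sp2_mul_inv_cancel hAt A').symm
  generalize (A t)⁻¹ * A' = φ at *
  subst hA'
  rw [← h3, Matrix.transpose_mul, Matrix.mul_zero, add_zero]
  conv_lhs => rw [← hJ]
  simp only [Matrix.mul_assoc]

lemma matDerivAt_upMat {a b : ℂ → ℂ} {a' b' t : ℂ} (ha : HasDerivAt a a' t)
    (hb : HasDerivAt b b' t) (h0 : a t ≠ 0) :
    MatDerivAt (fun τ => upMat (a τ) (b τ)) (upMatDeriv (a t) (b t) a' b') t := by
  have hi := ha.fun_inv h0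
  intro i j
  have e : ∀ {f : ℂ → ℂ} {c d : ℂ}, HasDerivAt f c t → c = d → HasDerivAt f d t :=
    fun h h' => h' ▸ h
  fin_cases i <;> fin_cases j
  · refine e (ha.pow 3) ?_
    simp [upMatDeriv, upMat, pfaffForm, Matrix.mul_apply, Fin.sum_univ_four]; field_simp
  · refine e ((ha.pow 2).mul hb) ?_
    simp [upMatDeriv, upMat, pfaffForm, Matrix.mul_apply, Fin.sum_univ_four]; field_simp; ring
  · refine e ((hb.pow 3).const_mul (-(2 / 9))) ?_
    simp [upMatDeriv, upMat, pfaffForm, Matrix.mul_apply, Fin.sum_univ_four]; field_simp; ring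
  · refine e ((ha.const_mul (2 / 3)).mul (hb.pow 2)) ?_
    simp [upMatDeriv, upMat, pfaffForm, Matrix.mul_apply, Fin.sum_univ_four]; field_simp; ring
  · refine e (hasDerivAt_const t 0) ?_
    simp [upMatDeriv, upMat, pfaffForm, Matrix.mul_apply, Fin.sum_univ_four]
  · refine e ha ?_
    simp [upMatDeriv, upMat, pfaffForm, Matrix.mul_apply, Fin.sum_univ_four]; field_simp
  · refine e (((hb.pow 2).const_mul (-(2 / 3))).mul hi) ?_
    simp [upMatDeriv, upMat, pfaffForm, Matrix.mul_apply, Fin.sum_univ_four]; field_simp; ring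
  · refine e (hb.const_mul (4 / 3)) ?_
    simp [upMatDeriv, upMat, pfaffForm, Matrix.mul_apply, Fin.sum_univ_four]; field_simp; ring
  · refine e (hasDerivAt_const t 0) ?_
    simp [upMatDeriv, upMat, pfaffForm, Matrix.mul_apply, Fin.sum_univ_four]
  · refine e (hasDerivAt_const t 0) ?_
    simp [upMatDeriv, upMat, pfaffForm, Matrix.mul_apply, Fin.sum_univ_four]
  · refine e (hi.pow 3) ?_
    simp [upMatDeriv, upMat, pfaffForm, Matrix.mul_apply, Fin.sum_univ_four]; field_simp
  · refine e (hasDerivAt_const t 0) ?_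
    simp [upMatDeriv, upMat, pfaffForm, Matrix.mul_apply, Fin.sum_univ_four]
  · refine e (hasDerivAt_const t 0) ?_
    simp [upMatDeriv, upMat, pfaffForm, Matrix.mul_apply, Fin.sum_univ_four]
  · refine e (hasDerivAt_const t 0) ?_
    simp [upMatDeriv, upMat, pfaffForm, Matrix.mul_apply, Fin.sum_univ_four]
  · refine e (hb.mul (hi.pow 2)).neg ?_
    simp [upMatDeriv, upMat, pfaffForm, Matrix.mul_apply, Fin.sum_univ_four]; field_simp; ring
  · refine e hi ?_
    simp [upMatDeriv, upMat, pfaffForm, Matrix.mul_apply, Fin.sum_univ_four]; field_simp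

/-! ### Holomorphic maps in charts -/

section Charts

variable {S : Type*} [TopologicalSpace S] [ChartedSpace ℂ S]
  {E : Type*} [NormedAddCommGroup E] [NormedSpace ℂ E] {m n : Type*}

lemma eventually_chart_symm {p : S} {t : ℂ} (ht : t ∈ (chartAt ℂ p).target) {U : Set S}
    (hU : IsOpen U) (h : (chartAt ℂ p).symm t ∈ U) : ∀ᶠ τ in 𝓝 t, (chartAt ℂ p).symm τ ∈ U :=
  ((chartAt ℂ p).continuousAt_symm ht).eventually (hU.mem_nhds h)

lemma eventually_mem_target {p : S} {t : ℂ} (ht : t ∈ (chartAt ℂ p).target) :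
    ∀ᶠ τ in 𝓝 t, τ ∈ (chartAt ℂ p).target := (chartAt ℂ p).open_target.mem_nhds ht

lemma deriv_comp_curve {g : S → E} {γ : ℂ → S} {t : ℂ}
    (hg : MDifferentiableAt 𝓘(ℂ, ℂ) 𝓘(ℂ, E) g (γ t))
    (hγ : MDifferentiableAt 𝓘(ℂ, ℂ) 𝓘(ℂ, ℂ) γ t) :
    HasDerivAt (fun τ => g (γ τ))
      (mfderiv 𝓘(ℂ, ℂ) 𝓘(ℂ, E) g (γ t) (mfderiv 𝓘(ℂ, ℂ) 𝓘(ℂ, ℂ) γ t (1 : ℂ)) : E) t := by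
  have h1 := mfderiv_comp t hg hγ
  have h2 : MDifferentiableAt 𝓘(ℂ, ℂ) 𝓘(ℂ, E) (g ∘ γ) t := hg.comp t hγ
  rw [mfderiv_eq_fderiv] at h1
  have h3 := h2.differentiableAt.hasFDerivAt.hasDerivAt
  rw [h1] at h3
  exact h3

lemma matD_smul (A : S → Matrix m n ℂ) (q : S) (c : ℂ) (v : TangentSpace 𝓘(ℂ, ℂ) q) :
    matD A q (c • v) = c • matD A q v := by
  ext i j; simp [matD]; rfl

lemma matD_add (A : S → Matrix m n ℂ) (q : S) (v w : TangentSpace 𝓘(ℂ, ℂ) q) :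
    matD A q (v + w) = matD A q v + matD A q w := by
  ext i j; simp [matD]; rfl

lemma matHolOn_iff_differentiableOn {A : ℂ → Matrix m n ℂ} {V : Set ℂ} :
    MatHolOn A V ↔ ∀ i j, DifferentiableOn ℂ (fun t => A t i j) V := by
  simp only [MatHolOn, mdifferentiableOn_iff_differentiableOn]

lemma matD_complex (A : ℂ → Matrix m n ℂ) (t : ℂ) : matD A t (1 : ℂ) = matDeriv A t := by
  ext i j
  simp only [matD, matDeriv, Matrix.of_apply, mfderiv_eq_fderiv]
  rfl

lemma MatHolOn.mdifferentiableAt {M : Type*} [TopologicalSpace M] [ChartedSpace ℂ M]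
    {A : M → Matrix m n ℂ} {U : Set M} (hU : IsOpen U)
    (hA : MatHolOn A U) {q : M} (hq : q ∈ U) (i : m) (j : n) :
    MDifferentiableAt 𝓘(ℂ, ℂ) 𝓘(ℂ, ℂ) (fun q => A q i j) q :=
  (hA i j q hq).mdifferentiableAt (hU.mem_nhds hq)

lemma MatHolOn.matDerivAt_comp {A : S → Matrix m n ℂ} {U : Set S} (hU : IsOpen U)
    (hA : MatHolOn A U) {γ : ℂ → S} {t : ℂ} (hγ : MDifferentiableAt 𝓘(ℂ, ℂ) 𝓘(ℂ, ℂ) γ t)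
    (hq : γ t ∈ U) : MatDerivAt (fun τ => A (γ τ))
      (matD A (γ t) (mfderiv 𝓘(ℂ, ℂ) 𝓘(ℂ, ℂ) γ t (1 : ℂ))) t :=
  fun i j => deriv_comp_curve (hA.mdifferentiableAt hU hq i j) hγ

variable [IsManifold 𝓘(ℂ, ℂ) 1 S]

lemma mdifferentiableAt_chart_symm (p : S) {t : ℂ} (ht : t ∈ (chartAt ℂ p).target) :
    MDifferentiableAt 𝓘(ℂ, ℂ) 𝓘(ℂ, ℂ) (chartAt ℂ p).symm t :=
  mdifferentiableAt_atlas_symm (chart_mem_atlas ℂ p) ht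

lemma mdifferentiableAt_chart (p : S) {q : S} (hq : q ∈ (chartAt ℂ p).source) :
    MDifferentiableAt 𝓘(ℂ, ℂ) 𝓘(ℂ, ℂ) (chartAt ℂ p) q :=
  mdifferentiableAt_atlas (chart_mem_atlas ℂ p) hq

lemma analyticAt_comp_chart_symm [CompleteSpace E] {g : S → E} {U : Set S} (hU : IsOpen U)
    (hg : MDifferentiableOn 𝓘(ℂ, ℂ) 𝓘(ℂ, E) g U) (p : S) {t : ℂ}
    (ht : t ∈ (chartAt ℂ p).target) (hq : (chartAt ℂ p).symm t ∈ U) :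
    AnalyticAt ℂ (fun τ => g ((chartAt ℂ p).symm τ)) t := by
  have hopen : IsOpen ((chartAt ℂ p).target ∩ (chartAt ℂ p).symm ⁻¹' U) :=
    (chartAt ℂ p).isOpen_inter_preimage_symm hU
  refine DifferentiableOn.analyticAt (s := (chartAt ℂ p).target ∩ (chartAt ℂ p).symm ⁻¹' U) ?_
    (hopen.mem_nhds ⟨ht, hq⟩)
  rintro τ ⟨h1, h2⟩
  have := ((hg _ h2).mdifferentiableAt (hU.mem_nhds h2)).comp τ (mdifferentiableAt_chart_symm p h1)
  exact this.differentiableAt.differentiableWithinAt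

lemma mdifferentiableAt_comp_chart {g : ℂ → E} (p : S) {q : S} (hq : q ∈ (chartAt ℂ p).source)
    (hg : DifferentiableAt ℂ g (chartAt ℂ p q)) :
    MDifferentiableAt 𝓘(ℂ, ℂ) 𝓘(ℂ, E) (fun q => g (chartAt ℂ p q)) q :=
  hg.mdifferentiableAt.comp q (mdifferentiableAt_chart p hq)

lemma mfderiv_coordVec {g : S → E} (p : S) {t : ℂ} (ht : t ∈ (chartAt ℂ p).target)
    (hg : MDifferentiableAt 𝓘(ℂ, ℂ) 𝓘(ℂ, E) g ((chartAt ℂ p).symm t)) :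
    HasDerivAt (fun τ => g ((chartAt ℂ p).symm τ))
      (mfderiv 𝓘(ℂ, ℂ) 𝓘(ℂ, E) g ((chartAt ℂ p).symm t) (coordVec p t) : E) t :=
  deriv_comp_curve hg (mdifferentiableAt_chart_symm p ht)

lemma coordVec_ne_zero (p : S) {t : ℂ} (ht : t ∈ (chartAt ℂ p).target) :
    coordVec p t ≠ 0 := by
  intro h0
  have h1 := mfderiv_coordVec (g := chartAt ℂ p) p ht
    (mdifferentiableAt_chart p ((chartAt ℂ p).map_target ht))
  rw [h0, map_zero] at h1
  have h2 : HasDerivAt (fun τ => chartAt ℂ p ((chartAt ℂ p).symm τ)) 1 t :=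
    (hasDerivAt_id t).congr_of_eventuallyEq
      ((eventually_mem_target ht).mono fun τ hτ => (chartAt ℂ p).right_inv hτ)
  exact (one_ne_zero (α := ℂ)) (h2.unique h1)

lemma exists_smul_coordVec (p : S) {t : ℂ} (ht : t ∈ (chartAt ℂ p).target)
    (v : TangentSpace 𝓘(ℂ, ℂ) ((chartAt ℂ p).symm t)) : ∃ c : ℂ, v = c • coordVec p t := by
  have h : (coordVec p t : ℂ) ≠ 0 := coordVec_ne_zero p ht
  let v' : ℂ := v
  let u : ℂ := coordVec p t
  exact ⟨v' * u⁻¹, (inv_mul_cancel_right₀ (show u ≠ 0 from h) v').symm⟩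

lemma MatHolOn.analyticAt {A : S → Matrix m n ℂ} {U : Set S} (hU : IsOpen U) (hA : MatHolOn A U)
    (p : S) {t : ℂ} (ht : t ∈ (chartAt ℂ p).target) (hq : (chartAt ℂ p).symm t ∈ U) :
    MatAnalyticAt (fun τ => A ((chartAt ℂ p).symm τ)) t :=
  fun i j => analyticAt_comp_chart_symm hU (hA i j) p ht hq

lemma MatHolOn.of_analyticAt {A : S → Matrix m n ℂ} {U : Set S}
    (h : ∀ q ∈ U, ∃ p, q ∈ (chartAt ℂ p).source ∧
      MatAnalyticAt (fun τ => A ((chartAt ℂ p).symm τ)) (chartAt ℂ p q)) : MatHolOn A U := by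
  intro i j q hq
  obtain ⟨p, hqp, hA⟩ := h q hq
  have h1 := mdifferentiableAt_comp_chart p hqp (hA i j).differentiableAt
  refine (h1.congr_of_eventuallyEq ?_).mdifferentiableWithinAt
  filter_upwards [(chartAt ℂ p).open_source.mem_nhds hqp] with q' hq'
  rw [(chartAt ℂ p).left_inv hq']

lemma MatHolOn.analyticAt_self {A : S → Matrix m n ℂ} {U : Set S} (hU : IsOpen U)
    (hA : MatHolOn A U) {q : S} (hq : q ∈ U) :
    MatAnalyticAt (fun τ => A ((chartAt ℂ q).symm τ)) (chartAt ℂ q q) :=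
  hA.analyticAt hU q (mem_chart_target ℂ q) (by rwa [(chartAt ℂ q).left_inv (mem_chart_source ℂ q)])

lemma MatHolOn.mul [Fintype m] {l : Type*} {A : S → Matrix l m ℂ} {B : S → Matrix m n ℂ}
    {U : Set S} (hU : IsOpen U) (hA : MatHolOn A U) (hB : MatHolOn B U) :
    MatHolOn (fun q => A q * B q) U :=
  MatHolOn.of_analyticAt fun q hq =>
    ⟨q, mem_chart_source ℂ q, (hA.analyticAt_self hU hq).mul (hB.analyticAt_self hU hq)⟩

lemma MatHolOn.matDerivAt_chart {A : S → Matrix m n ℂ} {U : Set S} (hU : IsOpen U)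
    (hA : MatHolOn A U) (p : S) {t : ℂ} (ht : t ∈ (chartAt ℂ p).target)
    (hq : (chartAt ℂ p).symm t ∈ U) : MatDerivAt (fun τ => A ((chartAt ℂ p).symm τ))
      (matD A ((chartAt ℂ p).symm t) (coordVec p t)) t :=
  hA.matDerivAt_comp hU (mdifferentiableAt_chart_symm p ht) hq

end Charts

/-! ### Local graphs of isotropic curves -/

/-- The third and fourth columns are dual to the first two, so the coordinates along them are
pairings with the first two columns. -/
lemma Sp2_inv_mulVec_apply {A : Mat4} (hA : A ∈ Sp2) (x : C4) :
    (A⁻¹.mulVec x) 2 = sympForm (fun i => A i 0) x ∧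
      (A⁻¹.mulVec x) 3 = sympForm (fun i => A i 1) x := by
  have key : ∀ j : Fin 4, sympForm (fun i => A i j) x = sympForm (Pi.single j 1) (A⁻¹.mulVec x) := by
    intro j
    conv_lhs => rw [← Sp2_mulVec_inv hA x]
    have : (fun i => A i j : C4) = A.mulVec (Pi.single j 1) := by
      ext i; simp
    rw [this, hA]
  rw [key, key]
  simp [sympForm]

/-- A Lagrangian plane is its own orthogonal complement for ω. Membership in the plane thereby
becomes two analytic equations, which can be differentiated and continued. -/
lemma mem_span_cols_iff_sympForm {A : Mat4} (hA : A ∈ Sp2) (x : C4) :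
    x ∈ Submodule.span ℂ {(fun i => A i 0 : C4), (fun i => A i 1 : C4)} ↔
      sympForm (fun i => A i 0) x = 0 ∧ sympForm (fun i => A i 1) x = 0 := by
  rw [mem_span_cols_iff hA, (Sp2_inv_mulVec_apply hA x).1, (Sp2_inv_mulVec_apply hA x).2]

lemma eq_span_cols {P : Q3} {A : Mat4} (hA : A ∈ Sp2) (h0 : (fun i => A i 0 : C4) ∈ P.1)
    (h1 : (fun i => A i 1 : C4) ∈ P.1) :
    P.1 = Submodule.span ℂ {(fun i => A i 0 : C4), (fun i => A i 1 : C4)} := by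
  apply le_antisymm
  · intro x hx
    rw [mem_span_cols_iff_sympForm hA]
    exact ⟨P.2.2 _ h0 _ hx, P.2.2 _ h1 _ hx⟩
  · rw [Submodule.span_le]
    rintro x (rfl | rfl)
    · exact h0
    · exact h1

/-- The symplectic frame of the graph of the symmetric matrix with entries `x, y, z`. -/
def graphFrame (x y z : ℂ) : Mat4 := !![1, 0, 0, 0; 0, 1, 0, 0; x, y, 1, 0; y, z, 0, 1]

lemma graphFrame_mem_Sp2 (x y z : ℂ) : graphFrame x y z ∈ Sp2 := by
  rw [mem_Sp2_iff_col]
  intro i j; fin_cases i <;> fin_cases j <;> simp [graphFrame, sympForm, gram]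

/-- A plane with nonzero leading minor in the coordinates of B is a graph, with coefficients given
by Cramer's rule. The matrix of the graph is symmetric because the plane is Lagrangian. -/
lemma span_graphFrame {P : Q3} {B : Mat4} (hB : B ∈ Sp2) {a b : C4} (ha : B.mulVec a ∈ P.1)
    (hb : B.mulVec b ∈ P.1) (hD : a 0 * b 1 - b 0 * a 1 ≠ 0) :
    let A := B * graphFrame ((a 2 * b 1 - b 2 * a 1) / (a 0 * b 1 - b 0 * a 1))
      ((b 2 * a 0 - a 2 * b 0) / (a 0 * b 1 - b 0 * a 1))
      ((b 3 * a 0 - a 3 * b 0) / (a 0 * b 1 - b 0 * a 1))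
    A ∈ Sp2 ∧ P.1 = Submodule.span ℂ {(fun i => A i 0 : C4), (fun i => A i 1 : C4)} := by
  intro A
  have hA : A ∈ Sp2 := Sp2_mul hB (graphFrame_mem_Sp2 _ _ _)
  have hlag : a 0 * b 2 - a 2 * b 0 + (a 1 * b 3 - a 3 * b 1) = 0 := by
    have h4 := P.2.2 _ ha _ hb
    rw [hB] at h4
    exact h4
  have key : ∀ (j : Fin 4) (c d : ℂ), (∀ i, graphFrame
      ((a 2 * b 1 - b 2 * a 1) / (a 0 * b 1 - b 0 * a 1))
      ((b 2 * a 0 - a 2 * b 0) / (a 0 * b 1 - b 0 * a 1))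
      ((b 3 * a 0 - a 3 * b 0) / (a 0 * b 1 - b 0 * a 1)) i j = c * a i + d * b i) →
      (fun i => A i j : C4) ∈ P.1 := by
    intro j c d h
    have e : (fun i => A i j : C4) = c • B.mulVec a + d • B.mulVec b := by
      rw [← Matrix.mulVec_smul, ← Matrix.mulVec_smul, ← Matrix.mulVec_add]
      ext i
      simp only [A, Matrix.mul_apply, h, Matrix.mulVec, dotProduct]
      rfl
    rw [e]
    exact Submodule.add_mem _ (Submodule.smul_mem _ _ ha) (Submodule.smul_mem _ _ hb)
  refine ⟨hA, eq_span_cols hA (key 0 (b 1 / (a 0 * b 1 - b 0 * a 1))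
    (-a 1 / (a 0 * b 1 - b 0 * a 1)) ?_) (key 1 (-b 0 / (a 0 * b 1 - b 0 * a 1))
    (a 0 / (a 0 * b 1 - b 0 * a 1)) ?_)⟩
  · intro i
    fin_cases i <;> simp [graphFrame] <;> field_simp
    · grind
    · ring
    · ring
    -- Here the entry below the diagonal has to equal the one above it: this is the symmetry of the
    -- graph matrix.
    · linear_combination hlag
  · intro i
    fin_cases i <;> simp [graphFrame] <;> field_simp
    · ring
    · grind
    · ring
    · ring

lemma matAnalyticAt_graphFrame {x y z : ℂ → ℂ} {t : ℂ} (hx : AnalyticAt ℂ x t)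
    (hy : AnalyticAt ℂ y t) (hz : AnalyticAt ℂ z t) :
    MatAnalyticAt (fun τ => graphFrame (x τ) (y τ) (z τ)) t := by
  intro i j
  fin_cases i <;> fin_cases j <;> simp only [graphFrame] <;> simp <;>
    first | exact analyticAt_const | assumption

/-- The derivative of a graph frame is the product of the frame with this matrix. -/
def graphForm (x' y' z' : ℂ) : Mat4 := !![0, 0, 0, 0; 0, 0, 0, 0; x', y', 0, 0; y', z', 0, 0]

lemma matDerivAt_graphFrame {x y z : ℂ → ℂ} {x' y' z' t : ℂ} (hx : HasDerivAt x x' t)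
    (hy : HasDerivAt y y' t) (hz : HasDerivAt z z' t) :
    MatDerivAt (fun τ => graphFrame (x τ) (y τ) (z τ))
      (graphFrame (x t) (y t) (z t) * graphForm x' y' z') t := by
  have e : graphFrame (x t) (y t) (z t) * graphForm x' y' z' = graphForm x' y' z' := by
    ext i j; fin_cases i <;> fin_cases j <;>
      simp [graphFrame, graphForm, Matrix.mul_apply, Fin.sum_univ_four]
  rw [e]
  intro i j
  fin_cases i <;> fin_cases j <;> simp only [graphFrame, graphForm] <;> simp <;>
    first | exact hasDerivAt_const _ _ | assumption

section

variable {S : Type*} [TopologicalSpace S] [ChartedSpace ℂ S]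

/-- In the preferred chart at `p`, the curve `f` is the image of a graph under a symplectic
matrix `B`. -/
structure IsGraphForm (f : S → Q3) (p : S) (R : ℝ) (B : Mat4) (x y z : ℂ → ℂ) : Prop where
  pos : 0 < R
  subset : Metric.ball (chartAt ℂ p p) R ⊆ (chartAt ℂ p).target
  symp : B ∈ Sp2
  an_x : ∀ t ∈ Metric.ball (chartAt ℂ p p) R, AnalyticAt ℂ x t
  an_y : ∀ t ∈ Metric.ball (chartAt ℂ p p) R, AnalyticAt ℂ y t
  an_z : ∀ t ∈ Metric.ball (chartAt ℂ p p) R, AnalyticAt ℂ z t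
  frame : ∀ t ∈ Metric.ball (chartAt ℂ p p) R, ((chartAt ℂ p).symm t,
    B * graphFrame (x t) (y t) (z t)) ∈ frameBundle f

lemma IsGraphForm.mono {f : S → Q3} {p : S} {R R' : ℝ} {B : Mat4} {x y z : ℂ → ℂ}
    (h : IsGraphForm f p R B x y z) (h0 : 0 < R') (hR : R' ≤ R) : IsGraphForm f p R' B x y z := by
  have hs := Metric.ball_subset_ball (x := chartAt ℂ p p) hR
  exact ⟨h0, hs.trans h.subset, h.symp, fun t ht => h.an_x t (hs ht), fun t ht => h.an_y t (hs ht),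
    fun t ht => h.an_z t (hs ht), fun t ht => h.frame t (hs ht)⟩

/-- Exchanging the first two and the last two basis vectors simultaneously is symplectic and
exchanges the diagonal entries of the graph matrix. It allows one to choose the diagonal entry whose
derivative vanishes to the lower order. -/
lemma IsGraphForm.swap {f : S → Q3} {p : S} {R : ℝ} {B : Mat4} {x y z : ℂ → ℂ}
    (h : IsGraphForm f p R B x y z) :
    IsGraphForm f p R (B * !![0, 1, 0, 0; 1, 0, 0, 0; 0, 0, 0, 1; 0, 0, 1, 0]) z y x := by
  have hP : (!![0, 1, 0, 0; 1, 0, 0, 0; 0, 0, 0, 1; 0, 0, 1, 0] : Mat4) ∈ Sp2 := by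
    rw [mem_Sp2_iff_col]
    intro i j; fin_cases i <;> fin_cases j <;> simp [sympForm, gram]
  refine ⟨h.pos, h.subset, Sp2_mul h.symp hP, h.an_z, h.an_y, h.an_x, fun t ht => ⟨?_, ?_⟩⟩
  · exact Sp2_mul (Sp2_mul h.symp hP) (graphFrame_mem_Sp2 _ _ _)
  · rw [(h.frame t ht).2, Set.pair_comm]
    have e : ∀ (A A' : Mat4) (j k : Fin 4), (∀ i, A i j = A' i k) →
        (fun i => A i j : C4) = fun i => A' i k := fun A A' j k h => funext h
    have e1 := e (B * graphFrame (x t) (y t) (z t)) (B * !![0, 1, 0, 0; 1, 0, 0, 0; 0, 0, 0, 1;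
      0, 0, 1, 0] * graphFrame (z t) (y t) (x t)) 1 0 fun i => by
        simp [Matrix.mul_apply, Fin.sum_univ_four, graphFrame]; ring
    have e2 := e (B * graphFrame (x t) (y t) (z t)) (B * !![0, 1, 0, 0; 1, 0, 0, 0; 0, 0, 0, 1;
      0, 0, 1, 0] * graphFrame (z t) (y t) (x t)) 0 1 fun i => by
        simp [Matrix.mul_apply, Fin.sum_univ_four, graphFrame]; ring
    change Submodule.span ℂ {(fun i => (B * graphFrame (x t) (y t) (z t)) i 1 : C4),
      (fun i => (B * graphFrame (x t) (y t) (z t)) i 0 : C4)} = _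
    rw [e1, e2]

lemma ball_subset_of_eventually {z₀ : ℂ} {P : ℂ → Prop} (h : ∀ᶠ t in 𝓝 z₀, P t) :
    ∃ R > 0, ∀ t ∈ Metric.ball z₀ R, P t :=
  Metric.eventually_nhds_iff_ball.1 h

variable {f : S → Q3} {p : S} {R : ℝ} {B : Mat4} {x y z : ℂ → ℂ}

lemma IsGraphForm.matAnalyticAt (h : IsGraphForm f p R B x y z) {t : ℂ}
    (ht : t ∈ Metric.ball (chartAt ℂ p p) R) :
    MatAnalyticAt (fun τ => B * graphFrame (x τ) (y τ) (z τ)) t :=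
  (matAnalyticAt_const B t).mul
    (matAnalyticAt_graphFrame (h.an_x t ht) (h.an_y t ht) (h.an_z t ht))

lemma IsGraphForm.matDerivAt (h : IsGraphForm f p R B x y z) {t : ℂ}
    (ht : t ∈ Metric.ball (chartAt ℂ p p) R) :
    MatDerivAt (fun τ => B * graphFrame (x τ) (y τ) (z τ))
      (B * graphFrame (x t) (y t) (z t) * graphForm (deriv x t) (deriv y t) (deriv z t)) t := by
  have := (matDerivAt_const B t).mul (matDerivAt_graphFrame
    (h.an_x t ht).differentiableAt.hasDerivAt (h.an_y t ht).differentiableAt.hasDerivAt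
    (h.an_z t ht).differentiableAt.hasDerivAt)
  rwa [Matrix.zero_mul, zero_add, ← Matrix.mul_assoc] at this

/-- The part of the surface that corresponds to a disc in the preferred chart at `p`. -/
def chartBall (p : S) (R : ℝ) : Set S :=
  (chartAt ℂ p).source ∩ chartAt ℂ p ⁻¹' Metric.ball (chartAt ℂ p p) R

lemma isOpen_chartBall (p : S) (R : ℝ) : IsOpen (chartBall p R) :=
  (chartAt ℂ p).isOpen_inter_preimage Metric.isOpen_ball

lemma mem_chartBall_self (p : S) {R : ℝ} (hR : 0 < R) : p ∈ chartBall p R :=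
  ⟨mem_chart_source ℂ p, Metric.mem_ball_self hR⟩

lemma IsGraphForm.symm_mem (h : IsGraphForm f p R B x y z) {t : ℂ}
    (ht : t ∈ Metric.ball (chartAt ℂ p p) R) : (chartAt ℂ p).symm t ∈ chartBall p R :=
  ⟨(chartAt ℂ p).map_target (h.subset ht), by
    rw [Set.mem_preimage, (chartAt ℂ p).right_inv (h.subset ht)]; exact ht⟩

lemma MatAnalyticAt.congr_chart {m n : Type*} {A : ℂ → Matrix m n ℂ} {q : S}
    (hq : q ∈ (chartAt ℂ p).source) (h : MatAnalyticAt A (chartAt ℂ p q)) :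
    MatAnalyticAt (fun τ => A (chartAt ℂ p ((chartAt ℂ p).symm τ))) (chartAt ℂ p q) :=
  h.congr ((eventually_mem_target ((chartAt ℂ p).map_source hq)).mono fun τ hτ => by
    rw [(chartAt ℂ p).right_inv hτ])

variable [IsManifold 𝓘(ℂ, ℂ) 1 S]

/-- In a symplectic frame B whose first two columns span `f p`, nearby planes remain transverse to
the span of the last two columns, hence are graphs. -/
lemma exists_isGraphForm {f : S → Q3} (hf : IsHolomorphic f) (p : S) :
    ∃ R B x y z, IsGraphForm f p R B x y z := by
  obtain ⟨U, u, hU, hpU, hu⟩ := hf p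
  obtain ⟨B, hB, hspan⟩ := exists_symplectic_frame (f p)
  set z₀ := chartAt ℂ p p with hz₀
  have hsymm : (chartAt ℂ p).symm z₀ = p := (chartAt ℂ p).left_inv (mem_chart_source ℂ p)
  let L : Fin 2 → ℂ → C4 := fun k t => B⁻¹.mulVec (u k ((chartAt ℂ p).symm t))
  have hL : ∀ k t, t ∈ (chartAt ℂ p).target → (chartAt ℂ p).symm t ∈ U →
      ∀ i, AnalyticAt ℂ (fun τ => L k τ i) t := by
    intro k t ht htU i
    have h1 := analyticAt_comp_chart_symm hU (hu.hol k) p ht htU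
    simp only [L, Matrix.mulVec, dotProduct]
    refine Finset.analyticAt_fun_sum _ fun j _ => analyticAt_const.mul ?_
    exact (ContinuousLinearMap.proj (R := ℂ) (φ := fun _ : Fin 4 => ℂ) j).analyticAt _ |>.comp h1
  let D : ℂ → ℂ := fun t => L 0 t 0 * L 1 t 1 - L 1 t 0 * L 0 t 1
  have hmem : ∀ q ∈ U, ∀ k, u k q ∈ (f q).1 := fun q hq k => by
    rw [hu.span q hq]; exact Submodule.subset_span ⟨k, rfl⟩
  -- At the centre the last two coordinates of both spanning vectors vanish, so a vanishing minor D
  -- would make the vectors dependent.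
  have hDp : D z₀ ≠ 0 := by
    intro hD
    have hz : ∀ k, L k z₀ 2 = 0 ∧ L k z₀ 3 = 0 := fun k => by
      rw [← mem_span_cols_iff hB, ← hspan, hsymm]
      exact hmem p hpU k
    have hind : ∀ a b : ℂ, a • L 0 z₀ + b • L 1 z₀ = 0 → a = 0 ∧ b = 0 := by
      intro a b hab
      have h1 := congrArg B.mulVec hab
      rw [Matrix.mulVec_add, Matrix.mulVec_smul, Matrix.mulVec_smul, Matrix.mulVec_zero] at h1
      simp only [L, Sp2_mulVec_inv hB, hsymm] at h1
      have h2 := hu.indep p hpU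
      have e : (fun i => u i p) = ![u 0 p, u 1 p] := by
        ext i; fin_cases i <;> rfl
      rw [e, LinearIndependent.pair_iff] at h2
      exact h2 a b h1
    have h1 := hind (L 1 z₀ 1) (-L 0 z₀ 1) (by
      ext i; fin_cases i <;> simp [hz] <;> grind)
    have h2 := hind (L 1 z₀ 0) (-L 0 z₀ 0) (by
      ext i; fin_cases i <;> simp [hz] <;> grind)
    have h3 := hind 1 0 (by
      ext i; fin_cases i <;> simp [hz] <;> grind)
    exact one_ne_zero h3.1
  have hev : ∀ᶠ t in 𝓝 z₀, t ∈ (chartAt ℂ p).target ∧ (chartAt ℂ p).symm t ∈ U ∧ D t ≠ 0 := by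
    have ht := mem_chart_target ℂ p
    have hpU' : (chartAt ℂ p).symm z₀ ∈ U := by rwa [hsymm]
    have hDan : AnalyticAt ℂ D z₀ :=
      ((hL 0 z₀ ht hpU' 0).mul (hL 1 z₀ ht hpU' 1)).sub ((hL 1 z₀ ht hpU' 0).mul (hL 0 z₀ ht hpU' 1))
    exact (eventually_mem_target ht).and ((eventually_chart_symm ht hU hpU').and
      (hDan.continuousAt.eventually_ne hDp))
  obtain ⟨R, hR, hball⟩ := ball_subset_of_eventually hev
  have hD : ∀ t ∈ Metric.ball z₀ R, AnalyticAt ℂ D t := fun t ht =>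
    have h := fun k => hL k t (hball t ht).1 (hball t ht).2.1
    ((h 0 0).mul (h 1 1)).sub ((h 1 0).mul (h 0 1))
  refine ⟨R, B, fun t => (L 0 t 2 * L 1 t 1 - L 1 t 2 * L 0 t 1) / D t,
    fun t => (L 1 t 2 * L 0 t 0 - L 0 t 2 * L 1 t 0) / D t,
    fun t => (L 1 t 3 * L 0 t 0 - L 0 t 3 * L 1 t 0) / D t, hR, fun t ht => (hball t ht).1, hB,
    fun t ht => ?_, fun t ht => ?_, fun t ht => ?_, fun t ht => ?_⟩
  · have h := fun k => hL k t (hball t ht).1 (hball t ht).2.1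
    exact (((h 0 2).mul (h 1 1)).sub ((h 1 2).mul (h 0 1))).div (hD t ht) (hball t ht).2.2
  · have h := fun k => hL k t (hball t ht).1 (hball t ht).2.1
    exact (((h 1 2).mul (h 0 0)).sub ((h 0 2).mul (h 1 0))).div (hD t ht) (hball t ht).2.2
  · have h := fun k => hL k t (hball t ht).1 (hball t ht).2.1
    exact (((h 1 3).mul (h 0 0)).sub ((h 0 3).mul (h 1 0))).div (hD t ht) (hball t ht).2.2
  · obtain ⟨h1, h2, h3⟩ := hball t ht
    refine span_graphFrame hB (a := L 0 t) (b := L 1 t) ?_ ?_ h3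
    · simp only [L, Sp2_mulVec_inv hB]
      exact hmem _ h2 0
    · simp only [L, Sp2_mulVec_inv hB]
      exact hmem _ h2 1

lemma MatHolOn.of_comp_chart {m n : Type*} {A : ℂ → Matrix m n ℂ} {U : Set S}
    (hU : U ⊆ (chartAt ℂ p).source) (h : ∀ q ∈ U, MatAnalyticAt A (chartAt ℂ p q)) :
    MatHolOn (fun q => A (chartAt ℂ p q)) U :=
  MatHolOn.of_analyticAt fun q hq => ⟨p, hU hq, (h q hq).congr_chart (hU hq)⟩

/-- The lower left block of the Maurer-Cartan form of the graph frame is the derivative of the graph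
matrix, and the conformal structure is its determinant. -/
lemma IsGraphForm.null (h : IsGraphForm f p R B x y z) (hf : IsNull f) {t : ℂ}
    (ht : t ∈ Metric.ball (chartAt ℂ p p) R) : deriv x t * deriv z t = deriv y t ^ 2 := by
  have hhol : MatHolOn (fun q => B * graphFrame (x (chartAt ℂ p q)) (y (chartAt ℂ p q))
      (z (chartAt ℂ p q))) (chartBall p R) :=
    MatHolOn.of_comp_chart (A := fun τ => B * graphFrame (x τ) (y τ) (z τ)) Set.inter_subset_left
      fun q hq => h.matAnalyticAt hq.2
  have hfr : ∀ q ∈ chartBall p R, (q, B * graphFrame (x (chartAt ℂ p q)) (y (chartAt ℂ p q))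
      (z (chartAt ℂ p q))) ∈ frameBundle f := by
    intro q hq
    have := h.frame _ hq.2
    rwa [(chartAt ℂ p).left_inv hq.1] at this
  have hnull := hf _ _ (isOpen_chartBall p R) hhol hfr _ (h.symm_mem ht) (coordVec p t)
  have hd := hhol.matDerivAt_chart (isOpen_chartBall p R) p (h.subset ht) (h.symm_mem ht)
  have hd' := (h.matDerivAt ht).congr (B := fun τ =>
    B * graphFrame (x (chartAt ℂ p ((chartAt ℂ p).symm τ)))
    (y (chartAt ℂ p ((chartAt ℂ p).symm τ))) (z (chartAt ℂ p ((chartAt ℂ p).symm τ))))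
    ((eventually_mem_target (h.subset ht)).mono fun τ hτ => by
      simp only [(chartAt ℂ p).right_inv hτ])
  rw [hd.unique hd'] at hnull
  have hsp := (h.frame t ht).1
  simp only [mcForm, LinearMap.comp_apply, LinearMap.snd_apply, LinearMap.mulLeft_apply,
    (chartAt ℂ p).right_inv (h.subset ht), Sp2_inv_mul_cancel hsp] at hnull
  simp [graphForm] at hnull
  linear_combination hnull

end

section

variable {S : Type*} [TopologicalSpace S] [ChartedSpace ℂ S]
  {f : S → Q3} {p : S} {R : ℝ} {B : Mat4} {x y z : ℂ → ℂ}

/-! ### The identity theorem for isotropic curves -/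

lemma eventually_of_chart_symm {P : S → Prop} {q : S} (hq : q ∈ (chartAt ℂ p).source)
    (h : ∀ᶠ t in 𝓝 (chartAt ℂ p q), P ((chartAt ℂ p).symm t)) : ∀ᶠ q' in 𝓝 q, P q' := by
  filter_upwards [((chartAt ℂ p).continuousAt hq).eventually h,
    (chartAt ℂ p).open_source.mem_nhds hq] with q' h1 h2
  rwa [(chartAt ℂ p).left_inv h2] at h1

lemma IsGraphForm.mem_iff (h : IsGraphForm f p R B x y z) {t : ℂ}
    (ht : t ∈ Metric.ball (chartAt ℂ p p) R) (ξ : C4) :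
    ξ ∈ (f ((chartAt ℂ p).symm t)).1 ↔
      sympForm (fun i => (B * graphFrame (x t) (y t) (z t)) i 0) ξ = 0 ∧
        sympForm (fun i => (B * graphFrame (x t) (y t) (z t)) i 1) ξ = 0 := by
  rw [(h.frame t ht).2]
  exact mem_span_cols_iff_sympForm (h.frame t ht).1 ξ

lemma IsGraphForm.analyticAt_sympForm (h : IsGraphForm f p R B x y z) {t : ℂ}
    (ht : t ∈ Metric.ball (chartAt ℂ p p) R) (ξ : C4) (j : Fin 4) : AnalyticAt ℂ
      (fun τ => sympForm (fun i => (B * graphFrame (x τ) (y τ) (z τ)) i j) ξ) t := by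
  have ha := fun i => h.matAnalyticAt ht i j
  exact (((ha 0).mul analyticAt_const).sub ((ha 2).mul analyticAt_const)).add
    (((ha 1).mul analyticAt_const).sub ((ha 3).mul analyticAt_const))

variable [IsManifold 𝓘(ℂ, ℂ) 1 S]

/-- A vector that lies in the planes of an open subset of the curve lies in all of them. -/
lemma forall_mem_of_eventually_mem [PreconnectedSpace S] (hf : IsHolomorphic f) {ξ : C4}
    (h : ∀ᶠ q in 𝓝 p, ξ ∈ (f q).1) (q : S) : ξ ∈ (f q).1 := by
  -- The set of points near which ξ lies in the planes is open by definition. It is closed because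
  -- in each graph form membership is expressed by analytic functions on a disc, which vanish
  -- identically once they vanish near one point.
  have hclopen : IsClopen {q | ∀ᶠ q' in 𝓝 q, ξ ∈ (f q').1} := by
    refine ⟨isClosed_of_closure_subset fun q hq => ?_, isOpen_setOfPred_eventually_nhds⟩
    obtain ⟨R, B, x, y, z, hg⟩ := exists_isGraphForm hf q
    obtain ⟨q', hq', hev⟩ := mem_closure_iff.1 hq _ (isOpen_chartBall q R)
      (mem_chartBall_self q hg.pos)
    have hev' : ∀ᶠ t in 𝓝 (chartAt ℂ q q'), ξ ∈ (f ((chartAt ℂ q).symm t)).1 := by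
      have := (chartAt ℂ q).continuousAt_symm ((chartAt ℂ q).map_source hq'.1)
      rw [ContinuousAt, (chartAt ℂ q).left_inv hq'.1] at this
      exact this.eventually hev
    have hb := Metric.isOpen_ball.mem_nhds hq'.2
    have hzero : ∀ t ∈ Metric.ball (chartAt ℂ q q) R, ξ ∈ (f ((chartAt ℂ q).symm t)).1 := by
      have hj : ∀ j : Fin 4, (∀ᶠ t in 𝓝 (chartAt ℂ q q'),
          sympForm (fun i => (B * graphFrame (x t) (y t) (z t)) i j) ξ = 0) →
          ∀ t ∈ Metric.ball (chartAt ℂ q q) R,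
            sympForm (fun i => (B * graphFrame (x t) (y t) (z t)) i j) ξ = 0 := by
        intro j hj t ht
        have han : AnalyticOnNhd ℂ (fun τ => sympForm
            (fun i => (B * graphFrame (x τ) (y τ) (z τ)) i j) ξ)
            (Metric.ball (chartAt ℂ q q) R) := fun t ht => hg.analyticAt_sympForm ht ξ j
        exact han.eqOn_zero_of_preconnected_of_eventuallyEq_zero
          (convex_ball _ _).isPreconnected hq'.2 hj ht
      intro t ht
      rw [hg.mem_iff ht]
      refine ⟨hj 0 ?_ t ht, hj 1 ?_ t ht⟩
      · filter_upwards [hev', hb] with τ h1 h2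
        exact ((hg.mem_iff h2 ξ).1 h1).1
      · filter_upwards [hev', hb] with τ h1 h2
        exact ((hg.mem_iff h2 ξ).1 h1).2
    exact eventually_of_chart_symm (mem_chart_source ℂ q)
      (Filter.eventually_of_mem (Metric.ball_mem_nhds _ hg.pos) hzero)
  have huniv := hclopen.eq_univ ⟨p, h⟩
  have : q ∈ {q | ∀ᶠ q' in 𝓝 q, ξ ∈ (f q').1} := huniv ▸ Set.mem_univ q
  exact Filter.Eventually.self_of_nhds (p := fun q' => ξ ∈ (f q').1) this

/-- If `f` were constant near p, each vector of `f p` would lie in every plane by the identity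
theorem, and equality of dimensions would make `f` constant. -/
lemma not_eventually_eq [PreconnectedSpace S] (hf : IsIsotropicCurve f) :
    ¬ ∀ᶠ q in 𝓝 p, f q = f p := by
  intro h
  obtain ⟨a, b, hab⟩ := hf.nonconstant
  have key : ∀ q, f p = f q := fun q => by
    have hle : (f p).1 ≤ (f q).1 := fun ξ hξ =>
      forall_mem_of_eventually_mem hf.holomorphic (h.mono fun q' hq' => by rwa [hq']) q
    have : FiniteDimensional ℂ (f q).1 := inferInstance
    exact Subtype.ext (Submodule.eq_of_le_of_finrank_eq hle ((f p).2.1.trans (f q).2.1.symm))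
  exact hab ((key a).symm.trans (key b))

lemma eventually_const_of_deriv_eq_zero {g : ℂ → ℂ} {z₀ : ℂ} (hg : AnalyticAt ℂ g z₀)
    (h : ∀ᶠ t in 𝓝 z₀, deriv g t = 0) : ∀ᶠ t in 𝓝 z₀, g t = g z₀ := by
  obtain ⟨r, hr, hb⟩ := ball_subset_of_eventually (h.and hg.eventually_analyticAt)
  filter_upwards [Metric.ball_mem_nhds z₀ hr] with t ht
  exact Metric.isOpen_ball.is_const_of_deriv_eq_zero (convex_ball z₀ r).isPreconnected
    (fun τ hτ => (hb τ hτ).2.differentiableAt.differentiableWithinAt)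
    (fun τ hτ => (hb τ hτ).1) ht (Metric.mem_ball_self hr)

/-- By nullity y' vanishes together with x' and z', so otherwise the graph matrix, and with it the
curve, would be locally constant. -/
lemma IsGraphForm.not_eventually_deriv_eq_zero [PreconnectedSpace S] (hf : IsIsotropicCurve f)
    (h : IsGraphForm f p R B x y z) : ¬ ((∀ᶠ t in 𝓝 (chartAt ℂ p p), deriv x t = 0) ∧
      (∀ᶠ t in 𝓝 (chartAt ℂ p p), deriv z t = 0)) := by
  rintro ⟨hx, hz⟩
  have hc := Metric.mem_ball_self (x := chartAt ℂ p p) h.pos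
  have hb := Metric.ball_mem_nhds (chartAt ℂ p p) h.pos
  have hy : ∀ᶠ t in 𝓝 (chartAt ℂ p p), deriv y t = 0 := by
    filter_upwards [hx, hb] with t h1 h2
    have := h.null hf.null h2
    rw [h1, zero_mul] at this
    exact pow_eq_zero_iff two_ne_zero |>.1 this.symm
  refine not_eventually_eq hf (p := p) (eventually_of_chart_symm (mem_chart_source ℂ p) ?_)
  filter_upwards [eventually_const_of_deriv_eq_zero (h.an_x _ hc) hx,
    eventually_const_of_deriv_eq_zero (h.an_y _ hc) hy,
    eventually_const_of_deriv_eq_zero (h.an_z _ hc) hz, hb] with t h1 h2 h3 h4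
  apply Subtype.ext
  have h5 := (h.frame t h4).2
  have h6 := (h.frame _ hc).2
  simp only [(chartAt ℂ p).left_inv (mem_chart_source ℂ p)] at h6
  rw [h6]
  simp only [h1, h2, h3] at h5
  exact h5

lemma exists_eq_mul_of_analyticOrderAt_le {g h : ℂ → ℂ} {z₀ : ℂ} (hg : AnalyticAt ℂ g z₀)
    (hh : AnalyticAt ℂ h z₀) (hle : analyticOrderAt h z₀ ≤ analyticOrderAt g z₀)
    (htop : analyticOrderAt h z₀ ≠ ⊤) :
    ∃ s, AnalyticAt ℂ s z₀ ∧ ∀ᶠ t in 𝓝 z₀, g t = s t * h t := by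
  obtain ⟨m, hm⟩ := ENat.ne_top_iff_exists.1 htop
  obtain ⟨h', hh', hh0, hev⟩ := (hh.analyticOrderAt_eq_natCast).1 hm.symm
  rw [← hm] at hle
  obtain ⟨g', hg', hgev⟩ := (natCast_le_analyticOrderAt hg).1 hle
  refine ⟨fun t => g' t / h' t, hg'.div hh' hh0, ?_⟩
  filter_upwards [hev, hgev, hh'.continuousAt.eventually_ne hh0] with t h1 h2 h3
  rw [h1, h2, smul_eq_mul, smul_eq_mul]
  field_simp

/-- Up to an exchange of the basis vectors, the derivative of the symmetric matrix of a local graph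
of an isotropic curve is divisible by its last diagonal entry. -/
lemma exists_isGraphForm_divisible [PreconnectedSpace S] (hf : IsIsotropicCurve f) (p : S) :
    ∃ R B x y z s, IsGraphForm f p R B x y z ∧ AnalyticAt ℂ s (chartAt ℂ p p) ∧
      (¬ ∀ᶠ t in 𝓝 (chartAt ℂ p p), deriv z t = 0) ∧
      ∀ᶠ t in 𝓝 (chartAt ℂ p p), deriv y t = -s t * deriv z t ∧
        deriv x t = s t ^ 2 * deriv z t := by
  -- The exchange of the two directions arranges that z' vanishes to at most the order of x'.
  have key : ∃ R B x y z, IsGraphForm f p R B x y z ∧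
      analyticOrderAt (deriv z) (chartAt ℂ p p) ≤ analyticOrderAt (deriv x) (chartAt ℂ p p) := by
    obtain ⟨R, B, x, y, z, h⟩ := exists_isGraphForm hf.holomorphic p
    rcases le_total (analyticOrderAt (deriv z) (chartAt ℂ p p))
      (analyticOrderAt (deriv x) (chartAt ℂ p p)) with hle | hle
    · exact ⟨R, B, x, y, z, h, hle⟩
    · exact ⟨R, _, z, y, x, h.swap, hle⟩
  obtain ⟨R, B, x, y, z, h, hle⟩ := key
  have hc := Metric.mem_ball_self (x := chartAt ℂ p p) h.pos
  have hb := Metric.ball_mem_nhds (chartAt ℂ p p) h.pos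
  have hx := (h.an_x _ hc).deriv
  have hy := (h.an_y _ hc).deriv
  have hz := (h.an_z _ hc).deriv
  have hz0 : analyticOrderAt (deriv z) (chartAt ℂ p p) ≠ ⊤ := by
    intro htop
    rw [htop, top_le_iff] at hle
    exact h.not_eventually_deriv_eq_zero hf
      ⟨analyticOrderAt_eq_top.1 hle, analyticOrderAt_eq_top.1 htop⟩
  -- Nullity doubles the order of y': ord x' + ord z' = 2 ord y'. With ord z' ≤ ord x' this forces
  -- ord z' ≤ ord y', so y'/z' is holomorphic at the centre.
  have hord : analyticOrderAt (deriv x) (chartAt ℂ p p) + analyticOrderAt (deriv z) (chartAt ℂ p p)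
      = 2 • analyticOrderAt (deriv y) (chartAt ℂ p p) := by
    rw [← analyticOrderAt_mul hx hz, ← analyticOrderAt_pow hy]
    apply analyticOrderAt_congr
    filter_upwards [hb] with t ht
    exact h.null hf.null ht
  have hyz : analyticOrderAt (deriv z) (chartAt ℂ p p) ≤
      analyticOrderAt (deriv y) (chartAt ℂ p p) := by
    revert hord hle hz0
    generalize analyticOrderAt (deriv x) (chartAt ℂ p p) = a
    generalize analyticOrderAt (deriv z) (chartAt ℂ p p) = c
    generalize analyticOrderAt (deriv y) (chartAt ℂ p p) = b
    intro hle hz0 hord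
    by_cases hbt : b = ⊤
    · simp [hbt]
    lift b to ℕ using hbt
    lift c to ℕ using hz0
    have hat : a ≠ ⊤ := by
      rintro rfl
      rw [top_add, nsmul_eq_mul] at hord
      exact (ENat.natCast_ne_top (2 * b)) (by exact_mod_cast hord.symm)
    lift a to ℕ using hat
    rw [nsmul_eq_mul] at hord
    norm_cast at *
    omega
  obtain ⟨s, hs, hsev⟩ := exists_eq_mul_of_analyticOrderAt_le hy hz hyz hz0
  have hz0' : ¬ ∀ᶠ t in 𝓝 (chartAt ℂ p p), deriv z t = 0 := fun h' =>
    hz0 (analyticOrderAt_eq_top.2 h')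
  -- The sign is chosen so that (1, s) spans the kernel of the derivative of the graph matrix.
  refine ⟨R, B, x, y, z, fun t => -s t, h, hs.neg, hz0', ?_⟩
  have hne := hz.eventually_eq_zero_or_eventually_ne_zero.resolve_left hz0'
  have hF : AnalyticAt ℂ (fun t => deriv x t - s t ^ 2 * deriv z t) (chartAt ℂ p p) :=
    hx.sub ((hs.pow 2).mul hz)
  -- The null relation only gives z' times this difference equal to zero. One can cancel z' off the
  -- centre, and an analytic function that is not nonzero on a punctured neighbourhood vanishes near
  -- the centre.
  have hF0 : ∀ᶠ t in 𝓝 (chartAt ℂ p p), deriv x t - s t ^ 2 * deriv z t = 0 := by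
    refine hF.eventually_eq_zero_or_eventually_ne_zero.resolve_right fun hcon => ?_
    have := (hcon.and hne).and ((hsev.filter_mono nhdsWithin_le_nhds).and
      ((Filter.eventually_of_mem hb fun t ht => h.null hf.null ht).filter_mono nhdsWithin_le_nhds))
    obtain ⟨t, ⟨h1, h2⟩, h3, h4⟩ := this.exists
    apply h1
    apply mul_right_cancel₀ h2
    rw [h3] at h4
    linear_combination h4
  filter_upwards [hsev, hF0] with t h1 h2
  exact ⟨by rw [h1]; ring, by linear_combination h2⟩

end

/-! ### The normal form of an isotropic curve -/

section

variable {S : Type*} [TopologicalSpace S] [ChartedSpace ℂ S]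

/-- The graph form of an isotropic curve, together with the function `s` such that the Legendre
associate is spanned by the sum of the first column and `s` times the second column of the
frame. -/
structure IsNormalForm (f : S → Q3) (p : S) (R : ℝ) (B : Mat4) (x y z s : ℂ → ℂ) : Prop extends
    IsGraphForm f p R B x y z where
  an_s : ∀ t ∈ Metric.ball (chartAt ℂ p p) R, AnalyticAt ℂ s t
  deriv_y : ∀ t ∈ Metric.ball (chartAt ℂ p p) R, deriv y t = -s t * deriv z t
  deriv_x : ∀ t ∈ Metric.ball (chartAt ℂ p p) R, deriv x t = s t ^ 2 * deriv z t
  deriv_ne_zero : ∀ t ∈ Metric.ball (chartAt ℂ p p) R, t ≠ chartAt ℂ p p →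
    deriv z t ≠ 0 ∧ deriv s t ≠ 0

/-- The vector that spans the Legendre associate. -/
def legendreVec (x y z s : ℂ) : C4 := ![1, s, x + s * y, y + s * z]

/-- What remains is that s' does not vanish identically. If `s` were constant, the kernel (1, s) of
the derivative of the graph matrix would be constant, hence so would be the corresponding vector of
the plane. This nonzero vector would lie in all planes of the curve, which would be contained in a
null ray. Shrinking the disc then removes all zeros of z' and s' except possibly the centre. -/
lemma exists_isNormalForm [IsManifold 𝓘(ℂ, ℂ) 1 S] [PreconnectedSpace S] {f : S → Q3}
    (hf : IsIsotropicCurve f) (p : S) : ∃ R B x y z s, IsNormalForm f p R B x y z s := by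
  obtain ⟨R, B, x, y, z, s, h, hs, hz, hev⟩ := exists_isGraphForm_divisible hf p
  have hc := Metric.mem_ball_self (x := chartAt ℂ p p) h.pos
  have hb := Metric.ball_mem_nhds (chartAt ℂ p p) h.pos
  have hs0 : ¬ ∀ᶠ t in 𝓝 (chartAt ℂ p p), deriv s t = 0 := by
    intro hs0
    set z₀ := chartAt ℂ p p
    have hconst := eventually_const_of_deriv_eq_zero hs hs0
    have h1 : ∀ᶠ t in 𝓝 z₀, x t + s t * y t = x z₀ + s z₀ * y z₀ := by
      refine eventually_const_of_deriv_eq_zero (g := fun t => x t + s t * y t)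
        ((h.an_x _ hc).add (hs.mul (h.an_y _ hc))) ?_
      filter_upwards [hs0, hev, hs.eventually_analyticAt, hb] with t h1 h2 h3 h4
      have := ((h.an_x t h4).differentiableAt.hasDerivAt.add
        (h3.differentiableAt.hasDerivAt.mul (h.an_y t h4).differentiableAt.hasDerivAt)).deriv
      refine this.trans ?_
      rw [h1, h2.1, h2.2]; ring
    have h2 : ∀ᶠ t in 𝓝 z₀, y t + s t * z t = y z₀ + s z₀ * z z₀ := by
      refine eventually_const_of_deriv_eq_zero (g := fun t => y t + s t * z t)
        ((h.an_y _ hc).add (hs.mul (h.an_z _ hc))) ?_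
      filter_upwards [hs0, hev, hs.eventually_analyticAt, hb] with t h1 h2 h3 h4
      have := ((h.an_y t h4).differentiableAt.hasDerivAt.add
        (h3.differentiableAt.hasDerivAt.mul (h.an_z t h4).differentiableAt.hasDerivAt)).deriv
      refine this.trans ?_
      rw [h1, h2.1]; ring
    have hξ : ∀ᶠ q in 𝓝 p, B.mulVec (legendreVec (x z₀) (y z₀) (z z₀) (s z₀)) ∈ (f q).1 := by
      refine eventually_of_chart_symm (mem_chart_source ℂ p) ?_
      filter_upwards [hconst, h1, h2, hb] with t h1 h2 h3 h4
      rw [legendreVec, ← h2, ← h3, ← h1, (h.frame t h4).2, Submodule.mem_span_pair]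
      refine ⟨1, s t, ?_⟩
      ext i
      simp [Matrix.mul_apply, Matrix.mulVec, dotProduct, Fin.sum_univ_four, graphFrame]
      ring
    refine hf.not_null_ray ⟨_, fun h0 => ?_, forall_mem_of_eventually_mem hf.holomorphic hξ⟩
    have h3 := congrArg (B⁻¹.mulVec) h0
    rw [Sp2_inv_mulVec h.symp, Matrix.mulVec_zero] at h3
    exact one_ne_zero (congrFun h3 0)
  have hz' := (h.an_z _ hc).deriv.eventually_eq_zero_or_eventually_ne_zero.resolve_left hz
  have hs' := hs.deriv.eventually_eq_zero_or_eventually_ne_zero.resolve_left hs0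
  rw [eventually_nhdsWithin_iff] at hz' hs'
  obtain ⟨r, hr, hball⟩ := ball_subset_of_eventually
    ((hev.and hs.eventually_analyticAt).and (hz'.and hs'))
  have hsub := Metric.ball_subset_ball (x := chartAt ℂ p p) (min_le_right R r)
  exact ⟨min R r, B, x, y, z, s, h.mono (lt_min h.pos hr) (min_le_left _ _),
    fun t ht => (hball t (hsub ht)).1.2, fun t ht => (hball t (hsub ht)).1.1.1,
    fun t ht => (hball t (hsub ht)).1.1.2,
    fun t ht hne => ⟨(hball t (hsub ht)).2.1 hne, (hball t (hsub ht)).2.2 hne⟩⟩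

end

/-! ### The Legendre associate and the critical points -/

lemma hasDerivAt_mulVec (B : Mat4) {v : ℂ → C4} {v' : C4} {t : ℂ} (h : HasDerivAt v v' t) :
    HasDerivAt (fun τ => B.mulVec (v τ)) (B.mulVec v') t :=
  (Matrix.mulVecLin B).toContinuousLinearMap.hasFDerivAt.comp_hasDerivAt t h

lemma hasDerivAt_sympForm {a b : ℂ → C4} {a' b' : C4} {t : ℂ} (ha : HasDerivAt a a' t)
    (hb : HasDerivAt b b' t) :
    HasDerivAt (fun τ => sympForm (a τ) (b τ)) (sympForm a' (b t) + sympForm (a t) b') t := by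
  rw [hasDerivAt_pi] at ha hb
  have := (((ha 0).mul (hb 2)).sub ((ha 2).mul (hb 0))).add
    (((ha 1).mul (hb 3)).sub ((ha 3).mul (hb 1)))
  refine this.congr_deriv ?_
  simp only [sympForm]; ring

lemma hasDerivAt_vec4 {a b c d : ℂ → ℂ} {a' b' c' d' t : ℂ} (ha : HasDerivAt a a' t)
    (hb : HasDerivAt b b' t) (hc : HasDerivAt c c' t) (hd : HasDerivAt d d' t) :
    HasDerivAt (fun τ => (![a τ, b τ, c τ, d τ] : C4)) ![a', b', c', d'] t := by
  rw [hasDerivAt_pi]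
  intro i; fin_cases i
  exacts [ha, hb, hc, hd]

section

variable {S : Type*} [TopologicalSpace S] [ChartedSpace ℂ S]
  {f : S → Q3} {p : S} {R : ℝ} {B : Mat4} {x y z s : ℂ → ℂ}

lemma IsGraphForm.mem_iff_exists (h : IsGraphForm f p R B x y z) {t : ℂ}
    (ht : t ∈ Metric.ball (chartAt ℂ p p) R) (v : C4) : v ∈ (f ((chartAt ℂ p).symm t)).1 ↔
      ∃ a b, v = B.mulVec ![a, b, a * x t + b * y t, a * y t + b * z t] := by
  rw [(h.frame t ht).2, Submodule.mem_span_pair]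
  refine exists_congr fun a => exists_congr fun b => ?_
  rw [eq_comm]
  refine Eq.congr_right ?_
  ext i
  simp [Matrix.mul_apply, Matrix.mulVec, dotProduct, Fin.sum_univ_four, graphFrame]
  ring

lemma mulVec_eq_iff {B : Mat4} (hB : B ∈ Sp2) {v w : C4} : B.mulVec v = B.mulVec w ↔ v = w := by
  refine ⟨fun h => ?_, fun h => h ▸ rfl⟩
  rw [← Sp2_inv_mulVec hB v, h, Sp2_inv_mulVec hB]

/-- Since (1, s) is in the kernel of the derivative of the graph matrix, only the derivative of the
coefficient `s` survives. In particular the curve of Legendre vectors has velocity inside the plane.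
-/
lemma IsNormalForm.hasDerivAt_legendreVec (h : IsNormalForm f p R B x y z s) {t : ℂ}
    (ht : t ∈ Metric.ball (chartAt ℂ p p) R) :
    HasDerivAt (fun τ => B.mulVec (legendreVec (x τ) (y τ) (z τ) (s τ)))
      (deriv s t • B.mulVec ![0, 1, y t, z t]) t := by
  have hx := (h.an_x t ht).differentiableAt.hasDerivAt
  have hy := (h.an_y t ht).differentiableAt.hasDerivAt
  have hz := (h.an_z t ht).differentiableAt.hasDerivAt
  have hs := (h.an_s t ht).differentiableAt.hasDerivAt
  have h1 := hasDerivAt_mulVec B (hasDerivAt_vec4 (hasDerivAt_const t 1) hs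
    (hx.add (hs.mul hy)) (hy.add (hs.mul hz)))
  refine h1.congr_deriv ?_
  rw [← Matrix.mulVec_smul]
  congr 1
  ext i
  fin_cases i <;> simp [h.deriv_x t ht, h.deriv_y t ht]
  ring

lemma IsGraphForm.hasDerivAt_col (h : IsGraphForm f p R B x y z) {t : ℂ}
    (ht : t ∈ Metric.ball (chartAt ℂ p p) R) (a b : ℂ) :
    HasDerivAt (fun τ => B.mulVec ![a, b, a * x τ + b * y τ, a * y τ + b * z τ])
      (B.mulVec ![0, 0, a * deriv x t + b * deriv y t, a * deriv y t + b * deriv z t]) t := by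
  have hx := (h.an_x t ht).differentiableAt.hasDerivAt
  have hy := (h.an_y t ht).differentiableAt.hasDerivAt
  have hz := (h.an_z t ht).differentiableAt.hasDerivAt
  exact hasDerivAt_mulVec B (hasDerivAt_vec4 (hasDerivAt_const t a) (hasDerivAt_const t b)
    ((hx.const_mul a).add (hy.const_mul b)) ((hy.const_mul a).add (hz.const_mul b)))

lemma IsNormalForm.legendreVec_mem (h : IsNormalForm f p R B x y z s) {t : ℂ}
    (ht : t ∈ Metric.ball (chartAt ℂ p p) R) :
    B.mulVec (legendreVec (x t) (y t) (z t) (s t)) ∈ (f ((chartAt ℂ p).symm t)).1 :=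
  (h.mem_iff_exists ht _).2 ⟨1, s t, by simp [legendreVec]⟩

lemma legendreVec_ne_zero {B : Mat4} (hB : B ∈ Sp2) (x y z s : ℂ) :
    B.mulVec (legendreVec x y z s) ≠ 0 := by
  intro h0
  rw [← Matrix.mulVec_zero B, mulVec_eq_iff hB] at h0
  exact one_ne_zero (congrFun h0 0)

variable [IsManifold 𝓘(ℂ, ℂ) 1 S]

/-- The Legendre vector ξ is characterised inside the plane by ω(ξ, u') = 0 for all sections u. For
an arbitrary lift this is a linear condition on the coefficients of ξ, solved up to a factor by -n₂₂
and n₁₂. The lifts in the definition use the preferred chart at the point itself, so the transition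
map ψ to the chart at p enters. -/
lemma IsNormalForm.legendreAssociate_le (h : IsNormalForm f p R B x y z s) {t : ℂ}
    (ht : t ∈ Metric.ball (chartAt ℂ p p) R) : legendreAssociate f ((chartAt ℂ p).symm t) ≤
      Submodule.span ℂ {B.mulVec (legendreVec (x t) (y t) (z t) (s t))} := by
  have hq : (chartAt ℂ p).symm t ∈ chartBall p R := h.symm_mem ht
  have htq : t = chartAt ℂ p ((chartAt ℂ p).symm t) := ((chartAt ℂ p).right_inv (h.subset ht)).symm
  generalize (chartAt ℂ p).symm t = q at *
  subst htq
  rw [legendreAssociate, Submodule.span_le]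
  rintro v ⟨U, u, k, n, hU, hqU, hUs, hu, hn, hω, hne, rfl⟩
  set χ := chartAt ℂ q with hχ
  have hopen : IsOpen (χ.target ∩ χ.symm ⁻¹' (U ∩ chartBall p R)) :=
    χ.isOpen_inter_preimage_symm (hU.inter (isOpen_chartBall p R))
  have hq0 : χ q ∈ χ.target ∩ χ.symm ⁻¹' (U ∩ chartBall p R) := by
    refine ⟨mem_chart_target ℂ q, ?_⟩
    rw [Set.mem_preimage, χ.left_inv (mem_chart_source ℂ q)]
    exact ⟨hqU, hq⟩
  -- the transition map
  let ψ : ℂ → ℂ := fun τ => chartAt ℂ p (χ.symm τ)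
  have hψ : ∀ τ ∈ χ.target ∩ χ.symm ⁻¹' (U ∩ chartBall p R), AnalyticAt ℂ ψ τ := by
    intro τ hτ
    refine analyticAt_comp_chart_symm (U := (chartAt ℂ p).source) (chartAt ℂ p).open_source ?_ q
      hτ.1 hτ.2.2.1
    exact fun q' hq' => (mdifferentiableAt_chart p hq').mdifferentiableWithinAt
  have hu' : ∀ i, ∀ τ ∈ χ.target ∩ χ.symm ⁻¹' (U ∩ chartBall p R),
      AnalyticAt ℂ (fun τ => u i (χ.symm τ)) τ := fun i τ hτ =>
    analyticAt_comp_chart_symm hU (hu.hol i) q hτ.1 hτ.2.1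
  have hn' : MatAnalyticAt (fun τ => n (χ.symm τ)) (χ q) := hn.analyticAt hU q hq0.1 hq0.2.1
  have hpt : ∀ τ ∈ χ.target ∩ χ.symm ⁻¹' (U ∩ chartBall p R), τ ≠ χ q →
      ∃ c : ℂ, -(n (χ.symm τ) 1 1) • u 0 (χ.symm τ) + n (χ.symm τ) 0 1 • u 1 (χ.symm τ) =
        c • B.mulVec (legendreVec (x (ψ τ)) (y (ψ τ)) (z (ψ τ)) (s (ψ τ))) := by
    intro τ hτ hτq
    have hball : ψ τ ∈ Metric.ball (chartAt ℂ p p) R := hτ.2.2.2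
    have hsymm : ∀ τ ∈ χ.target ∩ χ.symm ⁻¹' (U ∩ chartBall p R),
        (chartAt ℂ p).symm (ψ τ) = χ.symm τ := fun τ hτ => (chartAt ℂ p).left_inv hτ.2.2.1
    have hmem := h.legendreVec_mem hball
    rw [hsymm τ hτ, hu.span _ hτ.2.1] at hmem
    rw [show Set.range (fun i => u i (χ.symm τ)) = {u 0 (χ.symm τ), u 1 (χ.symm τ)} by
      ext; simp [Fin.exists_fin_two, eq_comm], Submodule.mem_span_pair] at hmem
    obtain ⟨α, β, hαβ⟩ := hmem
    have hξ : HasDerivAt (fun τ => B.mulVec (legendreVec (x (ψ τ)) (y (ψ τ)) (z (ψ τ)) (s (ψ τ))))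
        (deriv ψ τ • deriv s (ψ τ) • B.mulVec ![0, 1, y (ψ τ), z (ψ τ)]) τ :=
      (h.hasDerivAt_legendreVec hball).scomp τ (hψ τ hτ).differentiableAt.hasDerivAt
    -- Differentiate ω(ξ, u_j) = 0: the term ω(ξ', u_j) vanishes because ξ' lies in the same
    -- Lagrangian plane.
    have horth : ∀ j, sympForm (B.mulVec (legendreVec (x (ψ τ)) (y (ψ τ)) (z (ψ τ)) (s (ψ τ))))
        (chartDeriv q (u j) (χ.symm τ)) = 0 := by
      intro j
      have hduj : HasDerivAt (fun τ => u j (χ.symm τ)) (chartDeriv q (u j) (χ.symm τ)) τ := by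
        have := (hu' j τ hτ).differentiableAt.hasDerivAt
        rwa [chartDeriv, ← hχ, χ.right_inv hτ.1]
      have h1 := hasDerivAt_sympForm hξ hduj
      have h2 : ∀ᶠ τ' in 𝓝 τ, sympForm (B.mulVec (legendreVec (x (ψ τ')) (y (ψ τ')) (z (ψ τ'))
          (s (ψ τ')))) (u j (χ.symm τ')) = 0 := by
        filter_upwards [hopen.mem_nhds hτ] with τ' hτ'
        have hm := h.legendreVec_mem (t := ψ τ') hτ'.2.2.2
        rw [hsymm τ' hτ'] at hm
        refine (f (χ.symm τ')).2.2 _ hm _ ?_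
        rw [hu.span _ hτ'.2.1]
        exact Submodule.subset_span ⟨j, rfl⟩
      have h3 := h1.unique ((hasDerivAt_const τ (0 : ℂ)).congr_of_eventuallyEq h2)
      have h4 : sympForm (B.mulVec ![0, 1, y (ψ τ), z (ψ τ)]) (u j (χ.symm τ)) = 0 := by
        refine (f (χ.symm τ)).2.2 _ ?_ _ ?_
        · rw [← hsymm τ hτ]
          exact (h.mem_iff_exists hball _).2 ⟨0, 1, by simp⟩
        · rw [hu.span _ hτ.2.1]
          exact Submodule.subset_span ⟨j, rfl⟩
      rw [sympForm_smul_left, sympForm_smul_left, h4] at h3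
      linear_combination h3
    have h5 := horth 1
    rw [← hαβ, sympForm_add_left, sympForm_smul_left, sympForm_smul_left, hω _ hτ.2.1,
      hω _ hτ.2.1, χ.right_inv hτ.1] at h5
    -- Dividing by this power is only possible off the centre; the value at the centre is recovered
    -- below by continuity.
    have hpow : (τ - χ q) ^ k ≠ 0 := pow_ne_zero _ (sub_ne_zero.2 hτq)
    have h6 : α * n (χ.symm τ) 0 1 + β * n (χ.symm τ) 1 1 = 0 := by
      apply mul_left_cancel₀ hpow
      linear_combination h5
    have h11 := hne _ hτ.2.1
    have hα : α ≠ 0 := by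
      rintro rfl
      have hβ : β = 0 := by
        rw [zero_mul, zero_add] at h6
        exact (mul_eq_zero.1 h6).resolve_right h11
      rw [hβ, zero_smul, zero_smul, add_zero] at hαβ
      exact legendreVec_ne_zero h.symp _ _ _ _ hαβ.symm
    refine ⟨-(n (χ.symm τ) 1 1) / α, ?_⟩
    rw [← hαβ, smul_add, smul_smul, smul_smul]
    congr 2
    · field_simp
    · field_simp
      linear_combination h6
  -- the last condition is closed
  let V : ℂ → C4 := fun τ => B⁻¹.mulVec
    (-(n (χ.symm τ) 1 1) • u 0 (χ.symm τ) + n (χ.symm τ) 0 1 • u 1 (χ.symm τ))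
  have hV : ContinuousAt V (χ q) := by
    have h1 : ContinuousAt (fun τ => -(n (χ.symm τ) 1 1) • u 0 (χ.symm τ) +
        n (χ.symm τ) 0 1 • u 1 (χ.symm τ)) (χ q) :=
      ((hn' 1 1).continuousAt.neg.smul (hu' 0 _ hq0).continuousAt).add
        ((hn' 0 1).continuousAt.smul (hu' 1 _ hq0).continuousAt)
    exact (Matrix.mulVecLin B⁻¹).toContinuousLinearMap.continuous.continuousAt.comp h1
  have hVi : ∀ i, ContinuousAt (fun τ => V τ i) (χ q) := fun i =>
    (continuous_apply i).continuousAt.comp hV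
  have hψq : ψ (χ q) = chartAt ℂ p q := by simp only [ψ, χ.left_inv (mem_chart_source ℂ q)]
  have hψc : ContinuousAt ψ (χ q) := (hψ _ hq0).continuousAt
  have hcomp : ∀ g : ℂ → ℂ, AnalyticAt ℂ g (chartAt ℂ p q) → ContinuousAt (fun τ => g (ψ τ)) (χ q) :=
    fun g hg => ContinuousAt.comp (g := g) (by rw [hψq]; exact hg.continuousAt) hψc
  have hlim : ∀ g : ℂ → ℂ, ContinuousAt g (χ q) → (∀ τ ∈ χ.target ∩ χ.symm ⁻¹' (U ∩ chartBall p R),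
      τ ≠ χ q → g τ = 0) → g (χ q) = 0 := by
    intro g hg hg0
    refine tendsto_nhds_unique (hg.mono_left nhdsWithin_le_nhds : Filter.Tendsto g (𝓝[≠] (χ q)) _) ?_
    refine tendsto_const_nhds.congr' ?_
    rw [Filter.EventuallyEq, eventually_nhdsWithin_iff]
    filter_upwards [hopen.mem_nhds hq0] with τ h1 h2
    exact (hg0 τ h1 h2).symm
  have hVc : ∀ τ ∈ χ.target ∩ χ.symm ⁻¹' (U ∩ chartBall p R), τ ≠ χ q →
      V τ = V τ 0 • legendreVec (x (ψ τ)) (y (ψ τ)) (z (ψ τ)) (s (ψ τ)) := by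
    intro τ hτ hτq
    obtain ⟨c, hc⟩ := hpt τ hτ hτq
    have : V τ = c • legendreVec (x (ψ τ)) (y (ψ τ)) (z (ψ τ)) (s (ψ τ)) := by
      simp only [V]
      rw [hc, Matrix.mulVec_smul, Sp2_inv_mulVec h.symp]
    rw [this]
    congr 1
    simp [legendreVec]
  have hL : ∀ i, ContinuousAt (fun τ => legendreVec (x (ψ τ)) (y (ψ τ)) (z (ψ τ)) (s (ψ τ)) i)
      (χ q) := by
    have hx := hcomp x (h.an_x _ ht)
    have hy := hcomp y (h.an_y _ ht)
    have hz := hcomp z (h.an_z _ ht)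
    have hs := hcomp s (h.an_s _ ht)
    intro i
    fin_cases i
    · exact continuousAt_const
    · exact hs
    · exact hx.add (hs.mul hy)
    · exact hy.add (hs.mul hz)
  have hfin : V (χ q) = V (χ q) 0 • legendreVec (x (ψ (χ q))) (y (ψ (χ q))) (z (ψ (χ q)))
      (s (ψ (χ q))) := by
    ext i
    refine sub_eq_zero.1 (hlim (fun τ => V τ i - V τ 0 * legendreVec (x (ψ τ)) (y (ψ τ)) (z (ψ τ))
      (s (ψ τ)) i) ((hVi i).sub ((hVi 0).mul (hL i))) fun τ hτ hτq => ?_)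
    rw [sub_eq_zero]
    exact congrFun (hVc τ hτ hτq) i
  rw [hψq] at hfin
  refine Submodule.mem_span_singleton.2 ⟨V (χ q) 0, ?_⟩
  rw [← Matrix.mulVec_smul, ← hfin]
  simp only [V, Sp2_mulVec_inv h.symp, χ.left_inv (mem_chart_source ℂ q)]

/-- The definition takes a span over admissible data, so one admissible choice must be exhibited:
the two columns of the graph frame, with k the order of vanishing of z' at p, z' = (t - z₀)ᵏ g, and
n = g · (s², -s; -s, 1). The resulting vector is -g times the Legendre vector. -/
lemma legendreAssociate_ne_bot [PreconnectedSpace S] (hf : IsIsotropicCurve f) (p : S) :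
    legendreAssociate f p ≠ ⊥ := by
  obtain ⟨R, B, x, y, z, s, h⟩ := exists_isNormalForm hf p
  set z₀ := chartAt ℂ p p with hz₀
  have hc := Metric.mem_ball_self (x := z₀) h.pos
  have hsymm : (chartAt ℂ p).symm z₀ = p := (chartAt ℂ p).left_inv (mem_chart_source ℂ p)
  have hzne : ¬ ∀ᶠ t in 𝓝 z₀, deriv z t = 0 := by
    intro hev
    have h1 : ∀ᶠ t in 𝓝[≠] z₀, deriv z t = 0 := hev.filter_mono nhdsWithin_le_nhds
    have h2 : ∀ᶠ t in 𝓝[≠] z₀, t ∈ Metric.ball z₀ R :=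
      (Filter.eventually_of_mem (Metric.ball_mem_nhds z₀ h.pos) fun _ => id).filter_mono
        nhdsWithin_le_nhds
    obtain ⟨t, ⟨h3, h4⟩, h5⟩ := ((h1.and h2).and eventually_mem_nhdsWithin).exists
    exact (h.deriv_ne_zero t h4 h5).1 h3
  obtain ⟨k, g, hg, hg0, hev⟩ := ((h.an_z _ hc).deriv.exists_eventuallyEq_pow_smul_nonzero_iff).2 hzne
  obtain ⟨r, hr, hball⟩ := ball_subset_of_eventually
    (hev.and (hg.eventually_analyticAt.and (hg.continuousAt.eventually_ne hg0)))
  set r' := min R r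
  have hR' : Metric.ball z₀ r' ⊆ Metric.ball z₀ R := Metric.ball_subset_ball (min_le_left R r)
  have hr' : Metric.ball z₀ r' ⊆ Metric.ball z₀ r := Metric.ball_subset_ball (min_le_right R r)
  let φ := chartAt ℂ p
  let u : Fin 2 → S → C4 := fun i q =>
    B.mulVec ![![1, 0] i, ![0, 1] i, ![1, 0] i * x (φ q) + ![0, 1] i * y (φ q),
      ![1, 0] i * y (φ q) + ![0, 1] i * z (φ q)]
  let n : S → Mat2 := fun q => !![g (φ q) * s (φ q) ^ 2, -(g (φ q) * s (φ q));
    -(g (φ q) * s (φ q)), g (φ q)]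
  have hhol : ∀ i, HolOn (u i) (chartBall p r') := by
    intro i q hq
    exact (mdifferentiableAt_comp_chart (g := fun τ => B.mulVec ![![1, 0] i, ![0, 1] i,
      ![1, 0] i * x τ + ![0, 1] i * y τ, ![1, 0] i * y τ + ![0, 1] i * z τ]) p hq.1
      (h.hasDerivAt_col (hR' hq.2) _ _).differentiableAt).mdifferentiableWithinAt
  have hlift : IsLift f (chartBall p r') u := by
    refine ⟨hhol, fun q hq => ?_, fun q hq => ?_⟩
    · have e : (fun i => u i q) = ![u 0 q, u 1 q] := by
        ext i; fin_cases i <;> rfl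
      rw [e, LinearIndependent.pair_iff]
      intro a b hab
      simp only [u, ← Matrix.mulVec_smul, ← Matrix.mulVec_add] at hab
      rw [← Matrix.mulVec_zero B, mulVec_eq_iff h.symp] at hab
      have h0 := congrFun hab 0
      have h1 := congrFun hab 1
      simp at h0 h1
      exact ⟨h0, h1⟩
    · ext v
      have hq' := h.mem_iff_exists (hR' hq.2) v
      rw [(chartAt ℂ p).left_inv hq.1] at hq'
      rw [hq', show Set.range (fun i => u i q) = {u 0 q, u 1 q} by
        ext; simp [Fin.exists_fin_two, eq_comm], Submodule.mem_span_pair]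
      refine exists_congr fun a => exists_congr fun b => ?_
      rw [eq_comm]
      simp only [u, ← Matrix.mulVec_smul, ← Matrix.mulVec_add]
      refine Eq.congr_left ?_
      congr 1
      ext i
      fin_cases i <;> simp [φ]
  have hmem : -(n p 1 1) • u 0 p + n p 0 1 • u 1 p ∈ legendreAssociate f p := by
    refine Submodule.subset_span ⟨chartBall p r', u, k, n, isOpen_chartBall p r',
      mem_chartBall_self p (lt_min h.pos hr), Set.inter_subset_left, hlift, ?_, ?_, ?_, rfl⟩
    · refine MatHolOn.of_comp_chart (p := p) (A := fun τ => (!![g τ * s τ ^ 2, -(g τ * s τ);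
        -(g τ * s τ), g τ] : Mat2)) Set.inter_subset_left fun q hq => ?_
      have h1 := (hball _ (hr' hq.2)).2.1
      have h2 := h.an_s _ (hR' hq.2)
      intro i j
      fin_cases i <;> fin_cases j
      exacts [h1.mul (h2.pow 2), (h1.mul h2).neg, (h1.mul h2).neg, h1]
    · intro q hq i j
      have hd : chartDeriv p (u j) q = B.mulVec ![0, 0,
          ![1, 0] j * deriv x (φ q) + ![0, 1] j * deriv y (φ q),
          ![1, 0] j * deriv y (φ q) + ![0, 1] j * deriv z (φ q)] := by
        refine ((h.hasDerivAt_col (hR' hq.2) (![1, 0] j) (![0, 1] j)).congr_of_eventuallyEq ?_).deriv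
        filter_upwards [eventually_mem_target ((chartAt ℂ p).map_source hq.1)] with τ hτ
        simp only [u, φ, (chartAt ℂ p).right_inv hτ]
      rw [hd]
      simp only [u]
      rw [h.symp]
      have h3 := (hball _ (hr' hq.2)).1
      rw [h.deriv_x _ (hR' hq.2), h.deriv_y _ (hR' hq.2), h3]
      fin_cases i <;> fin_cases j <;> simp [sympForm, n, φ, ← hz₀] <;> try ring
    · intro q hq
      exact (hball _ (hr' hq.2)).2.2
  intro hbot
  rw [hbot, Submodule.mem_bot] at hmem
  simp only [u, ← Matrix.mulVec_smul, ← Matrix.mulVec_add] at hmem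
  rw [← Matrix.mulVec_zero B, mulVec_eq_iff h.symp] at hmem
  have h0 := congrFun hmem 0
  simp [n] at h0
  exact hg0 h0

lemma IsNormalForm.legendreAssociate_eq [PreconnectedSpace S] (hf : IsIsotropicCurve f)
    (h : IsNormalForm f p R B x y z s) {t : ℂ} (ht : t ∈ Metric.ball (chartAt ℂ p p) R) :
    legendreAssociate f ((chartAt ℂ p).symm t) =
      Submodule.span ℂ {B.mulVec (legendreVec (x t) (y t) (z t) (s t))} := by
  refine le_antisymm (h.legendreAssociate_le ht) ?_
  obtain ⟨v, hv, hv0⟩ := Submodule.exists_mem_ne_zero_of_ne_bot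
    (legendreAssociate_ne_bot hf ((chartAt ℂ p).symm t))
  obtain ⟨c, rfl⟩ := Submodule.mem_span_singleton.1 (h.legendreAssociate_le ht hv)
  have hc : c ≠ 0 := by rintro rfl; simp at hv0
  rw [Submodule.span_singleton_le_iff_mem]
  exact (Submodule.smul_mem_iff _ hc).1 hv

lemma hasDerivAt_comp_chart_symm {w : S → C4} {U : Set S} (hU : IsOpen U) (hw : HolOn w U) {t : ℂ}
    (ht : t ∈ (chartAt ℂ p).target) (hq : (chartAt ℂ p).symm t ∈ U) :
    HasDerivAt (fun τ => w ((chartAt ℂ p).symm τ))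
      (mfderiv 𝓘(ℂ, ℂ) 𝓘(ℂ, C4) w ((chartAt ℂ p).symm t) (coordVec p t) : C4) t :=
  mfderiv_coordVec p ht ((hw _ hq).mdifferentiableAt (hU.mem_nhds hq))

lemma IsGraphForm.isCritical_iff_aux {F : S → Submodule ℂ C4} (h : IsGraphForm f p R B x y z)
    {t : ℂ} (ht : t ∈ Metric.ball (chartAt ℂ p p) R) :
    IsCritical F ((chartAt ℂ p).symm t) ↔ ∀ (U : Set S) (w : S → C4), IsOpen U →
      (chartAt ℂ p).symm t ∈ U → HolOn w U → (∀ q ∈ U, w q ∈ F q) →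
      deriv (fun τ => w ((chartAt ℂ p).symm τ)) t ∈ F ((chartAt ℂ p).symm t) := by
  refine forall_congr' fun U => forall_congr' fun w => forall_congr' fun hU => forall_congr' fun hq =>
    forall_congr' fun hw => forall_congr' fun hF => ?_
  rw [(hasDerivAt_comp_chart_symm hU hw (h.subset ht) hq).deriv]
  refine ⟨fun h' => h' _, fun h' v => ?_⟩
  obtain ⟨c, rfl⟩ := exists_smul_coordVec p (h.subset ht) v
  rw [map_smul]
  exact Submodule.smul_mem _ c h'

/-- The second column as test section has derivative with vanishing first two coordinates, which
lies in a graph only if it is zero; this gives z' = 0. Conversely, z' = 0 kills the derivative of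
the whole graph matrix, and differentiating ω(column, w) = 0 shows that w' is orthogonal to the
plane, hence in it. -/
lemma IsNormalForm.isCritical_iff (h : IsNormalForm f p R B x y z s) {t : ℂ}
    (ht : t ∈ Metric.ball (chartAt ℂ p p) R) :
    IsCritical (fun q => (f q).1) ((chartAt ℂ p).symm t) ↔ deriv z t = 0 := by
  rw [h.isCritical_iff_aux ht]
  have hcol := fun a b => h.hasDerivAt_col ht a b
  have hev := Filter.eventually_of_mem (Metric.isOpen_ball.mem_nhds ht) fun _ => id
  constructor
  · intro hcrit
    have h1 := hcrit (chartBall p R) (fun q => B.mulVec ![0, 1, 0 * x (chartAt ℂ p q) +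
      1 * y (chartAt ℂ p q), 0 * y (chartAt ℂ p q) + 1 * z (chartAt ℂ p q)])
      (isOpen_chartBall p R) (h.symm_mem ht)
      (fun q hq => (mdifferentiableAt_comp_chart (g := fun τ => B.mulVec ![0, 1,
        0 * x τ + 1 * y τ, 0 * y τ + 1 * z τ]) p hq.1
        (h.hasDerivAt_col hq.2 _ _).differentiableAt).mdifferentiableWithinAt)
      (fun q hq => by
        have := (h.mem_iff_exists hq.2 _).2 ⟨0, 1, rfl⟩
        rwa [(chartAt ℂ p).left_inv hq.1] at this)
    have h2 := (hcol 0 1).congr_of_eventuallyEq (f₁ := fun τ => B.mulVec ![0, 1,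
      0 * x (chartAt ℂ p ((chartAt ℂ p).symm τ)) + 1 * y (chartAt ℂ p ((chartAt ℂ p).symm τ)),
      0 * y (chartAt ℂ p ((chartAt ℂ p).symm τ)) + 1 * z (chartAt ℂ p ((chartAt ℂ p).symm τ))])
      (hev.mono fun τ hτ => by simp only [(chartAt ℂ p).right_inv (h.subset hτ)])
    rw [h2.deriv, h.mem_iff_exists ht] at h1
    obtain ⟨a, b, hab⟩ := h1
    rw [mulVec_eq_iff h.symp] at hab
    have e0 := congrFun hab 0
    have e1 := congrFun hab 1
    have e3 := congrFun hab 3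
    simp at e0 e1 e3
    rw [e3, ← e0, ← e1]; ring
  · intro hz0 U w hU hq hw hF
    have hd := (hasDerivAt_comp_chart_symm hU hw (h.subset ht) hq)
    have horth : ∀ a b : ℂ, sympForm (B.mulVec ![a, b, a * x t + b * y t, a * y t + b * z t])
        (deriv (fun τ => w ((chartAt ℂ p).symm τ)) t) = 0 := by
      intro a b
      have h1 := hasDerivAt_sympForm (hcol a b) hd
      have h2 : ∀ᶠ τ in 𝓝 t, sympForm (B.mulVec ![a, b, a * x τ + b * y τ, a * y τ + b * z τ])
          (w ((chartAt ℂ p).symm τ)) = 0 := by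
        filter_upwards [hev, eventually_chart_symm (h.subset ht) hU hq] with τ h3 h4
        exact (f _).2.2 _ ((h.mem_iff_exists h3 _).2 ⟨a, b, rfl⟩) _ (hF _ h4)
      have h3 := h1.unique ((hasDerivAt_const t (0 : ℂ)).congr_of_eventuallyEq h2)
      rw [h.deriv_x t ht, h.deriv_y t ht, hz0] at h3
      have h4 : (![0, 0, a * (s t ^ 2 * 0) + b * (-s t * 0), a * (-s t * 0) + b * 0] : C4) = 0 := by
        ext i; fin_cases i <;> simp
      rw [h4, Matrix.mulVec_zero, show sympForm 0 (w ((chartAt ℂ p).symm t)) = 0 by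
        simp [sympForm], zero_add] at h3
      rw [hd.deriv]
      exact h3
    rw [h.mem_iff ht]
    have e : ∀ (a b : ℂ) (j : Fin 4), (∀ i, graphFrame (x t) (y t) (z t) i j =
        (![a, b, a * x t + b * y t, a * y t + b * z t] : C4) i) →
        (fun i => (B * graphFrame (x t) (y t) (z t)) i j : C4) =
          B.mulVec ![a, b, a * x t + b * y t, a * y t + b * z t] := by
      intro a b j hj
      ext i
      simp only [Matrix.mul_apply, Matrix.mulVec, dotProduct, hj]
    rw [e 1 0 0 (fun i => by fin_cases i <;> simp [graphFrame]),
      e 0 1 1 (fun i => by fin_cases i <;> simp [graphFrame])]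
    exact ⟨horth 1 0, horth 0 1⟩

/-- The derivative of the Legendre vector is s' times the second column, which is independent of
that vector. Any other section is a holomorphic multiple of it, the factor being the first
coordinate with respect to B. -/
lemma IsNormalForm.isCritical_legendreAssociate_iff [PreconnectedSpace S] (hf : IsIsotropicCurve f)
    (h : IsNormalForm f p R B x y z s) {t : ℂ} (ht : t ∈ Metric.ball (chartAt ℂ p p) R) :
    IsCritical (legendreAssociate f) ((chartAt ℂ p).symm t) ↔ deriv s t = 0 := by
  rw [h.isCritical_iff_aux ht]
  have hev := Filter.eventually_of_mem (Metric.isOpen_ball.mem_nhds ht) fun _ => id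
  have hξ := h.hasDerivAt_legendreVec ht
  rw [h.legendreAssociate_eq hf ht]
  constructor
  · intro hcrit
    have h1 := hcrit (chartBall p R) (fun q => B.mulVec (legendreVec (x (chartAt ℂ p q))
      (y (chartAt ℂ p q)) (z (chartAt ℂ p q)) (s (chartAt ℂ p q))))
      (isOpen_chartBall p R) (h.symm_mem ht)
      (fun q hq => (mdifferentiableAt_comp_chart (g := fun τ => B.mulVec
        (legendreVec (x τ) (y τ) (z τ) (s τ))) p hq.1
        (h.hasDerivAt_legendreVec hq.2).differentiableAt).mdifferentiableWithinAt)
      (fun q hq => by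
        have := h.legendreAssociate_eq hf hq.2
        rw [(chartAt ℂ p).left_inv hq.1] at this
        rw [this]
        exact Submodule.mem_span_singleton_self _)
    have h2 := hξ.congr_of_eventuallyEq (f₁ := fun τ => B.mulVec (legendreVec
      (x (chartAt ℂ p ((chartAt ℂ p).symm τ))) (y (chartAt ℂ p ((chartAt ℂ p).symm τ)))
      (z (chartAt ℂ p ((chartAt ℂ p).symm τ))) (s (chartAt ℂ p ((chartAt ℂ p).symm τ)))))
      (hev.mono fun τ hτ => by simp only [(chartAt ℂ p).right_inv (h.subset hτ)])
    rw [h2.deriv, Submodule.mem_span_singleton] at h1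
    obtain ⟨c, hc⟩ := h1
    rw [← Matrix.mulVec_smul, ← Matrix.mulVec_smul, mulVec_eq_iff h.symp] at hc
    have e0 := congrFun hc 0
    have e1 := congrFun hc 1
    simp [legendreVec] at e0 e1
    rw [← e1, e0]; ring
  · intro hs0 U w hU hq hw hF
    have hd := (hasDerivAt_comp_chart_symm hU hw (h.subset ht) hq)
    have hc := hasDerivAt_pi.1 (hasDerivAt_mulVec B⁻¹ hd) 0
    have h1 := hc.smul hξ
    have h2 := hd.unique (h1.congr_of_eventuallyEq (by
      filter_upwards [hev, eventually_chart_symm (h.subset ht) hU hq] with τ h3 h4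
      have h5 := hF _ h4
      rw [h.legendreAssociate_eq hf h3, Submodule.mem_span_singleton] at h5
      obtain ⟨c, hc⟩ := h5
      change _ = (B⁻¹.mulVec (w ((chartAt ℂ p).symm τ))) 0 • B.mulVec _
      rw [← hc, Matrix.mulVec_smul, Sp2_inv_mulVec h.symp]
      congr 1
      simp [legendreVec]))
    rw [hd.deriv, h2, hs0, zero_smul, smul_zero, zero_add]
    exact Submodule.smul_mem _ _ (Submodule.mem_span_singleton_self _)

lemma IsNormalForm.mem_critSet_iff [PreconnectedSpace S] (hf : IsIsotropicCurve f)
    (h : IsNormalForm f p R B x y z s) {t : ℂ} (ht : t ∈ Metric.ball (chartAt ℂ p p) R) :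
    (chartAt ℂ p).symm t ∈ critSet f ↔ deriv z t = 0 ∨ deriv s t = 0 :=
  or_congr (h.isCritical_iff ht) (h.isCritical_legendreAssociate_iff hf ht)

/-- Critical points are isolated. -/
lemma IsNormalForm.eq_of_mem_critSet [PreconnectedSpace S] (hf : IsIsotropicCurve f)
    (h : IsNormalForm f p R B x y z s) {q : S} (hq : q ∈ chartBall p R) (hcrit : q ∈ critSet f) :
    q = p := by
  rw [← (chartAt ℂ p).left_inv hq.1, h.mem_critSet_iff hf hq.2] at hcrit
  by_contra hne
  have hne' : chartAt ℂ p q ≠ chartAt ℂ p p := fun h' =>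
    hne ((chartAt ℂ p).injOn hq.1 (mem_chart_source ℂ p) h')
  obtain ⟨h1, h2⟩ := h.deriv_ne_zero _ hq.2 hne'
  exact hcrit.elim h1 h2

lemma isClosed_critSet [PreconnectedSpace S] (hf : IsIsotropicCurve f) :
    IsClosed (critSet f) := by
  rw [← isOpen_compl_iff, isOpen_iff_forall_mem_open]
  intro p hp
  obtain ⟨R, B, x, y, z, s, h⟩ := exists_isNormalForm hf p
  exact ⟨chartBall p R, fun q hq hcrit => hp (h.eq_of_mem_critSet hf hq hcrit ▸ hcrit),
    isOpen_chartBall p R, mem_chartBall_self p h.pos⟩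

lemma isDiscrete_critSet [PreconnectedSpace S] (hf : IsIsotropicCurve f) :
    IsDiscrete (critSet f) := by
  refine ⟨discreteTopology_iff_isOpen_singleton.2 fun p => ?_⟩
  obtain ⟨R, B, x, y, z, s, h⟩ := exists_isNormalForm hf p.1
  refine ⟨chartBall p.1 R, isOpen_chartBall p.1 R, ?_⟩
  ext q
  constructor
  · intro hq
    exact Subtype.ext (h.eq_of_mem_critSet hf hq q.2)
  · rintro rfl
    exact mem_chartBall_self _ h.pos

end

/-! ### The adapted frame of an isotropic curve in normal form -/

section

variable (z s : ℂ → ℂ)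

/-- The derivative of `z` with respect to the parameter `s`. -/
def curvZ (t : ℂ) : ℂ := deriv z t / deriv s t

/-- A third of the logarithmic derivative of `curvZ` with respect to the parameter `s`. -/
def curvP (t : ℂ) : ℂ := deriv (curvZ z s) t / (3 * deriv s t * curvZ z s t)

/-- The coefficient of `φ²₄` of the adapted frame with respect to the parameter `s`. -/
def curvR (t : ℂ) : ℂ :=
  -(2 / 5) * (deriv (curvP z s) t / deriv s t - 2 * curvP z s t ^ 2) / curvZ z s t

/-- An auxiliary function, which involves the derivative of `curvR`. -/
def curvK (t : ℂ) : ℂ := deriv (curvR z s) t / deriv s t + curvP z s t * curvR z s t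

/-- The coefficient of `φ¹₃` of the adapted frame with respect to the parameter `s`. -/
def curvS (t : ℂ) : ℂ :=
  3 / 4 * (deriv (curvK z s) t / deriv s t) / curvZ z s t ^ 2 - 9 / 16 * curvR z s t ^ 2 / curvZ z s t

variable {z s} {t : ℂ}

lemma curvZ_ne_zero (hz0 : deriv z t ≠ 0) (hs0 : deriv s t ≠ 0) : curvZ z s t ≠ 0 :=
  div_ne_zero hz0 hs0

lemma analyticAt_curvZ (hz : AnalyticAt ℂ z t) (hs : AnalyticAt ℂ s t) (hs0 : deriv s t ≠ 0) :
    AnalyticAt ℂ (curvZ z s) t := hz.deriv.div hs.deriv hs0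

lemma analyticAt_curvP (hz : AnalyticAt ℂ z t) (hs : AnalyticAt ℂ s t) (hz0 : deriv z t ≠ 0)
    (hs0 : deriv s t ≠ 0) : AnalyticAt ℂ (curvP z s) t :=
  (analyticAt_curvZ hz hs hs0).deriv.div
    ((analyticAt_const.mul hs.deriv).mul (analyticAt_curvZ hz hs hs0))
    (mul_ne_zero (mul_ne_zero three_ne_zero hs0) (curvZ_ne_zero hz0 hs0))

lemma analyticAt_curvR (hz : AnalyticAt ℂ z t) (hs : AnalyticAt ℂ s t) (hz0 : deriv z t ≠ 0)
    (hs0 : deriv s t ≠ 0) : AnalyticAt ℂ (curvR z s) t :=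
  (analyticAt_const.mul (((analyticAt_curvP hz hs hz0 hs0).deriv.div hs.deriv hs0).sub
    (analyticAt_const.mul ((analyticAt_curvP hz hs hz0 hs0).pow 2)))).div
    (analyticAt_curvZ hz hs hs0) (curvZ_ne_zero hz0 hs0)

lemma analyticAt_curvK (hz : AnalyticAt ℂ z t) (hs : AnalyticAt ℂ s t) (hz0 : deriv z t ≠ 0)
    (hs0 : deriv s t ≠ 0) : AnalyticAt ℂ (curvK z s) t :=
  ((analyticAt_curvR hz hs hz0 hs0).deriv.div hs.deriv hs0).add
    ((analyticAt_curvP hz hs hz0 hs0).mul (analyticAt_curvR hz hs hz0 hs0))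

lemma meromorphicAt_curvZ (hz : MeromorphicAt z t) (hs : MeromorphicAt s t) :
    MeromorphicAt (curvZ z s) t := hz.deriv.div hs.deriv

lemma meromorphicAt_curvP (hz : MeromorphicAt z t) (hs : MeromorphicAt s t) :
    MeromorphicAt (curvP z s) t :=
  (meromorphicAt_curvZ hz hs).deriv.div
    (((MeromorphicAt.const 3 t).mul hs.deriv).mul (meromorphicAt_curvZ hz hs))

lemma meromorphicAt_curvR (hz : MeromorphicAt z t) (hs : MeromorphicAt s t) :
    MeromorphicAt (curvR z s) t :=
  ((MeromorphicAt.const _ t).mul (((meromorphicAt_curvP hz hs).deriv.div hs.deriv).sub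
    ((MeromorphicAt.const _ t).mul ((meromorphicAt_curvP hz hs).pow 2)))).div
    (meromorphicAt_curvZ hz hs)

lemma meromorphicAt_curvK (hz : MeromorphicAt z t) (hs : MeromorphicAt s t) :
    MeromorphicAt (curvK z s) t :=
  ((meromorphicAt_curvR hz hs).deriv.div hs.deriv).add
    ((meromorphicAt_curvP hz hs).mul (meromorphicAt_curvR hz hs))

lemma meromorphicAt_curvS (hz : MeromorphicAt z t) (hs : MeromorphicAt s t) :
    MeromorphicAt (curvS z s) t :=
  (((MeromorphicAt.const _ t).mul ((meromorphicAt_curvK hz hs).deriv.div hs.deriv)).div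
    ((meromorphicAt_curvZ hz hs).pow 2)).sub
    (((MeromorphicAt.const _ t).mul ((meromorphicAt_curvR hz hs).pow 2)).div
      (meromorphicAt_curvZ hz hs))

/-- The adapted frame is the product of a graph frame with a matrix of this form. -/
def gaugeMat (s ζ p r k : ℂ) : Mat4 :=
  !![ζ, 0, 3 / 4 * k / ζ, -(3 / 4 * r);
     s * ζ, 1, s * (3 / 4 * k / ζ) - 3 / 4 * r / ζ, -(s * (3 / 4 * r)) - p / ζ;
     0, 0, ζ⁻¹, -s;
     0, 0, 0, 1]

lemma gaugeMat_mem_Sp2 {s ζ : ℂ} (hζ : ζ ≠ 0) (p r k : ℂ) : gaugeMat s ζ p r k ∈ Sp2 := by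
  rw [mem_Sp2_iff_col]
  intro i j; fin_cases i <;> fin_cases j <;>
    simp [gaugeMat, sympForm, gram] <;> field_simp <;> ring

/-- The product of `E` with the gauge matrix at `t`. -/
def adaptedFrame (E : ℂ → Mat4) (z s : ℂ → ℂ) (t : ℂ) : Mat4 :=
  E t * gaugeMat (s t) (curvZ z s t) (curvP z s t) (curvR z s t) (curvK z s t)

/-- The Maurer-Cartan form of the adapted frame. -/
def adaptedForm (z s : ℂ → ℂ) (t : ℂ) : Mat4 :=
  deriv s t • pfaffForm (curvP z s t) (curvZ z s t) (curvR z s t) (curvS z s t)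

lemma matAnalyticAt_adaptedFrame {E : ℂ → Mat4} (hE : MatAnalyticAt E t) (hz : AnalyticAt ℂ z t)
    (hs : AnalyticAt ℂ s t) (hz0 : deriv z t ≠ 0) (hs0 : deriv s t ≠ 0) :
    MatAnalyticAt (adaptedFrame E z s) t := by
  refine hE.mul ?_
  have hZ := analyticAt_curvZ hz hs hs0
  have hZ0 := curvZ_ne_zero hz0 hs0
  have hP := analyticAt_curvP hz hs hz0 hs0
  have hR := analyticAt_curvR hz hs hz0 hs0
  have hK := analyticAt_curvK hz hs hz0 hs0
  intro i j
  fin_cases i <;> fin_cases j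
  · exact hZ
  · exact analyticAt_const
  · exact (analyticAt_const.mul hK).div hZ hZ0
  · exact (analyticAt_const.mul hR).neg
  · exact hs.mul hZ
  · exact analyticAt_const
  · exact (hs.mul ((analyticAt_const.mul hK).div hZ hZ0)).sub
      ((analyticAt_const.mul hR).div hZ hZ0)
  · exact (hs.mul (analyticAt_const.mul hR)).neg.sub (hP.div hZ hZ0)
  · exact analyticAt_const
  · exact analyticAt_const
  · exact hZ.inv hZ0
  · exact hs.neg
  · exact analyticAt_const
  · exact analyticAt_const
  · exact analyticAt_const
  · exact analyticAt_const

/-- This is the equation M' = MΦ - GM for the gauge matrix. It reduces to four equations in the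
parameter s: ζ_s = 3pζ, p_s = 2p² - (5/2)rζ, r_s = k - pr and k_s = (4/3)ζ²(c + (9/16)r²/ζ). -/
lemma matDerivAt_gaugeMat {s ζ p r k : ℂ → ℂ} {s' c t : ℂ} (hζ : ζ t ≠ 0)
    (hs : HasDerivAt s s' t) (hZ : HasDerivAt ζ (3 * s' * p t * ζ t) t)
    (hP : HasDerivAt p (s' * (2 * p t ^ 2 - 5 / 2 * r t * ζ t)) t)
    (hR : HasDerivAt r (s' * (k t - p t * r t)) t)
    (hK : HasDerivAt k (s' * (4 / 3 * ζ t ^ 2 * (c + 9 / 16 * r t ^ 2 / ζ t))) t) :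
    MatDerivAt (fun τ => gaugeMat (s τ) (ζ τ) (p τ) (r τ) (k τ))
      (gaugeMat (s t) (ζ t) (p t) (r t) (k t) * (s' • pfaffForm (p t) (ζ t) (r t) c) -
        graphForm (s t ^ 2 * (ζ t * s')) (-s t * (ζ t * s')) (ζ t * s') *
          gaugeMat (s t) (ζ t) (p t) (r t) (k t)) t := by
  have h02 := ((hK.const_mul (3 / 4)).div hZ hζ)
  have h34r := hR.const_mul (3 / 4)
  intro i j
  fin_cases i <;> fin_cases j
  · refine hZ.congr_deriv ?_
    simp [gaugeMat, graphForm, pfaffForm]; try ring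
  · refine (hasDerivAt_const t 0).congr_deriv ?_
    simp [gaugeMat, graphForm, pfaffForm]; try ring
  · refine h02.congr_deriv ?_
    simp [gaugeMat, graphForm, pfaffForm]; field_simp; ring
  · refine h34r.neg.congr_deriv ?_
    simp [gaugeMat, graphForm, pfaffForm]; field_simp; ring
  · refine (hs.mul hZ).congr_deriv ?_
    simp [gaugeMat, graphForm, pfaffForm]; try ring
  · refine (hasDerivAt_const t 1).congr_deriv ?_
    simp [gaugeMat, graphForm, pfaffForm]; field_simp; ring
  · refine ((hs.mul h02).sub (h34r.div hZ hζ)).congr_deriv ?_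
    simp [gaugeMat, graphForm, pfaffForm]; field_simp; ring
  · refine ((hs.mul h34r).neg.sub (hP.div hZ hζ)).congr_deriv ?_
    simp [gaugeMat, graphForm, pfaffForm]; field_simp; ring
  · refine (hasDerivAt_const t 0).congr_deriv ?_
    simp [gaugeMat, graphForm, pfaffForm]; try ring
  · refine (hasDerivAt_const t 0).congr_deriv ?_
    simp [gaugeMat, graphForm, pfaffForm]; try ring
  · refine (hZ.fun_inv hζ).congr_deriv ?_
    simp [gaugeMat, graphForm, pfaffForm]; field_simp; ring
  · refine hs.neg.congr_deriv ?_
    simp [gaugeMat, graphForm, pfaffForm]; field_simp; ring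
  · refine (hasDerivAt_const t 0).congr_deriv ?_
    simp [gaugeMat, graphForm, pfaffForm]; try ring
  · refine (hasDerivAt_const t 0).congr_deriv ?_
    simp [gaugeMat, graphForm, pfaffForm]; try ring
  · refine (hasDerivAt_const t 0).congr_deriv ?_
    simp [gaugeMat, graphForm, pfaffForm]; field_simp; ring
  · refine (hasDerivAt_const t 1).congr_deriv ?_
    simp [gaugeMat, graphForm, pfaffForm]; field_simp; ring

/-- `curvP`, `curvR`, `curvK` and `curvS` are defined by solving the four differential equations of
`matDerivAt_gaugeMat` successively for p, r, k and c. -/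
lemma matDerivAt_adaptedFrame {E : ℂ → Mat4} (hz : AnalyticAt ℂ z t) (hs : AnalyticAt ℂ s t)
    (hz0 : deriv z t ≠ 0) (hs0 : deriv s t ≠ 0)
    (hE : MatDerivAt E (E t * graphForm (s t ^ 2 * deriv z t) (-s t * deriv z t) (deriv z t)) t) :
    MatDerivAt (adaptedFrame E z s) (adaptedFrame E z s t * adaptedForm z s t) t := by
  have hZ0 := curvZ_ne_zero hz0 hs0
  have e : curvZ z s t * deriv s t = deriv z t := by rw [curvZ]; field_simp
  have h1 := matDerivAt_gaugeMat (s := s) (ζ := curvZ z s) (p := curvP z s) (r := curvR z s)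
    (k := curvK z s) (s' := deriv s t) (c := curvS z s t) hZ0 hs.differentiableAt.hasDerivAt
    ((analyticAt_curvZ hz hs hs0).differentiableAt.hasDerivAt.congr_deriv
      (by rw [curvP]; field_simp))
    ((analyticAt_curvP hz hs hz0 hs0).differentiableAt.hasDerivAt.congr_deriv
      (by rw [curvR]; field_simp; ring))
    ((analyticAt_curvR hz hs hz0 hs0).differentiableAt.hasDerivAt.congr_deriv
      (by rw [curvK]; field_simp; ring))
    ((analyticAt_curvK hz hs hz0 hs0).differentiableAt.hasDerivAt.congr_deriv
      (by rw [curvS]; field_simp; ring))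
  rw [e] at h1
  have h2 := hE.mul h1
  -- The term EGM coming from E' = EG cancels against -E(GM), leaving (EM)Φ.
  rw [Matrix.mul_sub, ← Matrix.mul_assoc, ← Matrix.mul_assoc, Matrix.mul_assoc _ (graphForm _ _ _),
    ← Matrix.mul_assoc, Matrix.mul_assoc _ (graphForm _ _ _), add_sub_cancel] at h2
  exact h2

end

/-! ### Adapted local sections -/

section

variable {S : Type*} [TopologicalSpace S] [ChartedSpace ℂ S]

/-- A local holomorphic section of the frame bundle of `f` that is an integral curve of the Pfaffian
system. -/
structure IsAdapted (f : S → Q3) (U : Set S) (σ : S → Mat4) : Prop where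
  hol : MatHolOn σ U
  frame : ∀ q ∈ U, (q, σ q) ∈ frameBundle f
  form : ∀ q ∈ U, ∀ v, ∃ p h r s, (v ≠ 0 → h ≠ 0) ∧
    (σ q)⁻¹ * matD σ q v = pfaffForm p h r s

variable [IsManifold 𝓘(ℂ, ℂ) 1 S]

lemma IsAdapted.of_chart {f : S → Q3} {U : Set S} (hU : IsOpen U) {σ : S → Mat4} {p : S}
    (hUp : U ⊆ (chartAt ℂ p).source)
    (hol : MatHolOn σ U) (frame : ∀ q ∈ U, (q, σ q) ∈ frameBundle f)
    (form : ∀ t ∈ (chartAt ℂ p).target, (chartAt ℂ p).symm t ∈ U → ∃ c h r s, h ≠ 0 ∧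
      MatDerivAt (fun τ => σ ((chartAt ℂ p).symm τ))
        (σ ((chartAt ℂ p).symm t) * pfaffForm c h r s) t) : IsAdapted f U σ := by
  refine ⟨hol, frame, fun q hq => ?_⟩
  have ht := (chartAt ℂ p).map_source (hUp hq)
  have hsymm := (chartAt ℂ p).left_inv (hUp hq)
  obtain ⟨t, htq⟩ : ∃ t, t = chartAt ℂ p q := ⟨_, rfl⟩
  rw [← htq] at ht hsymm
  subst hsymm
  intro v
  obtain ⟨a, rfl⟩ := exists_smul_coordVec p ht v
  obtain ⟨c, h, r, s, hh, hd⟩ := form t ht hq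
  refine ⟨a * c, a * h, a * r, a * s, fun hv => mul_ne_zero ?_ hh, ?_⟩
  · rintro rfl; simp at hv
  · rw [matD_smul, (hol.matDerivAt_chart hU p ht hq).unique hd, Matrix.mul_smul,
      Sp2_inv_mul_cancel (frame _ hq).1, smul_pfaffForm]

lemma IsAdapted.matDerivAt_chart {f : S → Q3} {U : Set S} (hU : IsOpen U) {σ : S → Mat4}
    (hσ : IsAdapted f U σ) (p : S) {t : ℂ} (ht : t ∈ (chartAt ℂ p).target)
    (hq : (chartAt ℂ p).symm t ∈ U) : ∃ c h r s, h ≠ 0 ∧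
      MatDerivAt (fun τ => σ ((chartAt ℂ p).symm τ))
        (σ ((chartAt ℂ p).symm t) * pfaffForm c h r s) t := by
  obtain ⟨c, h, r, s, hh, he⟩ := hσ.form _ hq (coordVec p t)
  refine ⟨c, h, r, s, hh (coordVec_ne_zero p ht), ?_⟩
  rw [← he, Sp2_mul_inv_cancel (hσ.frame _ hq).1]
  exact hσ.hol.matDerivAt_chart hU p ht hq

variable {f : S → Q3} {p : S} {R : ℝ} {B : Mat4} {x y z s : ℂ → ℂ}

/-- The adapted frame of a normal form. -/
def normalFrame (p : S) (B : Mat4) (x y z s : ℂ → ℂ) (q : S) : Mat4 :=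
  adaptedFrame (fun τ => B * graphFrame (x τ) (y τ) (z τ)) z s (chartAt ℂ p q)

lemma IsNormalForm.matDerivAt_normalFrame [PreconnectedSpace S] (hf : IsIsotropicCurve f)
    (h : IsNormalForm f p R B x y z s) {t : ℂ} (ht : t ∈ Metric.ball (chartAt ℂ p p) R)
    (hcrit : (chartAt ℂ p).symm t ∉ critSet f) :
    MatDerivAt (fun τ => normalFrame p B x y z s ((chartAt ℂ p).symm τ))
      (normalFrame p B x y z s ((chartAt ℂ p).symm t) * adaptedForm z s t) t := by
  rw [h.mem_critSet_iff hf ht, not_or] at hcrit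
  have hE := h.matDerivAt ht
  rw [h.deriv_x t ht, h.deriv_y t ht] at hE
  have := matDerivAt_adaptedFrame (h.an_z t ht) (h.an_s t ht) hcrit.1 hcrit.2 hE
  simp only [normalFrame, (chartAt ℂ p).right_inv (h.subset ht)]
  exact this.congr ((eventually_mem_target (h.subset ht)).mono fun τ hτ => by
    rw [(chartAt ℂ p).right_inv hτ])

/-- The first two columns of the gauge matrix only combine the first two columns of E, so the plane
is unchanged. -/
lemma span_mul_gaugeMat {P : Q3} {E : Mat4} (hE : E ∈ Sp2)
    (hP : P.1 = Submodule.span ℂ {(fun i => E i 0 : C4), (fun i => E i 1 : C4)})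
    {s ζ : ℂ} (hζ : ζ ≠ 0) (p r k : ℂ) :
    P.1 = Submodule.span ℂ {(fun i => (E * gaugeMat s ζ p r k) i 0 : C4),
      (fun i => (E * gaugeMat s ζ p r k) i 1 : C4)} := by
  apply eq_span_cols (Sp2_mul hE (gaugeMat_mem_Sp2 hζ p r k))
  · rw [hP, Submodule.mem_span_pair]
    refine ⟨ζ, s * ζ, ?_⟩
    ext i; simp [gaugeMat, Matrix.mul_apply, Fin.sum_univ_four]; ring
  · rw [hP, Submodule.mem_span_pair]
    refine ⟨0, 1, ?_⟩
    ext i; simp [gaugeMat, Matrix.mul_apply, Fin.sum_univ_four]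

lemma IsNormalForm.isAdapted_normalFrame [PreconnectedSpace S] (hf : IsIsotropicCurve f)
    (h : IsNormalForm f p R B x y z s) :
    IsAdapted f (chartBall p R ∩ (critSet f)ᶜ) (normalFrame p B x y z s) := by
  have hopen := (isOpen_chartBall p R).inter (isClosed_critSet hf).isOpen_compl
  have hne : ∀ q ∈ chartBall p R ∩ (critSet f)ᶜ,
      deriv z (chartAt ℂ p q) ≠ 0 ∧ deriv s (chartAt ℂ p q) ≠ 0 := by
    rintro q ⟨hq, hcrit⟩
    rwa [Set.mem_compl_iff, ← (chartAt ℂ p).left_inv hq.1, h.mem_critSet_iff hf hq.2, not_or]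
      at hcrit
  refine IsAdapted.of_chart hopen (fun q hq => hq.1.1) ?_ ?_ ?_
  · exact MatHolOn.of_comp_chart (fun q hq => hq.1.1) fun q hq =>
      matAnalyticAt_adaptedFrame (h.matAnalyticAt hq.1.2) (h.an_z _ hq.1.2) (h.an_s _ hq.1.2)
        (hne q hq).1 (hne q hq).2
  · intro q hq
    have hfr := h.frame _ hq.1.2
    rw [(chartAt ℂ p).left_inv hq.1.1] at hfr
    have hζ := curvZ_ne_zero (hne q hq).1 (hne q hq).2
    exact ⟨Sp2_mul hfr.1 (gaugeMat_mem_Sp2 hζ _ _ _), span_mul_gaugeMat hfr.1 hfr.2 hζ _ _ _⟩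
  · intro t ht hq
    have htb : t ∈ Metric.ball (chartAt ℂ p p) R := by
      have := hq.1.2
      rwa [Set.mem_preimage, (chartAt ℂ p).right_inv ht] at this
    have hne' := hne _ hq
    rw [(chartAt ℂ p).right_inv ht] at hne'
    have hd := h.matDerivAt_normalFrame hf htb hq.2
    rw [adaptedForm, smul_pfaffForm] at hd
    exact ⟨_, _, _, _, mul_ne_zero hne'.2 (curvZ_ne_zero hne'.1 hne'.2), hd⟩

end

/-! ### Uniqueness of adapted frames up to `H₁` -/

/-- An adapted frame whose first two columns agree with those of the frame of the normal form
agrees with it. -/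
lemma eq_gaugeMat_of_cols {z s : ℂ → ℂ} {M : ℂ → Mat4} {t₀ : ℂ} (hz : AnalyticAt ℂ z t₀)
    (hs : AnalyticAt ℂ s t₀) (hz0 : deriv z t₀ ≠ 0) (hs0 : deriv s t₀ ≠ 0)
    (hsp : ∀ᶠ t in 𝓝 t₀, M t ∈ Sp2)
    (hcol0 : ∀ᶠ t in 𝓝 t₀, M t 0 0 = curvZ z s t ∧ M t 1 0 = s t * curvZ z s t ∧ M t 2 0 = 0 ∧
      M t 3 0 = 0)
    (hcol1 : ∀ᶠ t in 𝓝 t₀, M t 0 1 = 0 ∧ M t 1 1 = 1 ∧ M t 2 1 = 0 ∧ M t 3 1 = 0)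
    (hD : ∀ᶠ t in 𝓝 t₀, ∃ p h r c, MatDerivAt M (M t * pfaffForm p h r c -
      graphForm (s t ^ 2 * deriv z t) (-s t * deriv z t) (deriv z t) * M t) t) :
    M t₀ = gaugeMat (s t₀) (curvZ z s t₀) (curvP z s t₀) (curvR z s t₀) (curvK z s t₀) := by
  have hgen : ∀ᶠ t in 𝓝 t₀, AnalyticAt ℂ z t ∧ AnalyticAt ℂ s t ∧ deriv z t ≠ 0 ∧ deriv s t ≠ 0 :=
    hz.eventually_analyticAt.and (hs.eventually_analyticAt.and
      ((hz.deriv.continuousAt.eventually_ne hz0).and (hs.deriv.continuousAt.eventually_ne hs0)))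
  -- the consequences of the symplectic condition
  have hsymp : ∀ᶠ t in 𝓝 t₀, M t 3 2 = 0 ∧ M t 2 2 * curvZ z s t = 1 ∧ M t 3 3 = 1 ∧
      M t 2 3 = -s t ∧ M t 1 2 * curvZ z s t = s t * M t 0 2 * curvZ z s t + M t 0 3 := by
    filter_upwards [hsp, hcol0, hcol1, hgen] with t h1 ⟨h2, h3, h4, h5⟩ ⟨h6, h7, h8, h9⟩ ⟨_, _, h10, h11⟩
    have hZ := curvZ_ne_zero h10 h11
    rw [mem_Sp2_iff_col] at h1
    have e02 := h1 0 2
    have e12 := h1 1 2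
    have e03 := h1 0 3
    have e13 := h1 1 3
    have e23 := h1 2 3
    simp [sympForm, gram, h2, h3, h4, h5, h6, h7, h8, h9] at e02 e12 e03 e13 e23
    have e23' : M t 2 3 = -s t := by
      apply mul_left_cancel₀ hZ
      rw [e13] at e03
      linear_combination e03
    refine ⟨e12, ?_, e13, e23', ?_⟩
    · rw [e12] at e02; linear_combination e02
    · have e22 : M t 2 2 * curvZ z s t = 1 := by rw [e12] at e02; linear_combination e02
      rw [e12, e13, e23'] at e23
      linear_combination curvZ z s t * e23 + M t 0 3 * e22
  -- the consequences of the structure equations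
  have hode : ∀ᶠ t in 𝓝 t₀, ∃ r, 3 / 4 * r * curvZ z s t + M t 0 3 * deriv z t = 0 ∧
      3 / 4 * r * s t * curvZ z s t + deriv s t * curvP z s t + M t 1 3 * deriv z t = 0 ∧
      HasDerivAt (fun t => M t 0 3) (-(deriv z t * M t 0 2) - deriv s t * curvP z s t * M t 0 3) t ∧
      HasDerivAt (fun t => M t 1 3)
        (r - deriv z t * M t 1 2 - deriv s t * curvP z s t * M t 1 3) t := by
    filter_upwards [hD, hcol0.eventually_nhds, hcol1.eventually_nhds, hsymp, hgen] with t
      ⟨p, h, r, c, hd⟩ hc0 hc1 hsy hg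
    obtain ⟨h2, h3, h4, h5⟩ := hc0.self_of_nhds
    obtain ⟨h6, h7, h8, h9⟩ := hc1.self_of_nhds
    have hZ := curvZ_ne_zero hg.2.2.1 hg.2.2.2
    have hzero : ∀ {g : ℂ → ℂ} {g' c : ℂ}, HasDerivAt g g' t → (∀ᶠ τ in 𝓝 t, g τ = c) → g' = 0 :=
      fun {g g' c} hg hc => hg.unique ((hasDerivAt_const t c).congr_of_eventuallyEq hc)
    have d00 := (hd 0 0).unique
      ((analyticAt_curvZ hg.1 hg.2.1 hg.2.2.2).differentiableAt.hasDerivAt.congr_of_eventuallyEq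
        (hc0.mono fun τ hτ => hτ.1))
    have d31 := hzero (hd 3 1) (hc1.mono fun τ hτ => hτ.2.2.2)
    have d01 := hzero (hd 0 1) (hc1.mono fun τ hτ => hτ.1)
    have d11 := hzero (hd 1 1) (hc1.mono fun τ hτ => hτ.2.1)
    have d03 := hd 0 3
    have d13 := hd 1 3
    simp [Matrix.mul_apply, Matrix.vecMul, dotProduct, Fin.sum_univ_four, pfaffForm, graphForm, h2, h3, h4, h5, h6, h7, h8, h9,
      hsy.1, hsy.2.2.1, hsy.2.2.2.1] at d00 d31 d01 d11 d03 d13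
    have hh : h = deriv z t := by linear_combination d31
    have hp : p = deriv s t * curvP z s t := by
      rw [curvP, ← d00]
      have := hg.2.2.2
      field_simp
    subst hh hp
    refine ⟨r, by linear_combination d01, by linear_combination d11, d03.congr_deriv (by ring),
      d13.congr_deriv (by ring)⟩
  -- The constancy of the second column gives two linear equations for r, `M t 0 3` and `M t 1 3`;
  -- subtracting s times the first from the second eliminates r.
  have hM13 : ∀ᶠ t in 𝓝 t₀, M t 1 3 = s t * M t 0 3 - curvP z s t / curvZ z s t := by
    filter_upwards [hode, hgen] with t ⟨r, h1, h2, _⟩ hg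
    have hZ := curvZ_ne_zero hg.2.2.1 hg.2.2.2
    have e : deriv z t = deriv s t * curvZ z s t := by
      rw [curvZ]
      have := hg.2.2.2
      field_simp
    apply mul_right_cancel₀ hg.2.2.1
    have e2 : curvP z s t / curvZ z s t * deriv z t = deriv s t * curvP z s t := by
      rw [e]; field_simp
    rw [sub_mul, e2]
    linear_combination h2 - s t * h1
  -- Differentiate the formula for `M t 1 3` and compare with its differential equation. Once `M t 1
  -- 2` is eliminated by the symplectic relation, the terms in `M t 0 2` cancel. The remaining
  -- coefficient 4/3 + 1 + 1 = 10/3 of `M t 0 3` accounts for the factor 2/5 in `curvR`.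
  have hM03 : ∀ᶠ t in 𝓝 t₀, M t 0 3 = -(3 / 4 * curvR z s t) := by
    filter_upwards [hode, hgen, hM13.eventually_nhds, hsymp] with t ⟨r, h1, h2, h3, h4⟩ hg h5 hsy
    have hZ := curvZ_ne_zero hg.2.2.1 hg.2.2.2
    have hs0' := hg.2.2.2
    have e : deriv z t = deriv s t * curvZ z s t := by rw [curvZ]; field_simp
    have hP := (analyticAt_curvP hg.1 hg.2.1 hg.2.2.1 hg.2.2.2).differentiableAt.hasDerivAt
    have hZd := (analyticAt_curvZ hg.1 hg.2.1 hg.2.2.2).differentiableAt.hasDerivAt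
    have h6 := h4.unique ((((hg.2.1.differentiableAt.hasDerivAt.mul h3).sub
      (hP.div hZd hZ))).congr_of_eventuallyEq h5)
    have eP : deriv (curvZ z s) t = 3 * deriv s t * curvZ z s t * curvP z s t := by
      rw [curvP]; field_simp
    have er : r = -(4 / 3) * deriv s t * M t 0 3 := by
      apply mul_right_cancel₀ hZ
      rw [e] at h1
      linear_combination 4 / 3 * h1
    have e12 := hsy.2.2.2.2
    rw [h5.self_of_nhds, e, eP, er] at h6
    rw [curvR]
    have e12' : deriv s t * curvZ z s t * M t 1 2 =
        deriv s t * (s t * M t 0 2 * curvZ z s t + M t 0 3) := by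
      rw [← e12]; ring
    rw [e12'] at h6
    field_simp at h6 ⊢
    linear_combination (-2) * h6
  -- Differentiating once more, now `M t 0 3`, determines the last unknown entry.
  have hM02 : M t₀ 0 2 = 3 / 4 * curvK z s t₀ / curvZ z s t₀ := by
    obtain ⟨r, h1, h2, h3, h4⟩ := hode.self_of_nhds
    have hZ := curvZ_ne_zero hz0 hs0
    have e : deriv z t₀ = deriv s t₀ * curvZ z s t₀ := by rw [curvZ]; field_simp
    have hR := (analyticAt_curvR hz hs hz0 hs0).differentiableAt.hasDerivAt
    have h5 := h3.unique (((hR.const_mul (3 / 4)).neg).congr_of_eventuallyEq hM03)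
    rw [hM03.self_of_nhds, e] at h5
    rw [curvK]
    field_simp at h5 ⊢
    linear_combination (-1) * h5
  obtain ⟨h2, h3, h4, h5⟩ := hcol0.self_of_nhds
  obtain ⟨h6, h7, h8, h9⟩ := hcol1.self_of_nhds
  obtain ⟨h32, h22, h33, h23, h12⟩ := hsymp.self_of_nhds
  have hZ := curvZ_ne_zero hz0 hs0
  have h03 := hM03.self_of_nhds
  have h13 := hM13.self_of_nhds
  ext i j
  fin_cases i <;> fin_cases j
  · exact h2
  · exact h6
  · exact hM02
  · exact h03
  · exact h3
  · exact h7
  · change M t₀ 1 2 = s t₀ * (3 / 4 * curvK z s t₀ / curvZ z s t₀) -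
      3 / 4 * curvR z s t₀ / curvZ z s t₀
    apply mul_right_cancel₀ hZ
    rw [h12, hM02, h03]
    field_simp
    ring
  · refine h13.trans ?_
    change s t₀ * M t₀ 0 3 - _ = -(s t₀ * (3 / 4 * curvR z s t₀)) - curvP z s t₀ / curvZ z s t₀
    rw [h03]; ring
  · exact h4
  · exact h8
  · exact eq_inv_of_mul_eq_one_left h22
  · exact h23
  · exact h5
  · exact h9
  · exact h32
  · exact h33

/-- The first two columns of an adapted frame with respect to the frame of the normal form. -/
lemma adapted_cols {L : Mat4} {p h r c x' z' s s' : ℂ} (hL : L ∈ Sp2) (hz : z' ≠ 0)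
    (h20 : L 2 0 = 0) (h30 : L 3 0 = 0)
    (h21 : L 2 1 = 0) (h31 : L 3 1 = 0)
    (d30 : (L * pfaffForm p h r c - graphForm x' (-s * z') z' * L) 3 0 = 0)
    (d31 : (L * pfaffForm p h r c - graphForm x' (-s * z') z' * L) 3 1 = 0)
    (d10 : L 1 0 = s * L 0 0 → (L * pfaffForm p h r c - graphForm x' (-s * z') z' * L) 1 0 =
      s' * L 0 0 + s * (L * pfaffForm p h r c - graphForm x' (-s * z') z' * L) 0 0) :
    L 1 0 = s * L 0 0 ∧ L 0 0 ≠ 0 ∧ L 1 1 - s * L 0 1 ≠ 0 ∧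
      L 0 0 * s' = z' * (L 1 1 - s * L 0 1) ^ 3 := by
  rw [mem_Sp2_iff_col] at hL
  have e02 := hL 0 2
  have e03 := hL 0 3
  have e13 := hL 1 3
  simp [sympForm, gram, h20, h30, h21, h31] at e02 e03 e13
  simp [Matrix.mul_apply, Matrix.vecMul, dotProduct, Fin.sum_univ_four, pfaffForm, graphForm, h20, h30, h21, h31] at d30 d31 d10
  -- The derivative of the first column of the frame stays in the plane, so its coordinates are in
  -- the kernel of the derivative of the graph matrix: the column lies on the Legendre line.
  have h10 : L 1 0 = s * L 0 0 := by
    apply mul_left_cancel₀ hz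
    linear_combination -d30
  have d10' := d10 h10
  rw [h10] at e02 e03
  have h00 : L 0 0 ≠ 0 := by rintro h0; simp [h0] at e02
  have e03' : L 2 3 = -s * L 3 3 := by
    apply mul_left_cancel₀ h00
    linear_combination e03
  have hμ : (L 1 1 - s * L 0 1) * L 3 3 = 1 := by
    rw [e03'] at e13
    linear_combination e13
  have hμ0 : L 1 1 - s * L 0 1 ≠ 0 := left_ne_zero_of_mul_eq_one hμ
  -- With μ = `L 1 1 - s * L 0 1`, the entry (3, 1) gives h = z'μ². The derivative of the Legendre
  -- relation gives hμ = s' · `L 0 0`, because φ²₁ and φ⁴₂ are the same h; this is the source of the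
  -- cube in the conclusion.
  have hh' : h = z' * (L 1 1 - s * L 0 1) ^ 2 := by
    linear_combination (L 1 1 - s * L 0 1) * d31 - h * hμ
  refine ⟨h10, h00, hμ0, ?_⟩
  rw [h10, hh'] at d10'
  linear_combination -d10'

/-- The logarithmic derivative of a factor of a product. -/
lemma MatDerivAt.of_mul {E L : ℂ → Mat4} {A G Φ : Mat4} {t : ℂ} (hEd : MatDerivAt E (E t * G) t)
    (hE : E t ∈ Sp2) (hL : MatAnalyticAt L t)
    (hd : MatDerivAt (fun τ => E τ * L τ) (A * Φ) t) (hA : A = E t * L t) :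
    MatDerivAt L (L t * Φ - G * L t) t := by
  have h1 := (hEd.mul hL.matDerivAt).unique hd
  have h2 : matDeriv L t = L t * Φ - G * L t := by
    have h3 := congrArg ((E t)⁻¹ * ·) h1
    simp only [hA, Matrix.mul_add, Matrix.mul_assoc, Sp2_inv_mul_cancel hE] at h3
    rw [← h3]
    abel
  exact h2 ▸ hL.matDerivAt

/-- A frame adapted to the curve is, up to an element of `H₁`, the frame of the normal form. -/
lemma exists_mul_upMat_eq_gaugeMat {z s : ℂ → ℂ} {L : ℂ → Mat4} {t₀ : ℂ} (hz : AnalyticAt ℂ z t₀)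
    (hs : AnalyticAt ℂ s t₀) (hz0 : deriv z t₀ ≠ 0) (hs0 : deriv s t₀ ≠ 0)
    (hL0 : MatAnalyticAt L t₀) (hLsp : ∀ᶠ t in 𝓝 t₀, L t ∈ Sp2)
    (hLzero : ∀ᶠ t in 𝓝 t₀, (L t 2 0 = 0 ∧ L t 3 0 = 0) ∧ (L t 2 1 = 0 ∧ L t 3 1 = 0))
    (hLd : ∀ᶠ t in 𝓝 t₀, ∃ c h r d, MatDerivAt L (L t * pfaffForm c h r d -
      graphForm (s t ^ 2 * deriv z t) (-s t * deriv z t) (deriv z t) * L t) t) :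
    ∃ a b : ℂ, a ≠ 0 ∧ L t₀ * upMat a b =
      gaugeMat (s t₀) (curvZ z s t₀) (curvP z s t₀) (curvR z s t₀) (curvK z s t₀) := by
  have hgen : ∀ᶠ t in 𝓝 t₀, deriv z t ≠ 0 ∧ deriv s t ≠ 0 :=
    (hz.deriv.continuousAt.eventually_ne hz0).and (hs.deriv.continuousAt.eventually_ne hs0)
  have h10 : ∀ᶠ t in 𝓝 t₀, L t 1 0 = s t * L t 0 0 := by
    filter_upwards [hLd, hLzero.eventually_nhds, hgen] with t ⟨c, h, r, d, hd⟩ h0 hg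
    have d30 := (hd 3 0).unique ((hasDerivAt_const t (0 : ℂ)).congr_of_eventuallyEq
      (h0.mono fun τ hτ => hτ.1.2))
    obtain ⟨⟨h20, h30⟩, h21, h31⟩ := h0.self_of_nhds
    simp [Matrix.mul_apply, Matrix.vecMul, dotProduct, Fin.sum_univ_four, pfaffForm, graphForm, h30, h31] at d30
    apply mul_left_cancel₀ hg.1
    linear_combination -d30
  have hcols : ∀ᶠ t in 𝓝 t₀, L t 0 0 ≠ 0 ∧ L t 1 1 - s t * L t 0 1 ≠ 0 ∧
      L t 0 0 * deriv s t = deriv z t * (L t 1 1 - s t * L t 0 1) ^ 3 := by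
    filter_upwards [hLd, hLzero.eventually_nhds, hgen, hLsp, h10.eventually_nhds,
      hs.eventually_analyticAt] with t ⟨c, h, r, d, hd⟩ h0 hg hsp h1 hst
    obtain ⟨⟨h20, h30⟩, h21, h31⟩ := h0.self_of_nhds
    have hzero : ∀ {g : ℂ → ℂ} {g' c : ℂ}, HasDerivAt g g' t → (∀ᶠ τ in 𝓝 t, g τ = c) → g' = 0 :=
      fun {g g' c} hg hc => hg.unique ((hasDerivAt_const t c).congr_of_eventuallyEq hc)
    refine (adapted_cols hsp hg.1 h20 h30 h21 h31
      (hzero (hd 3 0) (h0.mono fun τ hτ => hτ.1.2))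
      (hzero (hd 3 1) (h0.mono fun τ hτ => hτ.2.2)) (fun _ => ?_)).2
    exact (hd 1 0).unique ((hst.differentiableAt.hasDerivAt.mul
      (hd 0 0)).congr_of_eventuallyEq h1)
  have hμ0 := hcols.self_of_nhds.2.1
  -- a scales the transverse component of the second column to 1 and b removes its component along
  -- the first. By the cubic relation the first column then automatically has the leading
  -- coefficient z'/s' = `curvZ z s`.
  let a : ℂ → ℂ := fun t => (L t 1 1 - s t * L t 0 1)⁻¹
  let b : ℂ → ℂ := fun t => -(L t 0 1 * (L t 1 1 - s t * L t 0 1) / L t 0 0)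
  have hμan : AnalyticAt ℂ (fun t => L t 1 1 - s t * L t 0 1) t₀ := (hL0 1 1).sub (hs.mul (hL0 0 1))
  have ha : AnalyticAt ℂ a t₀ := hμan.inv hμ0
  have hb : AnalyticAt ℂ b t₀ := (((hL0 0 1).mul hμan).div (hL0 0 0) hcols.self_of_nhds.1).neg
  have hM := eq_gaugeMat_of_cols (M := fun t => L t * upMat (a t) (b t)) hz hs hz0 hs0
    (by
      filter_upwards [hLsp, hcols] with t h1 h2
      exact Sp2_mul h1 (upMat_mem_Sp2 (inv_ne_zero h2.2.1) _))
    (by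
      filter_upwards [hLzero, hcols, h10, hgen] with t ⟨⟨h20, h30⟩, h21, h31⟩ ⟨h1, h2, h3⟩ h4 h5
      have hs' := h5.2
      have e : (a t) ^ 3 * L t 0 0 = curvZ z s t := by
        simp only [a, curvZ]
        field_simp
        rw [h3, mul_comm]
      refine ⟨?_, ?_, ?_, ?_⟩ <;>
        simp [Matrix.mul_apply, Fin.sum_univ_four, upMat, h20, h30, h4, ← e] <;> ring)
    (by
      filter_upwards [hLzero, hcols, h10, hgen] with t ⟨⟨h20, h30⟩, h21, h31⟩ ⟨h1, h2, h3⟩ h4 h5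
      refine ⟨?_, ?_, ?_, ?_⟩ <;>
        simp [Matrix.mul_apply, Fin.sum_univ_four, upMat, h20, h30, h21, h31, h4, a, b] <;>
        field_simp <;> ring)
    (by
      filter_upwards [hLd, hcols, ha.eventually_analyticAt, hb.eventually_analyticAt] with t
        ⟨c, h, r, d, hd⟩ ⟨h1, h2, h3⟩ h4 h5
      have ha0 : a t ≠ 0 := inv_ne_zero h2
      have h6 := hd.mul (matDerivAt_upMat h4.differentiableAt.hasDerivAt
        h5.differentiableAt.hasDerivAt ha0)
      have hc := upMat_conj_pfaffForm ha0 (b t) c h r d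
      have hc' := congrArg (upMat (a t) (b t) * ·) hc
      simp only [Sp2_mul_inv_cancel (upMat_mem_Sp2 ha0 (b t))] at hc'
      rw [upMatDeriv, Matrix.sub_mul, Matrix.mul_assoc, hc', ← Matrix.mul_assoc, ← Matrix.mul_assoc,
        sub_add_eq_add_sub, ← Matrix.mul_add, pfaffForm_add, Matrix.mul_assoc (graphForm _ _ _)] at h6
      exact ⟨_, _, _, _, h6⟩)
  exact ⟨a t₀, b t₀, inv_ne_zero hμ0, hM⟩

section

variable {S : Type*} [TopologicalSpace S] [ChartedSpace ℂ S] [IsManifold 𝓘(ℂ, ℂ) 1 S]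
  [PreconnectedSpace S] {f : S → Q3} {p : S} {R : ℝ} {B : Mat4} {x y z s : ℂ → ℂ}

/-- Write σ = EL with the graph frame E. Then L is symplectic, preserves the span of the first two
basis vectors and satisfies L' = LΦ - GL, so the normalisation by `H1` applies. Comparison with the
frame of the normal form shows in particular that any two adapted frames differ by `H1`. -/
lemma IsNormalForm.exists_eq_normalFrame_mul (hf : IsIsotropicCurve f)
    (hn : IsNormalForm f p R B x y z s) (hp : p ∉ critSet f) {U : Set S} (hU : IsOpen U) (hpU : p ∈ U)
    {σ : S → Mat4} (hσ : IsAdapted f U σ) :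
    ∃ X ∈ H1, σ p = normalFrame p B x y z s p * X := by
  set t₀ := chartAt ℂ p p with ht₀
  have ht₀b : t₀ ∈ Metric.ball t₀ R := Metric.mem_ball_self hn.pos
  have hsymm : (chartAt ℂ p).symm t₀ = p := (chartAt ℂ p).left_inv (mem_chart_source ℂ p)
  have hcrit : deriv z t₀ ≠ 0 ∧ deriv s t₀ ≠ 0 := by
    have := hn.mem_critSet_iff hf ht₀b
    rw [hsymm] at this
    rwa [this, not_or] at hp
  have hz := hn.an_z _ ht₀b
  have hs := hn.an_s _ ht₀b
  let E : ℂ → Mat4 := fun τ => B * graphFrame (x τ) (y τ) (z τ)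
  let L : ℂ → Mat4 := fun τ => (E τ)⁻¹ * σ ((chartAt ℂ p).symm τ)
  have hgood : ∀ᶠ t in 𝓝 t₀, t ∈ Metric.ball t₀ R ∧ (chartAt ℂ p).symm t ∈ U :=
    (Filter.eventually_of_mem (Metric.ball_mem_nhds t₀ hn.pos) fun _ => id).and
      (eventually_chart_symm (mem_chart_target ℂ p) hU (by rwa [hsymm]))
  have hE : ∀ t ∈ Metric.ball t₀ R, E t ∈ Sp2 := fun t ht => (hn.frame t ht).1
  have hLan : ∀ t, t ∈ Metric.ball t₀ R ∧ (chartAt ℂ p).symm t ∈ U → MatAnalyticAt L t :=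
    fun t ht => ((hn.matAnalyticAt ht.1).inv_of_Sp2 (Filter.eventually_of_mem
      (Metric.isOpen_ball.mem_nhds ht.1) hE)).mul (hσ.hol.analyticAt hU p (hn.subset ht.1) ht.2)
  have hL0 := hLan t₀ hgood.self_of_nhds
  have hσL : ∀ t ∈ Metric.ball t₀ R, σ ((chartAt ℂ p).symm t) = E t * L t := fun t ht =>
    (Sp2_mul_inv_cancel (hE t ht) _).symm
  have hLsp : ∀ᶠ t in 𝓝 t₀, L t ∈ Sp2 := hgood.mono fun t ht =>
    Sp2_mul (Sp2_inv_mem (hE t ht.1)) (hσ.frame _ ht.2).1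
  have hLzero : ∀ᶠ t in 𝓝 t₀, (L t 2 0 = 0 ∧ L t 3 0 = 0) ∧ (L t 2 1 = 0 ∧ L t 3 1 = 0) := by
    filter_upwards [hgood] with t ht
    have h1 := (hσ.frame _ ht.2).2
    have h2 := (hn.frame t ht.1).2
    have h3 : Submodule.span ℂ {(fun i => E t i 0 : C4), (fun i => E t i 1 : C4)} =
      Submodule.span ℂ {(fun i => σ ((chartAt ℂ p).symm t) i 0 : C4),
        (fun i => σ ((chartAt ℂ p).symm t) i 1 : C4)} := h2.symm.trans h1
    have h4 := fun v => mem_span_cols_iff (x := v) (hE t ht.1)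
    exact ⟨(h4 (fun i => σ ((chartAt ℂ p).symm t) i 0)).1 (h3 ▸ Submodule.subset_span (by simp)),
      (h4 (fun i => σ ((chartAt ℂ p).symm t) i 1)).1 (h3 ▸ Submodule.subset_span (by simp))⟩
  have hLd : ∀ᶠ t in 𝓝 t₀, ∃ c h r d, MatDerivAt L (L t * pfaffForm c h r d -
      graphForm (s t ^ 2 * deriv z t) (-s t * deriv z t) (deriv z t) * L t) t := by
    filter_upwards [hgood] with t ht
    obtain ⟨c, h, r, d, -, hd⟩ := hσ.matDerivAt_chart hU p (hn.subset ht.1) ht.2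
    refine ⟨c, h, r, d, ?_⟩
    have hEd := hn.matDerivAt ht.1
    rw [hn.deriv_x t ht.1, hn.deriv_y t ht.1] at hEd
    exact hEd.of_mul (hE t ht.1) (hLan t ht) (hd.congr (Filter.eventually_of_mem
      (Metric.isOpen_ball.mem_nhds ht.1) fun τ hτ => (hσL τ hτ).symm)) (hσL t ht.1)
  obtain ⟨a, b, ha, hM⟩ := exists_mul_upMat_eq_gaugeMat hz hs hcrit.1 hcrit.2 hL0 hLsp hLzero hLd
  refine ⟨(upMat a b)⁻¹, ?_, ?_⟩
  · rw [mem_H1_iff, upMat_inv ha]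
    exact ⟨_, _, inv_ne_zero ha, rfl⟩
  · have h1 := hσL t₀ ht₀b
    rw [hsymm] at h1
    rw [normalFrame, adaptedFrame, ← ht₀, ← hM, h1, Matrix.mul_assoc (E t₀),
      Matrix.mul_assoc (L t₀), Sp2_mul_nonsing_inv (upMat_mem_Sp2 ha _), Matrix.mul_one]

end

/-! ### Reductions to `H₁` and their tangent spaces -/

lemma H1_mul {X Y : Mat4} (hX : X ∈ H1) (hY : Y ∈ H1) : X * Y ∈ H1 := by
  obtain ⟨a, b, ha, rfl⟩ := mem_H1_iff.1 hX
  obtain ⟨c, d, hc, rfl⟩ := mem_H1_iff.1 hY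
  rw [upMat_mul ha hc]
  exact mem_H1_iff.2 ⟨_, _, mul_ne_zero ha hc, rfl⟩

lemma H1_inv {X : Mat4} (hX : X ∈ H1) : X⁻¹ ∈ H1 := by
  obtain ⟨a, b, ha, rfl⟩ := mem_H1_iff.1 hX
  rw [upMat_inv ha]
  exact mem_H1_iff.2 ⟨_, _, inv_ne_zero ha, rfl⟩

lemma Sp2_of_mem_H1 {X : Mat4} (hX : X ∈ H1) : X ∈ Sp2 := by
  obtain ⟨a, b, ha, rfl⟩ := mem_H1_iff.1 hX
  exact upMat_mem_Sp2 ha b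

lemma frameBundle_mul {S : Type*} {f : S → Q3} {a : S × Mat4} (ha : a ∈ frameBundle f) {X : Mat4} (hX : X ∈ H1) :
    (a.1, a.2 * X) ∈ frameBundle f := by
  have hsp := Sp2_mul ha.1 (Sp2_of_mem_H1 hX)
  obtain ⟨c, d, hc, rfl⟩ := mem_H1_iff.1 hX
  refine ⟨hsp, eq_span_cols hsp ?_ ?_⟩
  · rw [ha.2, Submodule.mem_span_pair]
    refine ⟨c ^ 3, 0, ?_⟩
    ext i; simp [upMat, Matrix.mul_apply, Fin.sum_univ_four]; ring
  · rw [ha.2, Submodule.mem_span_pair]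
    refine ⟨c ^ 2 * d, c, ?_⟩
    ext i; simp [upMat, Matrix.mul_apply, Fin.sum_univ_four]; ring

section

variable {S : Type*} [TopologicalSpace S] [ChartedSpace ℂ S] {f : S → Q3}

/-- The velocities of the curves `t ↦ σ(γ(t)) X(t)` with `X(t) ∈ H₁` and `X(0) = 1`. -/
lemma mem_tangent_of_curve {F : Set (S × Mat4)}
    (act : ∀ a ∈ F, ∀ X ∈ H1, (a.1, a.2 * X) ∈ F) {U : Set S} {σ : S → Mat4} (hU : IsOpen U)
    (hσ : MatHolOn σ U) (hσF : ∀ q ∈ U, (q, σ q) ∈ F) {V : Set ℂ} {γ : ℂ → S} (hV : IsOpen V)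
    (h0 : (0 : ℂ) ∈ V) (hγ : MDifferentiableOn 𝓘(ℂ, ℂ) 𝓘(ℂ, ℂ) γ V) (hγU : ∀ t ∈ V, γ t ∈ U)
    (α β : ℂ) :
    (mfderiv 𝓘(ℂ, ℂ) 𝓘(ℂ, ℂ) γ 0 (1 : ℂ), matD σ (γ 0) (mfderiv 𝓘(ℂ, ℂ) 𝓘(ℂ, ℂ) γ 0 (1 : ℂ)) +
      σ (γ 0) * pfaffForm α 0 β 0) ∈ tangent F (γ 0, σ (γ 0)) := by
  -- The curve `upMat (1 + α * τ) (3 / 4 * β * τ)` has velocity `pfaffForm α 0 β 0` at 0; the factor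
  -- 3/4 cancels the 4/3 in `upMatDeriv`. It lies in `H1` only where 1 + ατ ≠ 0.
  have hW : IsOpen {t : ℂ | 1 + α * t ≠ 0} :=
    isOpen_ne.preimage (f := fun t : ℂ => 1 + α * t) (by fun_prop)
  have hd : ∀ t ∈ V ∩ {t : ℂ | 1 + α * t ≠ 0},
      MatDerivAt (fun τ => σ (γ τ) * upMat (1 + α * τ) (3 / 4 * β * τ))
        (matD σ (γ t) (mfderiv 𝓘(ℂ, ℂ) 𝓘(ℂ, ℂ) γ t (1 : ℂ)) * upMat (1 + α * t) (3 / 4 * β * t) +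
          σ (γ t) * upMatDeriv (1 + α * t) (3 / 4 * β * t) α (3 / 4 * β)) t := by
    intro t ht
    refine (hσ.matDerivAt_comp hU ((hγ t ht.1).mdifferentiableAt (hV.mem_nhds ht.1))
      (hγU t ht.1)).mul (matDerivAt_upMat ?_ ?_ ht.2)
    · exact (((hasDerivAt_id t).const_mul α).const_add 1).congr_deriv (mul_one α)
    · exact ((hasDerivAt_id t).const_mul (3 / 4 * β)).congr_deriv (mul_one _)
  have h0' : (0 : ℂ) ∈ V ∩ {t : ℂ | 1 + α * t ≠ 0} := ⟨h0, by simp⟩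
  refine Submodule.subset_span ⟨V ∩ {t : ℂ | 1 + α * t ≠ 0}, γ,
    fun τ => σ (γ τ) * upMat (1 + α * τ) (3 / 4 * β * τ), hV.inter hW, h0',
    hγ.mono Set.inter_subset_left, ?_, ?_, rfl, ?_, ?_⟩
  · exact matHolOn_iff_differentiableOn.2 fun i j t ht =>
      (hd t ht i j).differentiableAt.differentiableWithinAt
  · exact fun t ht => act _ (hσF _ (hγU t ht.1)) _ (mem_H1_iff.2 ⟨_, _, ht.2, rfl⟩)
  · simp [upMat_one_zero]
  · rw [matD_complex, (hd 0 h0').matDeriv_eq]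
    simp [upMat_one_zero, upMatDeriv]
    congr 2
    ring

/-- A curve in `F` through `σ(p)` has a velocity that differs from `dσ(v)` by the velocity of a
one-parameter subgroup of `H₁`. -/
lemma exists_velocity_eq {F : Set (S × Mat4)} (sub : F ⊆ frameBundle f)
    (trans : ∀ a ∈ F, ∀ b ∈ F, a.1 = b.1 → ∃ X ∈ H1, b.2 = a.2 * X) {U : Set S} {σ : S → Mat4}
    (hU : IsOpen U) (hσ : MatHolOn σ U) (hσF : ∀ q ∈ U, (q, σ q) ∈ F) {V : Set ℂ} {γ : ℂ → S}
    {A : ℂ → Mat4} (hV : IsOpen V) (h0 : (0 : ℂ) ∈ V)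
    (hγ : MDifferentiableOn 𝓘(ℂ, ℂ) 𝓘(ℂ, ℂ) γ V) (hA : MatHolOn A V)
    (hAF : ∀ t ∈ V, (γ t, A t) ∈ F) (hγ0 : γ 0 ∈ U) (hA0 : A 0 = σ (γ 0)) :
    ∃ α β, matD A (0 : ℂ) (1 : ℂ) = matD σ (γ 0) (mfderiv 𝓘(ℂ, ℂ) 𝓘(ℂ, ℂ) γ 0 (1 : ℂ)) +
      σ (γ 0) * pfaffForm α 0 β 0 := by
  have hγd := (hγ 0 h0).mdifferentiableAt (hV.mem_nhds h0)
  have hev : ∀ᶠ t in 𝓝 (0 : ℂ), t ∈ V ∧ γ t ∈ U :=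
    (Filter.eventually_of_mem (hV.mem_nhds h0) fun _ => id).and
      (hγd.continuousAt.eventually (hU.mem_nhds hγ0))
  have hdσ := hσ.matDerivAt_comp hU hγd hγ0
  have hdA : MatDerivAt A (matDeriv A 0) 0 := fun i j =>
    ((matHolOn_iff_differentiableOn.1 hA i j).differentiableAt (hV.mem_nhds h0)).hasDerivAt
  -- This is σ(γ)⁻¹A, written with the polynomial formula for the symplectic inverse so that the
  -- product rule shows that it is differentiable.
  let X : ℂ → Mat4 := fun t => -(gram * (σ (γ t)).transpose * gram) * A t
  have hXinv : ∀ t, t ∈ V ∧ γ t ∈ U → X t = (σ (γ t))⁻¹ * A t := fun t ht => by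
    simp only [X]; rw [Sp2_inv (sub (hσF _ ht.2)).1]
  have hXup : ∀ t, t ∈ V ∧ γ t ∈ U → ∃ a b, a ≠ 0 ∧ X t = upMat a b ∧ A t = σ (γ t) * upMat a b := by
    intro t ht
    obtain ⟨Y, hY, h1⟩ := trans _ (hσF _ ht.2) _ (hAF t ht.1) rfl
    obtain ⟨a, b, ha, rfl⟩ := mem_H1_iff.1 hY
    have h1' : A t = σ (γ t) * upMat a b := h1
    exact ⟨a, b, ha, by rw [hXinv t ht, h1', Sp2_inv_mul_cancel (sub (hσF _ ht.2)).1], h1'⟩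
  have hXd : ∃ X', MatDerivAt X X' 0 := by
    refine ⟨_, MatDerivAt.mul (A' := -(gram * (matD σ (γ 0) (mfderiv 𝓘(ℂ, ℂ) 𝓘(ℂ, ℂ) γ 0
      (1 : ℂ))).transpose * gram)) ?_ hdA⟩
    have h1 := ((matDerivAt_const gram 0).mul hdσ.transpose).mul (matDerivAt_const gram 0)
    simp only [Matrix.zero_mul, zero_add, Matrix.mul_zero, add_zero] at h1
    exact fun i j => (h1 i j).neg
  obtain ⟨X', hX'⟩ := hXd
  have hX0 : X 0 = upMat 1 0 := by
    rw [hXinv 0 ⟨h0, hγ0⟩, hA0, Sp2_nonsing_inv_mul (sub (hσF _ hγ0)).1, upMat_one_zero]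
  have hX11 : X 0 1 1 = 1 := by rw [hX0]; simp [upMat]
  have hX13 : X 0 1 3 = 0 := by rw [hX0]; simp [upMat]
  -- The parameters of an element of `H1` can be read off from two of its entries, so they depend
  -- differentiably on t.
  have hXeq : ∀ t, t ∈ V ∧ γ t ∈ U → X t = upMat (X t 1 1) (3 / 4 * X t 1 3) := by
    intro t ht
    obtain ⟨a, b, ha, h1, -⟩ := hXup t ht
    rw [h1]
    congr 1
    simp [upMat]
    ring
  have h1 := matDerivAt_upMat (hX' 1 1) ((hX' 1 3).const_mul (3 / 4)) (by simp [hX11])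
  have h2 := hdσ.mul h1
  have h3 := hdA.unique (h2.congr (hev.mono fun t ht => by
    rw [← hXeq t ht]
    obtain ⟨a, b, ha, h1, h2⟩ := hXup t ht
    rw [h1, h2]))
  refine ⟨X' 1 1, 4 / 3 * (3 / 4 * X' 1 3), ?_⟩
  rw [matD_complex, h3]
  simp [hX11, hX13, upMat_one_zero, upMatDeriv]

variable [IsManifold 𝓘(ℂ, ℂ) 1 S]

lemma velocity_eq_smul_coordVec {p : S} {g : ℂ → ℂ} {t c : ℂ} (hg : HasDerivAt g c 0)
    (ht : g 0 = t) (htp : t ∈ (chartAt ℂ p).target) :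
    (⟨(chartAt ℂ p).symm (g 0),
      mfderiv 𝓘(ℂ, ℂ) 𝓘(ℂ, ℂ) (fun τ => (chartAt ℂ p).symm (g τ)) 0 (1 : ℂ)⟩ :
        TangentBundle 𝓘(ℂ, ℂ) S) = ⟨(chartAt ℂ p).symm t, c • coordVec p t⟩ := by
  subst ht
  congr 1
  have h1 := mfderiv_comp (0 : ℂ) (mdifferentiableAt_chart_symm p htp)
    hg.differentiableAt.mdifferentiableAt
  have h2 : mfderiv 𝓘(ℂ, ℂ) 𝓘(ℂ, ℂ) g 0 (1 : ℂ) = c • (1 : ℂ) := by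
    rw [mfderiv_eq_fderiv]
    exact (fderiv_apply_one_eq_deriv.trans hg.deriv).trans (mul_one c).symm
  change mfderiv 𝓘(ℂ, ℂ) 𝓘(ℂ, ℂ) ((chartAt ℂ p).symm ∘ g) 0 (1 : ℂ) = _
  rw [h1]
  change mfderiv 𝓘(ℂ, ℂ) 𝓘(ℂ, ℂ) (chartAt ℂ p).symm (g 0) (mfderiv 𝓘(ℂ, ℂ) 𝓘(ℂ, ℂ) g 0 (1 : ℂ)) = _
  rw [h2]
  exact map_smul (mfderiv 𝓘(ℂ, ℂ) 𝓘(ℂ, ℂ) (chartAt ℂ p).symm (g 0)) c (1 : ℂ)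

lemma exists_curve {U : Set S} (hU : IsOpen U) {q : S} (hq : q ∈ U) (v : TangentSpace 𝓘(ℂ, ℂ) q) :
    ∃ (V : Set ℂ) (γ : ℂ → S), IsOpen V ∧ (0 : ℂ) ∈ V ∧ MDifferentiableOn 𝓘(ℂ, ℂ) 𝓘(ℂ, ℂ) γ V ∧
      (∀ t ∈ V, γ t ∈ U) ∧
      (⟨γ 0, mfderiv 𝓘(ℂ, ℂ) 𝓘(ℂ, ℂ) γ 0 (1 : ℂ)⟩ : TangentBundle 𝓘(ℂ, ℂ) S) = ⟨q, v⟩ := by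
  obtain ⟨p, t, ht, rfl⟩ : ∃ p : S, ∃ t ∈ (chartAt ℂ p).target, q = (chartAt ℂ p).symm t :=
    ⟨q, _, mem_chart_target ℂ q, ((chartAt ℂ q).left_inv (mem_chart_source ℂ q)).symm⟩
  obtain ⟨c, rfl⟩ := exists_smul_coordVec p ht v
  have hg : Differentiable ℂ (fun τ : ℂ => t + τ * c) := by fun_prop
  refine ⟨(fun τ : ℂ => t + τ * c) ⁻¹' ((chartAt ℂ p).target ∩ (chartAt ℂ p).symm ⁻¹' U),
    fun τ => (chartAt ℂ p).symm (t + τ * c),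
    ((chartAt ℂ p).isOpen_inter_preimage_symm hU).preimage hg.continuous, by simpa using ⟨ht, hq⟩,
    fun τ hτ => ?_, fun τ hτ => hτ.2, ?_⟩
  · exact ((mdifferentiableAt_chart_symm p hτ.1).comp τ
      (hg τ).mdifferentiableAt).mdifferentiableWithinAt
  · exact velocity_eq_smul_coordVec (g := fun τ => t + τ * c)
      ((((hasDerivAt_id (0 : ℂ)).mul_const c).const_add t).congr_deriv (one_mul c)) (by simp) ht

/-- Near the section, a curve in F is σ(γ)X with X in `H1`, so its velocity is dσ(v) plus σ times an
element of the Lie algebra of `H1`; all such vectors occur. These vectors already form a linear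
subspace, so the span in the definition of `tangent` adds nothing. -/
lemma mem_tangent_iff {F : Set (S × Mat4)} (sub : F ⊆ frameBundle f)
    (act : ∀ a ∈ F, ∀ X ∈ H1, (a.1, a.2 * X) ∈ F)
    (trans : ∀ a ∈ F, ∀ b ∈ F, a.1 = b.1 → ∃ X ∈ H1, b.2 = a.2 * X) {U : Set S} {σ : S → Mat4}
    (hU : IsOpen U) (hσ : MatHolOn σ U) (hσF : ∀ q ∈ U, (q, σ q) ∈ F) {p : S} (hp : p ∈ U)
    {w : TangentSpace 𝓘(ℂ, ℂ) p × Mat4} :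
    w ∈ tangent F (p, σ p) ↔ ∃ α β, w.2 = matD σ p w.1 + σ p * pfaffForm α 0 β 0 := by
  constructor
  · intro hw
    induction hw using Submodule.span_induction with
    | mem w hw =>
      obtain ⟨V, γ, A, hV, h0, hγ, hA, hAF, hγ0, hA0, hw2⟩ := hw
      obtain ⟨v, w2⟩ := w
      have hpγ : p = γ 0 := (congrArg Bundle.TotalSpace.proj hγ0).symm
      subst hpγ
      have hv : mfderiv 𝓘(ℂ, ℂ) 𝓘(ℂ, ℂ) γ 0 (1 : ℂ) = v := by simpa using hγ0
      subst hv
      obtain ⟨α, β, h⟩ := exists_velocity_eq sub trans hU hσ hσF hV h0 hγ hA hAF hp hA0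
      exact ⟨α, β, hw2.trans h⟩
    | zero => exact ⟨0, 0, by
        have := matD_smul σ p 0 0
        simp only [zero_smul] at this
        have h2 : pfaffForm 0 0 0 0 = 0 := by simpa using (smul_pfaffForm 0 0 0 0 0).symm
        change (0 : Mat4) = matD σ p 0 + _
        rw [this, h2, Matrix.mul_zero, add_zero]⟩
    | add x y _ _ hx hy =>
      obtain ⟨α, β, hx⟩ := hx
      obtain ⟨α', β', hy⟩ := hy
      refine ⟨α + α', β + β', ?_⟩
      change x.2 + y.2 = matD σ p (x.1 + y.1) + _
      have := pfaffForm_add α 0 β 0 α' 0 β' 0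
      rw [add_zero] at this
      rw [matD_add, hx, hy, ← this, Matrix.mul_add]
      abel
    | smul c x _ hx =>
      obtain ⟨α, β, hx⟩ := hx
      refine ⟨c * α, c * β, ?_⟩
      change c • x.2 = matD σ p (c • x.1) + _
      have := smul_pfaffForm c α 0 β 0
      rw [mul_zero] at this
      rw [matD_smul, hx, ← this, smul_add, Matrix.mul_smul]
  · rintro ⟨α, β, h⟩
    obtain ⟨v, w2⟩ := w
    obtain ⟨V, γ, hV, h0, hγ, hγU, hγ0⟩ := exists_curve hU hp v
    have hpγ : p = γ 0 := (congrArg Bundle.TotalSpace.proj hγ0).symm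
    subst hpγ
    have hv : mfderiv 𝓘(ℂ, ℂ) 𝓘(ℂ, ℂ) γ 0 (1 : ℂ) = v := by simpa using hγ0
    subst hv
    change w2 = _ at h
    change w2 = matD σ (γ 0) (mfderiv 𝓘(ℂ, ℂ) 𝓘(ℂ, ℂ) γ 0 (1 : ℂ)) + _ at h
    subst h
    exact mem_tangent_of_curve act hU hσ hσF hV h0 hγ hγU α β

end

/-! ### The bundle of adapted frames -/

section

variable {S : Type*} [TopologicalSpace S] [ChartedSpace ℂ S] {f : S → Q3}

lemma IsAdapted.mono {U V : Set S} {σ : S → Mat4} (h : IsAdapted f U σ) (hVU : V ⊆ U) :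
    IsAdapted f V σ :=
  ⟨fun i j => (h.hol i j).mono hVU, fun q hq => h.frame q (hVU hq), fun q hq => h.form q (hVU hq)⟩

/-- The bundle of the values of the adapted local sections, outside of the critical points. -/
def adaptedBundle (f : S → Q3) : Set (S × Mat4) :=
  {a | ∃ p U σ, p ∉ critSet f ∧ IsOpen U ∧ p ∈ U ∧ IsAdapted f U σ ∧ a = (p, σ p)}

lemma IsAdapted.mem_adaptedBundle {U : Set S} {σ : S → Mat4} (h : IsAdapted f U σ) (hU : IsOpen U)
    {q : S} (hq : q ∈ U) (hcrit : q ∉ critSet f) : (q, σ q) ∈ adaptedBundle f :=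
  ⟨q, U, σ, hcrit, hU, hq, h, rfl⟩

/-- The quartic form `φ¹₃ (φ⁴₂)³`. -/
def quartic (φ : Mat4) : ℂ := φ 0 2 * φ 3 1 ^ 3

open Classical in
/-- The quartic differential of an isotropic curve. -/
def quarticDifferential (f : S → Q3) (p : S) (v : TangentSpace 𝓘(ℂ, ℂ) p) : ℂ :=
  -- Adapted sections exist near every noncritical point of an isotropic curve, so the value 0 is
  -- only used at critical points. Elsewhere the choice of σ is immaterial by `quartic_eq`.
  if h : p ∉ critSet f ∧ ∃ σ : S → Mat4, ∃ U, IsOpen U ∧ p ∈ U ∧ IsAdapted f U σ then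
    quartic ((h.2.choose p)⁻¹ * matD h.2.choose p v)
  else 0

lemma quarticDifferential_smul (p : S) (c : ℂ) (v : TangentSpace 𝓘(ℂ, ℂ) p) :
    quarticDifferential f p (c • v) = c ^ 4 * quarticDifferential f p v := by
  unfold quarticDifferential
  split_ifs with h
  · rw [matD_smul, Matrix.mul_smul]
    simp only [quartic, Matrix.smul_apply, smul_eq_mul]
    ring
  · rw [mul_zero]

variable [IsManifold 𝓘(ℂ, ℂ) 1 S]

lemma matD_mul_const {U : Set S} {σ : S → Mat4} (hU : IsOpen U) (hσ : MatHolOn σ U) (X : Mat4)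
    {q : S} (hq : q ∈ U) (v : TangentSpace 𝓘(ℂ, ℂ) q) :
    matD (fun q => σ q * X) q v = matD σ q v * X := by
  obtain ⟨p, t, ht, rfl⟩ : ∃ p : S, ∃ t ∈ (chartAt ℂ p).target, q = (chartAt ℂ p).symm t :=
    ⟨q, _, mem_chart_target ℂ q, ((chartAt ℂ q).left_inv (mem_chart_source ℂ q)).symm⟩
  obtain ⟨c, rfl⟩ := exists_smul_coordVec p ht v
  have hX : MatHolOn (fun _ : S => X) U := MatHolOn.of_analyticAt fun q _ =>
    ⟨q, mem_chart_source ℂ q, matAnalyticAt_const X _⟩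
  have h1 := (hσ.matDerivAt_chart hU p ht hq).mul (matDerivAt_const X t)
  rw [Matrix.mul_zero, add_zero] at h1
  rw [matD_smul, matD_smul, ((hσ.mul hU hX).matDerivAt_chart hU p ht hq).unique h1,
    Matrix.smul_mul]

/-- Conjugation by `H1` stays within the Pfaffian system and multiplies φ⁴₂ by a² ≠ 0. -/
lemma IsAdapted.mul_const {U : Set S} {σ : S → Mat4} (h : IsAdapted f U σ) (hU : IsOpen U)
    {X : Mat4} (hX : X ∈ H1) : IsAdapted f U (fun q => σ q * X) := by
  refine ⟨h.hol.mul hU (MatHolOn.of_analyticAt fun q _ => ⟨q, mem_chart_source ℂ q,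
    matAnalyticAt_const X _⟩), fun q hq => frameBundle_mul (h.frame q hq) hX, fun q hq v => ?_⟩
  obtain ⟨p, c, r, s, hc, he⟩ := h.form q hq v
  obtain ⟨a, b, ha, rfl⟩ := mem_H1_iff.1 hX
  refine ⟨p - c * b * a / 3, c * a ^ 2, 8 / 3 * b * p * a⁻¹ + r * a⁻¹ ^ 2 - 4 / 9 * c * b ^ 2,
    s * a⁻¹ ^ 6, fun hv => mul_ne_zero (hc hv) (pow_ne_zero 2 ha), ?_⟩
  rw [matD_mul_const hU h.hol _ hq, Matrix.mul_inv_rev, Matrix.mul_assoc,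
    ← Matrix.mul_assoc (σ q)⁻¹, he, upMat_conj_pfaffForm ha]

variable [PreconnectedSpace S]

lemma exists_isAdapted (hf : IsIsotropicCurve f) (p : S) : ∃ U σ, IsOpen U ∧ p ∈ U ∧
    IsAdapted f (U ∩ (critSet f)ᶜ) σ := by
  obtain ⟨R, B, x, y, z, s, h⟩ := exists_isNormalForm hf p
  exact ⟨_, _, isOpen_chartBall p R, mem_chartBall_self p h.pos, h.isAdapted_normalFrame hf⟩

/-- Both frames are compared with the frame of a normal form centred at their common base point. -/
lemma adaptedBundle_trans (hf : IsIsotropicCurve f) : ∀ a ∈ adaptedBundle f,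
    ∀ b ∈ adaptedBundle f, a.1 = b.1 → ∃ X ∈ H1, b.2 = a.2 * X := by
  rintro _ ⟨p, U, σ, hp, hU, hpU, hσ, rfl⟩ _ ⟨q, U', σ', hq, hU', hqU', hσ', rfl⟩ hpq
  change p = q at hpq
  subst hpq
  obtain ⟨R, B, x, y, z, s, h⟩ := exists_isNormalForm hf p
  obtain ⟨X, hX, h1⟩ := h.exists_eq_normalFrame_mul hf hp hU hpU hσ
  obtain ⟨X', hX', h2⟩ := h.exists_eq_normalFrame_mul hf hp hU' hqU' hσ'
  refine ⟨X⁻¹ * X', H1_mul (H1_inv hX) hX', ?_⟩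
  change σ' p = σ p * _
  rw [h1, h2, Matrix.mul_assoc, Sp2_mul_inv_cancel (Sp2_of_mem_H1 hX)]

lemma isReduction_adaptedBundle (hf : IsIsotropicCurve f) :
    IsReduction f (critSet f)ᶜ H1 (adaptedBundle f) where
  sub := by
    rintro _ ⟨p, U, σ, hp, hU, hpU, hσ, rfl⟩
    exact ⟨hp, hσ.frame p hpU⟩
  act := by
    rintro _ ⟨p, U, σ, hp, hU, hpU, hσ, rfl⟩ X hX
    exact (hσ.mul_const hU hX).mem_adaptedBundle hU hpU hp
  trans := adaptedBundle_trans hf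
  section_exists := fun p hp => by
    obtain ⟨U, σ, hU, hpU, hσ⟩ := exists_isAdapted hf p
    have hopen := hU.inter (isClosed_critSet hf).isOpen_compl
    exact ⟨_, σ, hopen, ⟨hpU, hp⟩, hσ.hol, fun q hq => hσ.mem_adaptedBundle hopen hq hq.2⟩

end

section

variable {S : Type*} [TopologicalSpace S] [ChartedSpace ℂ S] [IsManifold 𝓘(ℂ, ℂ) 1 S] {f : S → Q3}
  {W : Set S} {F : Set (S × Mat4)}

lemma IsReduction.mem_tangent_iff (hF : IsReduction f W H1 F) {U : Set S} {σ : S → Mat4}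
    (hU : IsOpen U) (hσ : MatHolOn σ U) (hσF : ∀ q ∈ U, (q, σ q) ∈ F) {p : S} (hp : p ∈ U)
    {w : TangentSpace 𝓘(ℂ, ℂ) p × Mat4} :
    w ∈ tangent F (p, σ p) ↔ ∃ α β, w.2 = matD σ p w.1 + σ p * pfaffForm α 0 β 0 :=
  IsotropicCurve.mem_tangent_iff (fun a ha => (hF.sub a ha).2) hF.act hF.trans hU hσ hσF hp

/-- The Maurer-Cartan form on the tangent spaces of a reduction. -/
lemma IsReduction.mcForm_eq (hF : IsReduction f W H1 F) {U : Set S} {σ : S → Mat4}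
    (hU : IsOpen U) (hσ : MatHolOn σ U) (hσF : ∀ q ∈ U, (q, σ q) ∈ F) {p : S} (hp : p ∈ U)
    {w : TangentSpace 𝓘(ℂ, ℂ) p × Mat4} (hw : w ∈ tangent F (p, σ p)) :
    ∃ α β, mcForm (p, σ p) w = (σ p)⁻¹ * matD σ p w.1 + pfaffForm α 0 β 0 := by
  obtain ⟨α, β, h⟩ := (hF.mem_tangent_iff hU hσ hσF hp).1 hw
  refine ⟨α, β, ?_⟩
  change (σ p)⁻¹ * w.2 = _
  rw [h, Matrix.mul_add, Sp2_inv_mul_cancel (hF.sub _ (hσF p hp)).2.1]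

/-- The local sections of a reduction that is an integral manifold are adapted. -/
lemma IsReduction.isAdapted (hF : IsReduction f W H1 F) (hint : IsIntegralManifold F) {U : Set S}
    {σ : S → Mat4} (hU : IsOpen U) (hσ : MatHolOn σ U) (hσF : ∀ q ∈ U, (q, σ q) ∈ F) :
    IsAdapted f U σ := by
  refine ⟨hσ, fun q hq => (hF.sub _ (hσF q hq)).2, fun q hq v => ?_⟩
  have hv : (v, matD σ q v) ∈ tangent F (q, σ q) := by
    rw [hF.mem_tangent_iff hU hσ hσF hq]
    have h2 : pfaffForm 0 0 0 0 = 0 := by simpa using (smul_pfaffForm 0 0 0 0 0).symm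
    exact ⟨0, 0, by rw [h2, Matrix.mul_zero, add_zero]⟩
  have h1 : IsPfaffian ((σ q)⁻¹ * matD σ q v) := (hint _ (hσF q hq)).1 _ hv
  obtain ⟨w, hw, hw0⟩ := (hint _ (hσF q hq)).2
  obtain ⟨α, β, hmc⟩ := hF.mcForm_eq hU hσ hσF hq hw
  obtain ⟨w1, w2⟩ := w
  obtain ⟨p, t, ht, hqt⟩ : ∃ p : S, ∃ t ∈ (chartAt ℂ p).target, q = (chartAt ℂ p).symm t :=
    ⟨q, _, mem_chart_target ℂ q, ((chartAt ℂ q).left_inv (mem_chart_source ℂ q)).symm⟩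
  subst hqt
  obtain ⟨c, rfl⟩ := exists_smul_coordVec p ht v
  obtain ⟨d, rfl⟩ := exists_smul_coordVec p ht w1
  rw [hmc] at hw0
  have hd := hσ.matDerivAt_chart hU p ht hq
  have hsp := maurerCartan_mem_sp hd ((eventually_chart_symm ht hU hq).mono fun τ hτ =>
    (hF.sub _ (hσF _ hτ)).2.1)
  -- Vertical vectors do not contribute to φ⁴₂, so the one tangent vector with φ⁴₂ ≠ 0 forces
  -- φ⁴₂(dσ(∂/∂z)) ≠ 0. As the tangent line of the surface is one-dimensional, this gives h ≠ 0 for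
  -- every v ≠ 0.
  refine ⟨_, _, _, _, fun hc => ?_, eq_pfaffForm ?_ h1⟩
  · rw [matD_smul, Matrix.mul_smul, Matrix.smul_apply, smul_eq_mul]
    refine mul_ne_zero (fun h0 => hc (by rw [h0, zero_smul])) fun h0 => hw0 ?_
    rw [matD_smul, Matrix.mul_smul, Matrix.add_apply, Matrix.smul_apply, h0]
    simp [pfaffForm]
  · rw [matD_smul, Matrix.mul_smul, Matrix.transpose_smul, Matrix.smul_mul, Matrix.mul_smul,
      ← smul_add, hsp, smul_zero]

variable [PreconnectedSpace S]

/-- The Maurer-Cartan form on the tangent spaces of the bundle of adapted frames. -/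
lemma adaptedBundle_mcForm_eq (hf : IsIsotropicCurve f) {U : Set S} {σ : S → Mat4}
    (hU : IsOpen U) (hσ : IsAdapted f U σ) {p : S} (hp : p ∈ U) (hcrit : p ∉ critSet f)
    {w : TangentSpace 𝓘(ℂ, ℂ) p × Mat4} (hw : w ∈ tangent (adaptedBundle f) (p, σ p)) :
    ∃ α β, mcForm (p, σ p) w = (σ p)⁻¹ * matD σ p w.1 + pfaffForm α 0 β 0 := by
  have hopen := hU.inter (isClosed_critSet hf).isOpen_compl
  exact (isReduction_adaptedBundle hf).mcForm_eq hopen (hσ.mono Set.inter_subset_left).hol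
    (fun q hq => hσ.mem_adaptedBundle hU hq.1 hq.2) ⟨hp, hcrit⟩ hw

lemma mem_tangent_adaptedBundle_iff (hf : IsIsotropicCurve f) {U : Set S} {σ : S → Mat4}
    (hU : IsOpen U) (hσ : IsAdapted f U σ) {p : S} (hp : p ∈ U) (hcrit : p ∉ critSet f)
    {w : TangentSpace 𝓘(ℂ, ℂ) p × Mat4} : w ∈ tangent (adaptedBundle f) (p, σ p) ↔
      ∃ α β, w.2 = matD σ p w.1 + σ p * pfaffForm α 0 β 0 := by
  have hopen := hU.inter (isClosed_critSet hf).isOpen_compl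
  exact (isReduction_adaptedBundle hf).mem_tangent_iff hopen (hσ.mono Set.inter_subset_left).hol
    (fun q hq => hσ.mem_adaptedBundle hU hq.1 hq.2) ⟨hp, hcrit⟩

lemma matD_mem_tangent (hf : IsIsotropicCurve f) {U : Set S} {σ : S → Mat4}
    (hU : IsOpen U) (hσ : IsAdapted f U σ) {p : S} (hp : p ∈ U) (hcrit : p ∉ critSet f)
    (v : TangentSpace 𝓘(ℂ, ℂ) p) : (v, matD σ p v) ∈ tangent (adaptedBundle f) (p, σ p) := by
  rw [mem_tangent_adaptedBundle_iff hf hU hσ hp hcrit]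
  have h2 : pfaffForm 0 0 0 0 = 0 := by simpa using (smul_pfaffForm 0 0 0 0 0).symm
  exact ⟨0, 0, by rw [h2, Matrix.mul_zero, add_zero]⟩

lemma isIntegralManifold_adaptedBundle (hf : IsIsotropicCurve f) :
    IsIntegralManifold (adaptedBundle f) := by
  rintro _ ⟨p, U, σ, hp, hU, hpU, hσ, rfl⟩
  refine ⟨fun w hw => ?_, ?_⟩
  · obtain ⟨α, β, h⟩ := adaptedBundle_mcForm_eq hf hU hσ hpU hp hw
    obtain ⟨p', h', r', s', -, he⟩ := hσ.form p hpU w.1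
    rw [he, pfaffForm_add] at h
    change IsPfaffian (mcForm (p, σ p) w)
    rw [h]
    exact isPfaffian_pfaffForm _ _ _ _
  · let v : TangentSpace 𝓘(ℂ, ℂ) p := (1 : ℂ)
    obtain ⟨p', h', r', s', h0, he⟩ := hσ.form p hpU v
    refine ⟨_, matD_mem_tangent hf hU hσ hpU hp v, ?_⟩
    change ((σ p)⁻¹ * matD σ p v) 3 1 ≠ 0
    rw [he]
    simpa [pfaffForm] using h0 (show v ≠ 0 from one_ne_zero (α := ℂ))

/-- A reduction that is an integral manifold is the bundle of adapted frames. -/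
lemma IsReduction.eq_adaptedBundle (hf : IsIsotropicCurve f)
    (hF : IsReduction f (critSet f)ᶜ H1 F) (hint : IsIntegralManifold F) :
    F = adaptedBundle f := by
  -- Over each noncritical point both sets are the orbit under `H1` of the value of a local section
  -- of F, which is adapted.
  apply Set.Subset.antisymm
  · rintro ⟨p, A⟩ ha
    have hp := (hF.sub _ ha).1
    obtain ⟨U, σ, hU, hpU, hσ, hσF⟩ := hF.section_exists p hp
    obtain ⟨X, hX, h⟩ := hF.trans _ (hσF p hpU) _ ha rfl
    have h' : A = σ p * X := h
    rw [h']
    exact ((hF.isAdapted hint hU hσ hσF).mul_const hU hX).mem_adaptedBundle hU hpU hp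
  · rintro ⟨p, A⟩ ha
    have hp := ((isReduction_adaptedBundle hf).sub _ ha).1
    obtain ⟨U, σ, hU, hpU, hσ, hσF⟩ := hF.section_exists p hp
    have h1 := (hF.isAdapted hint hU hσ hσF).mem_adaptedBundle hU hpU hp
    obtain ⟨X, hX, h⟩ := adaptedBundle_trans hf _ h1 _ ha rfl
    have h' : A = σ p * X := h
    rw [h']
    exact hF.act _ (hσF p hpU) X hX

/-! ### The quartic differential -/

/-- The quartic form does not depend on the adapted frame. -/
lemma quartic_eq (hf : IsIsotropicCurve f) {U U' : Set S} {σ σ' : S → Mat4} (hU : IsOpen U)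
    (hσ : IsAdapted f U σ) (hU' : IsOpen U') (hσ' : IsAdapted f U' σ') {p : S} (hp : p ∈ U)
    (hp' : p ∈ U') (hcrit : p ∉ critSet f) (v : TangentSpace 𝓘(ℂ, ℂ) p) :
    quartic ((σ' p)⁻¹ * matD σ' p v) = quartic ((σ p)⁻¹ * matD σ p v) := by
  obtain ⟨X, hX, h⟩ := adaptedBundle_trans hf _ (hσ.mem_adaptedBundle hU hp hcrit) _
    (hσ'.mem_adaptedBundle hU' hp' hcrit) rfl
  have h' : σ' p = σ p * X := h
  have h1 := matD_mem_tangent hf hU' hσ' hp' hcrit v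
  rw [h'] at h1
  -- σ' agrees with σX for this constant X only at p. Still, dσ'(v) and d(σX)(v) are tangent to the
  -- same bundle over the same v, so they differ by a vertical vector, on which φ¹₃ and φ⁴₂ vanish.
  -- The weights a⁻⁶ and (a²)³ then cancel.
  obtain ⟨α, β, h2⟩ := adaptedBundle_mcForm_eq hf hU (hσ.mul_const hU hX) hp hcrit h1
  have h3 : (σ p * X)⁻¹ * matD σ' p v =
    (σ p * X)⁻¹ * matD (fun q => σ q * X) p v + pfaffForm α 0 β 0 := h2
  obtain ⟨p', c, r, s, -, he⟩ := hσ.form p hp v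
  obtain ⟨a, b, ha, rfl⟩ := mem_H1_iff.1 hX
  rw [h', h3, matD_mul_const hU hσ.hol _ hp, Matrix.mul_inv_rev, Matrix.mul_assoc,
    ← Matrix.mul_assoc (σ p)⁻¹, he, upMat_conj_pfaffForm ha, pfaffForm_add]
  simp [quartic, pfaffForm]
  field_simp

lemma quarticDifferential_eq (hf : IsIsotropicCurve f) {U : Set S} {σ : S → Mat4} (hU : IsOpen U)
    (hσ : IsAdapted f U σ) {p : S} (hp : p ∈ U) (hcrit : p ∉ critSet f)
    (v : TangentSpace 𝓘(ℂ, ℂ) p) :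
    quarticDifferential f p v = quartic ((σ p)⁻¹ * matD σ p v) := by
  have h : p ∉ critSet f ∧ ∃ σ : S → Mat4, ∃ U, IsOpen U ∧ p ∈ U ∧ IsAdapted f U σ :=
    ⟨hcrit, σ, U, hU, hp, hσ⟩
  rw [quarticDifferential, dif_pos h]
  obtain ⟨U', hU', hp', hσ'⟩ := h.2.choose_spec
  exact quartic_eq hf hU hσ hU' hσ' hp hp' hcrit v

lemma quarticDifferential_fst (hf : IsIsotropicCurve f) : ∀ a ∈ adaptedBundle f,
    ∀ w ∈ tangent (adaptedBundle f) a,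
      quarticDifferential f a.1 w.1 = mcForm a w 0 2 * (mcForm a w 3 1) ^ 3 := by
  rintro _ ⟨p, U, σ, hp, hU, hpU, hσ, rfl⟩ w hw
  obtain ⟨α, β, h⟩ := adaptedBundle_mcForm_eq hf hU hσ hpU hp hw
  rw [quarticDifferential_eq hf hU hσ hpU hp]
  rw [h]
  simp [quartic, pfaffForm]

/-! ### Meromorphy of the quartic differential -/

variable {p : S} {R : ℝ} {B : Mat4} {x y z s : ℂ → ℂ}

lemma IsNormalForm.eventually_not_mem_critSet (hf : IsIsotropicCurve f)
    (h : IsNormalForm f p R B x y z s) : ∀ᶠ t in 𝓝[≠] (chartAt ℂ p p),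
      t ∈ Metric.ball (chartAt ℂ p p) R ∧ (chartAt ℂ p).symm t ∉ critSet f := by
  filter_upwards [self_mem_nhdsWithin, mem_nhdsWithin_of_mem_nhds
    (Metric.ball_mem_nhds (chartAt ℂ p p) h.pos)] with t ht htb
  refine ⟨htb, fun hc => ht ?_⟩
  have := h.eq_of_mem_critSet hf (h.symm_mem htb) hc
  rw [Set.mem_singleton_iff, ← (chartAt ℂ p).right_inv (h.subset htb), this]

lemma IsNormalForm.mcForm_normalFrame (hf : IsIsotropicCurve f)
    (h : IsNormalForm f p R B x y z s) {t : ℂ} (ht : t ∈ Metric.ball (chartAt ℂ p p) R)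
    (hcrit : (chartAt ℂ p).symm t ∉ critSet f) :
    (normalFrame p B x y z s ((chartAt ℂ p).symm t))⁻¹ *
      matD (normalFrame p B x y z s) ((chartAt ℂ p).symm t) (coordVec p t) =
        adaptedForm z s t := by
  have hσ := h.isAdapted_normalFrame hf
  have hmem : (chartAt ℂ p).symm t ∈ chartBall p R ∩ (critSet f)ᶜ := ⟨h.symm_mem ht, hcrit⟩
  rw [(hσ.hol.matDerivAt_chart ((isOpen_chartBall p R).inter (isClosed_critSet hf).isOpen_compl) p
    (h.subset ht) hmem).unique (h.matDerivAt_normalFrame hf ht hcrit),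
    Sp2_inv_mul_cancel (hσ.frame _ hmem).1]

lemma meromorphicAt_adaptedForm {t : ℂ} (hz : AnalyticAt ℂ z t) (hs : AnalyticAt ℂ s t) (i j) :
    MeromorphicAt (fun t => adaptedForm z s t i j) t := by
  have hs' := hs.deriv.meromorphicAt
  have hZ := meromorphicAt_curvZ hz.meromorphicAt hs.meromorphicAt
  have hP := meromorphicAt_curvP hz.meromorphicAt hs.meromorphicAt
  have hR := meromorphicAt_curvR hz.meromorphicAt hs.meromorphicAt
  have hS := meromorphicAt_curvS hz.meromorphicAt hs.meromorphicAt
  refine hs'.mul ?_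
  fin_cases i <;> fin_cases j <;> simp only [pfaffForm] <;> simp <;> fun_prop

/-- On a punctured disc around each point, critical or not, the coefficient is computed from the
frame of the normal form, whose Maurer-Cartan form is rational in derivatives of functions
holomorphic on the whole disc. -/
lemma isMeromorphicDifferential_quarticDifferential (hf : IsIsotropicCurve f) :
    IsMeromorphicDifferential 4 (quarticDifferential f) := by
  refine ⟨quarticDifferential_smul, fun p => ?_⟩
  obtain ⟨R, B, x, y, z, s, h⟩ := exists_isNormalForm hf p
  have hc := Metric.mem_ball_self (x := chartAt ℂ p p) h.pos
  refine MeromorphicAt.congr (f := fun t => quartic (adaptedForm z s t)) ?_ ?_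
  · exact (meromorphicAt_adaptedForm (h.an_z _ hc) (h.an_s _ hc) 0 2).mul
      ((meromorphicAt_adaptedForm (h.an_z _ hc) (h.an_s _ hc) 3 1).pow 3)
  · filter_upwards [h.eventually_not_mem_critSet hf] with t ⟨ht, hcrit⟩
    rw [quarticDifferential_eq hf ((isOpen_chartBall p R).inter (isClosed_critSet hf).isOpen_compl)
      (h.isAdapted_normalFrame hf) ⟨h.symm_mem ht, hcrit⟩ hcrit, h.mcForm_normalFrame hf ht hcrit]

end

/-! ### The projective structure -/

/-- The `2 × 2` matrix whose entries are those of `etaForm`. -/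
def etaMat (φ : Mat4) : Mat2 :=
  !![φ 1 1, -cbrt (3 / 32) * φ 1 3; -cbrt (1 / 6) * φ 3 1, -φ 1 1]

lemma etaMat_pfaffForm (p h r s : ℂ) : etaMat (pfaffForm p h r s) =
    !![p, -cbrt (3 / 32) * r; -cbrt (1 / 6) * h, -p] := by
  simp [etaMat, pfaffForm]

/-- The upper triangular conjugates of the projective connection. -/
lemma etaMat_conj {x : SL2} (hx : x ∈ SL2up) (p h r s : ℂ) :
    etaMat ((repS x)⁻¹ * (pfaffForm p h r s * repS x)) =
      (x⁻¹).1 * etaMat (pfaffForm p h r s) * x.1 := by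
  obtain ⟨h11, h0⟩ := SL2up_apply_one_one hx
  have h10 : x.1 1 0 = 0 := hx
  have hk := cbrt_ne_zero (show (0 : ℝ) < 2 / 9 by norm_num)
  have hk3 := cbrt_two_ninths_cube
  rw [repS_of_mem_SL2up hx, upMat_conj_pfaffForm h0, etaMat_pfaffForm, etaMat_pfaffForm,
    cbrt_three_div, cbrt_one_sixth]
  have hinv : (x⁻¹).1 = !![x.1 1 1, -x.1 0 1; -x.1 1 0, x.1 0 0] := by
    rw [Matrix.SpecialLinearGroup.coe_inv, Matrix.adjugate_fin_two]
  rw [hinv, Matrix.eta_fin_two x.1, h11, h10]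
  generalize x.1 0 0 = a at *
  generalize x.1 0 1 = b at *
  generalize cbrt (2 / 9) = k at *
  ext i j; fin_cases i <;> fin_cases j <;> simp [Matrix.mul_apply] <;>
    field_simp <;> try ring

lemma analyticAt_etaMat {φ : ℂ → Mat4} {t : ℂ} (h11 : AnalyticAt ℂ (fun t => φ t 1 1) t)
    (h13 : AnalyticAt ℂ (fun t => φ t 1 3) t) (h31 : AnalyticAt ℂ (fun t => φ t 3 1) t) (i j) :
    AnalyticAt ℂ (fun t => etaMat (φ t) i j) t := by
  fin_cases i <;> fin_cases j
  · exact h11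
  · exact analyticAt_const.mul h13
  · exact analyticAt_const.mul h31
  · exact h11.neg

lemma meromorphicAt_etaMat {φ : ℂ → Mat4} {t : ℂ}
    (h : ∀ i j, MeromorphicAt (fun t => φ t i j) t) (i j) :
    MeromorphicAt (fun t => etaMat (φ t) i j) t := by
  fin_cases i <;> fin_cases j
  · exact h 1 1
  · exact (MeromorphicAt.const _ t).mul (h 1 3)
  · exact (MeromorphicAt.const _ t).mul (h 3 1)
  · exact (h 1 1).neg

section

variable {S : Type*} [TopologicalSpace S] [ChartedSpace ℂ S]

lemma etaForm_apply (a : S × Mat4) (w : TangentSpace 𝓘(ℂ, ℂ) a.1 × Mat4) :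
    etaForm a w = etaMat (mcForm a w) := rfl

/-- On the Lie algebra of `H1` the form η inverts the differential of the representation: the
constant `cbrt (3 / 32)` = (3/4)`cbrt (2 / 9)` undoes the factor 4/3 of `upMatDeriv` and the
rescaling by `cbrt (2 / 9)`. -/
lemma etaForm_vertical {A : Mat4} (hA : A ∈ Sp2) (p : S) {V : Set ℂ} {x : ℂ → SL2} (hV : IsOpen V)
    (h0 : (0 : ℂ) ∈ V) (hx : MatHolOn (fun t => (x t).1) V) (hup : ∀ t ∈ V, x t ∈ SL2up)
    (hx0 : x 0 = 1) :
    etaForm (p, A) (0, matD (fun t => A * repS (x t)) (0 : ℂ) (1 : ℂ)) =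
      matD (fun t => (x t).1) (0 : ℂ) (1 : ℂ) := by
  have hk := cbrt_ne_zero (show (0 : ℝ) < 2 / 9 by norm_num)
  have hev : ∀ᶠ t in 𝓝 (0 : ℂ), x t ∈ SL2up := Filter.eventually_of_mem (hV.mem_nhds h0) hup
  have hxd : MatDerivAt (fun t => (x t).1) (matDeriv (fun t => (x t).1) 0) 0 := fun i j =>
    ((matHolOn_iff_differentiableOn.1 hx i j).differentiableAt (hV.mem_nhds h0)).hasDerivAt
  obtain ⟨X, hX⟩ : ∃ X, X = matDeriv (fun t => (x t).1) 0 := ⟨_, rfl⟩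
  rw [← hX] at hxd
  have h00 : (x 0).1 0 0 = 1 := by rw [hx0]; simp
  have h01 : (x 0).1 0 1 = 0 := by rw [hx0]; simp
  have h10 : X 1 0 = 0 := (hxd 1 0).unique
    ((hasDerivAt_const (0 : ℂ) (0 : ℂ)).congr_of_eventuallyEq (hev.mono fun t ht => ht))
  have hd00 : HasDerivAt (fun t => (x t).1 0 0) (X 0 0) 0 := hxd 0 0
  have hd01 : HasDerivAt (fun t => (x t).1 0 1) (X 0 1) 0 := hxd 0 1
  have hne : (x 0).1 0 0 ≠ 0 := by rw [h00]; exact one_ne_zero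
  have h11 : X 1 1 = -X 0 0 := by
    have h2 := hd00.fun_inv hne
    rw [h00, one_pow, div_one] at h2
    exact (hxd 1 1).unique (h2.congr_of_eventuallyEq
      (hev.mono fun t ht => (SL2up_apply_one_one ht).1))
  have h1 := matDerivAt_upMat hd00 (hd01.div_const (cbrt (2 / 9))).fun_neg hne
  rw [h00, h01, upMatDeriv, zero_div, neg_zero, upMat_one_zero, Matrix.one_mul] at h1
  have h2 := ((matDerivAt_const A 0).mul h1).congr (B := fun t => A * repS (x t))
    (hev.mono fun t ht => by rw [repS_of_mem_SL2up ht])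
  rw [Matrix.zero_mul, zero_add] at h2
  rw [matD_complex, matD_complex, h2.matDeriv_eq, ← hX]
  change etaMat (A⁻¹ * (A * _)) = _
  rw [Sp2_inv_mul_cancel hA, etaMat_pfaffForm, cbrt_three_div, Matrix.eta_fin_two X, h10, h11]
  ext i j; fin_cases i <;> fin_cases j <;> simp
  field_simp

lemma pullCoeff_etaForm (σ : S → Mat4) (p : S) (t : ℂ) : pullCoeff etaForm σ p t =
    etaMat ((σ ((chartAt ℂ p).symm t))⁻¹ * matD σ ((chartAt ℂ p).symm t) (coordVec p t)) := rfl

variable [IsManifold 𝓘(ℂ, ℂ) 1 S]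

lemma analyticAt_pullCoeff {U : Set S} {σ : S → Mat4} (hU : IsOpen U) (hσ : MatHolOn σ U)
    (hsp : ∀ q ∈ U, σ q ∈ Sp2) {p : S} (hp : p ∈ U) (i j) :
    AnalyticAt ℂ (fun t => pullCoeff etaForm σ p t i j) (chartAt ℂ p p) := by
  have hsymm : (chartAt ℂ p).symm (chartAt ℂ p p) ∈ U := by
    rwa [(chartAt ℂ p).left_inv (mem_chart_source ℂ p)]
  have hev := eventually_chart_symm (mem_chart_target ℂ p) hU hsymm
  have hσa := hσ.analyticAt_self hU hp
  have h1 := (hσa.inv_of_Sp2 (hev.mono fun t ht => hsp _ ht)).mul hσa.matDeriv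
  have h2 : MatAnalyticAt (fun t => (σ ((chartAt ℂ p).symm t))⁻¹ *
      matD σ ((chartAt ℂ p).symm t) (coordVec p t)) (chartAt ℂ p p) := by
    refine h1.congr ?_
    filter_upwards [hev, eventually_mem_target (mem_chart_target ℂ p)] with t ht ht'
    rw [(hσ.matDerivAt_chart hU p ht' ht).matDeriv_eq]
  exact analyticAt_etaMat (h2 1 1) (h2 1 3) (h2 3 1) i j

variable {f : S → Q3} [PreconnectedSpace S]

/-- In the coordinates (c, α, β) of a tangent vector the map is triangular: h ≠ 0 recovers c from
the lower left entry, and the vertical parameters α and β then adjust the diagonal and upper right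
entries freely. -/
lemma bijOn_etaForm (hf : IsIsotropicCurve f) {a : S × Mat4} (ha : a ∈ adaptedBundle f) :
    Set.BijOn (etaForm a) (tangent (adaptedBundle f) a) {X : Mat2 | X.trace = 0} := by
  obtain ⟨p, U, σ, hp, hU, hpU, hσ, rfl⟩ := ha
  have hc3 : cbrt (3 / 32) ≠ 0 := cbrt_ne_zero (by norm_num)
  have hc6 : cbrt (1 / 6) ≠ 0 := cbrt_ne_zero (by norm_num)
  let v : TangentSpace 𝓘(ℂ, ℂ) p := (1 : ℂ)
  have hv : ∀ v' : TangentSpace 𝓘(ℂ, ℂ) p, ∃ c : ℂ, v' = c • v := fun v' =>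
    ⟨v', (mul_one (M := ℂ) v').symm⟩
  obtain ⟨P, h, r, s, h0, he⟩ := hσ.form p hpU v
  have hh : h ≠ 0 := h0 (show v ≠ 0 from one_ne_zero (α := ℂ))
  have hsp := (hσ.frame p hpU).1
  have hform : ∀ (c α β : ℂ), etaForm (p, σ p) (c • v, matD σ p (c • v) + σ p * pfaffForm α 0 β 0) =
      !![c * P + α, -cbrt (3 / 32) * (c * r + β); -cbrt (1 / 6) * (c * h), -(c * P + α)] := by
    intro c α β
    rw [etaForm_apply]
    change etaMat ((σ p)⁻¹ * (matD σ p (c • v) + σ p * pfaffForm α 0 β 0)) = _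
    rw [Matrix.mul_add, Sp2_inv_mul_cancel hsp, matD_smul, Matrix.mul_smul, he, smul_pfaffForm,
      pfaffForm_add, etaMat_pfaffForm, add_zero]
  have hmem : ∀ w, w ∈ tangent (adaptedBundle f) (p, σ p) ↔
      ∃ c α β : ℂ, w = (c • v, matD σ p (c • v) + σ p * pfaffForm α 0 β 0) := by
    rintro ⟨w1, w2⟩
    rw [mem_tangent_adaptedBundle_iff hf hU hσ hpU hp]
    constructor
    · rintro ⟨α, β, hw⟩
      obtain ⟨c, rfl⟩ := hv w1
      exact ⟨c, α, β, Prod.ext rfl hw⟩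
    · rintro ⟨c, α, β, hw⟩
      obtain ⟨rfl, rfl⟩ := Prod.mk.inj hw
      exact ⟨α, β, rfl⟩
  refine ⟨fun w hw => ?_, fun w hw w' hw' heq => ?_, fun X hX => ?_⟩
  · obtain ⟨c, α, β, rfl⟩ := (hmem w).1 hw
    change (etaForm _ _).trace = 0
    rw [hform, Matrix.trace_fin_two]
    simp
  · obtain ⟨c, α, β, rfl⟩ := (hmem w).1 hw
    obtain ⟨c', α', β', rfl⟩ := (hmem w').1 hw'
    rw [hform, hform] at heq
    have e00 := congrFun (congrFun heq 0) 0
    have e01 := congrFun (congrFun heq 0) 1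
    have e10 := congrFun (congrFun heq 1) 0
    have e10' : c = c' := mul_right_cancel₀ hh (mul_left_cancel₀ (neg_ne_zero.2 hc6) e10)
    subst e10'
    simp [hc3] at e00 e01
    rw [e00, e01]
  · have htr : X 1 1 = -X 0 0 := by
      have : X 0 0 + X 1 1 = 0 := by rw [← Matrix.trace_fin_two]; exact hX
      linear_combination this
    obtain ⟨c, hc⟩ : ∃ c, c = X 1 0 / (-cbrt (1 / 6) * h) := ⟨_, rfl⟩
    refine ⟨_, (hmem _).2 ⟨c, X 0 0 - c * P, X 0 1 / (-cbrt (3 / 32)) - c * r, rfl⟩, ?_⟩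
    rw [hform, Matrix.eta_fin_two X, htr, hc]
    ext i j; fin_cases i <;> fin_cases j <;> simp <;> field_simp

lemma isProjectiveStructure_adaptedBundle (hf : IsIsotropicCurve f) :
    IsProjectiveStructure (critSet f)ᶜ (adaptedBundle f) etaForm where
  isOpen := (isClosed_critSet hf).isOpen_compl
  base a ha := ((isReduction_adaptedBundle hf).sub a ha).1
  act a ha x hx := (isReduction_adaptedBundle hf).act a ha _ <| by
    rw [repS_of_mem_SL2up hx]
    exact mem_H1_iff.2 ⟨_, _, (SL2up_apply_one_one hx).2, rfl⟩
  simply_trans a ha b hb hab := by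
    obtain ⟨X, hX, h⟩ := adaptedBundle_trans hf a ha b hb hab
    obtain ⟨c, d, hc, rfl⟩ := mem_H1_iff.1 hX
    refine ⟨upSL c d hc, ⟨upSL_mem hc, by rw [repS_upSL, h]⟩, fun y ⟨hy, h'⟩ => ?_⟩
    apply repS_injOn hy (upSL_mem hc)
    have hsp := ((isReduction_adaptedBundle hf).sub a ha).2.1
    rw [repS_upSL, ← Sp2_inv_mul_cancel hsp (repS y), ← h', h, Sp2_inv_mul_cancel hsp]
  section_exists p hp := (isReduction_adaptedBundle hf).section_exists p hp
  hol U σ hU hσ p hp i j := analyticAt_pullCoeff hU hσ.1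
    (fun q hq => ((isReduction_adaptedBundle hf).sub _ (hσ.2 q hq)).2.1) hp i j
  iso a ha := bijOn_etaForm hf ha
  vertical a ha V x hV h0 hx hup hx0 :=
    etaForm_vertical ((isReduction_adaptedBundle hf).sub a ha).2.1 a.1 hV h0 hx hup hx0
  equivariant := by
    rintro _ ⟨p, U, σ, hp, hU, hpU, hσ, rfl⟩ x hx w hw
    obtain ⟨α, β, h⟩ := adaptedBundle_mcForm_eq hf hU hσ hpU hp hw
    obtain ⟨P, c, r, s, -, he⟩ := hσ.form p hpU w.1
    rw [he, pfaffForm_add] at h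
    rw [etaForm_apply, etaForm_apply, h, ← etaMat_conj hx, ← h]
    change etaMat ((σ p * repS x)⁻¹ * (w.2 * repS x)) =
      etaMat ((repS x)⁻¹ * ((σ p)⁻¹ * w.2 * repS x))
    rw [Matrix.mul_inv_rev, Matrix.mul_assoc, Matrix.mul_assoc]

/-! ### Behaviour of the projective structure at the critical points -/

variable {p : S} {R : ℝ} {B : Mat4} {x y z s : ℂ → ℂ}

lemma IsNormalForm.isSection_normalFrame (hf : IsIsotropicCurve f)
    (h : IsNormalForm f p R B x y z s) {V : Set S} (hV : V ⊆ chartBall p R ∩ (critSet f)ᶜ) :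
    IsSection (adaptedBundle f) V (normalFrame p B x y z s) :=
  ⟨fun i j => ((h.isAdapted_normalFrame hf).hol i j).mono hV, fun _ hq =>
    (h.isAdapted_normalFrame hf).mem_adaptedBundle
      ((isOpen_chartBall p R).inter (isClosed_critSet hf).isOpen_compl) (hV hq) (hV hq).2⟩

lemma IsNormalForm.diff_singleton_subset (hf : IsIsotropicCurve f)
    (h : IsNormalForm f p R B x y z s) :
    chartBall p R \ {p} ⊆ chartBall p R ∩ (critSet f)ᶜ := fun _ hq =>
  ⟨hq.1, fun hcrit => hq.2 (h.eq_of_mem_critSet hf hq.1 hcrit)⟩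

lemma IsNormalForm.eventually_pullCoeff_eq (hf : IsIsotropicCurve f)
    (h : IsNormalForm f p R B x y z s) : ∀ᶠ t in 𝓝[≠] (chartAt ℂ p p),
      pullCoeff etaForm (normalFrame p B x y z s) p t = etaMat (adaptedForm z s t) := by
  filter_upwards [h.eventually_not_mem_critSet hf] with t ⟨ht, hcrit⟩
  rw [pullCoeff_etaForm, h.mcForm_normalFrame hf ht hcrit]

/-- The adapted frames define a meromorphic projective structure. -/
lemma isMeromorphicProjectiveStructure_adaptedBundle (hf : IsIsotropicCurve f) :
    IsMeromorphicProjectiveStructure (critSet f) (adaptedBundle f) etaForm where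
  closed := isClosed_critSet hf
  discrete := isDiscrete_critSet hf
  projective := isProjectiveStructure_adaptedBundle hf
  meromorphic p hp := by
    obtain ⟨R, B, x, y, z, s, h⟩ := exists_isNormalForm hf p
    have hc := Metric.mem_ball_self (x := chartAt ℂ p p) h.pos
    refine ⟨chartBall p R, normalFrame p B x y z s, isOpen_chartBall p R, ?_,
      h.isSection_normalFrame hf (h.diff_singleton_subset hf), fun i j => ?_⟩
    · ext q
      refine ⟨fun hq => h.eq_of_mem_critSet hf hq.1 hq.2, ?_⟩
      rintro rfl
      exact ⟨mem_chartBall_self _ h.pos, hp⟩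
    · exact (meromorphicAt_etaMat (meromorphicAt_adaptedForm (h.an_z _ hc) (h.an_s _ hc)) i j).congr
        ((h.eventually_pullCoeff_eq hf).mono fun t ht => (congrFun (congrFun ht i) j).symm)

/-- The singular points of the projective structure are critical points. -/
lemma singularLocus_subset (hf : IsIsotropicCurve f) :
    singularLocus (adaptedBundle f) etaForm ⊆ critSet f := by
  intro p hp
  by_contra hcrit
  apply hp
  obtain ⟨R, B, x, y, z, s, h⟩ := exists_isNormalForm hf p
  have hc := Metric.mem_ball_self (x := chartAt ℂ p p) h.pos
  have hne : deriv z (chartAt ℂ p p) ≠ 0 ∧ deriv s (chartAt ℂ p p) ≠ 0 := by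
    rwa [← (chartAt ℂ p).left_inv (mem_chart_source ℂ p), h.mem_critSet_iff hf hc, not_or] at hcrit
  have hz := h.an_z _ hc
  have hs := h.an_s _ hc
  refine ⟨chartBall p R, normalFrame p B x y z s, fun t => etaMat (adaptedForm z s t),
    isOpen_chartBall p R, mem_chartBall_self p h.pos,
    h.isSection_normalFrame hf (h.diff_singleton_subset hf), ?_, h.eventually_pullCoeff_eq hf, ?_⟩
  · exact analyticAt_etaMat (hs.deriv.mul (analyticAt_curvP hz hs hne.1 hne.2))
      (hs.deriv.mul (analyticAt_curvR hz hs hne.1 hne.2))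
      (hs.deriv.mul (analyticAt_curvZ hz hs hne.2))
  -- The lower left entry is -(1/6)^(1/3) s' · (z'/s') = -(1/6)^(1/3) z', which is nonzero at a
  -- noncritical point.
  · simp only [adaptedForm, smul_pfaffForm, etaMat_pfaffForm]
    exact mul_ne_zero (neg_ne_zero.2 (cbrt_ne_zero (by norm_num)))
      (mul_ne_zero hne.2 (curvZ_ne_zero hne.1 hne.2))

end

end IsotropicCurve
end

theorem theoremB {S : Type*} [TopologicalSpace S] [T2Space S] [ConnectedSpace S] [ChartedSpace ℂ S]
    [IsManifold 𝓘(ℂ, ℂ) 1 S] (f : S → Q3) (hf : IsIsotropicCurve f) :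
    ∃ F : Set (S × Mat4),
      (IsReduction f (critSet f)ᶜ H1 F ∧ IsIntegralManifold F) ∧
      (∀ F' : Set (S × Mat4), IsReduction f (critSet f)ᶜ H1 F' → IsIntegralManifold F' → F' = F) ∧
      (∃ δ : ∀ p : S, TangentSpace 𝓘(ℂ, ℂ) p → ℂ,
        IsMeromorphicDifferential 4 δ ∧
        ∀ a ∈ F, ∀ w ∈ tangent F a, δ a.1 w.1 = mcForm a w 0 2 * (mcForm a w 3 1) ^ 3) ∧
      IsMeromorphicProjectiveStructure (critSet f) F etaForm ∧
      singularLocus F etaForm ⊆ critSet f := by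
  exact ⟨adaptedBundle f,
    ⟨isReduction_adaptedBundle hf, isIntegralManifold_adaptedBundle hf⟩,
    fun _ hF hint => hF.eq_adaptedBundle hf hint,
    ⟨quarticDifferential f, isMeromorphicDifferential_quarticDifferential hf,
      quarticDifferential_fst hf⟩,
    isMeromorphicProjectiveStructure_adaptedBundle hf, singularLocus_subset hf⟩
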